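/- For a measurable bounded control $u:[0,1]\to\mathbb R$ put $\theta(t)=\int_0^t u$, $S_z(t)=\int_0^t\cos 2\theta$, $S_x(t)=\int_0^t\sin 2\theta$, and for $\gamma\ge 0$ define the cost $$C_\gamma(u)=\tfrac12\int_0^1u^2\,dt+\tfrac{\gamma}{2}\bigl(S_z(1)^2+S_x(1)^2\bigr).$$ The NOT-gate problem with penalty $\gamma$ is to minimize $C_\gamma(u)$ subject to $\theta(1)=\pi/2$. An extremal is a control $u$ with $\theta(1)=\pi/2$ for which there are a constant $\mu\le 0$ and a costate $(\lambda_\theta,\lambda_z,\lambda_x)$ on $[0,1]$, not both identically zero, satisfying the Pontryagin maximum principle with Hamiltonian $$\hat H=\lambda_\theta u+\lambda_z\cos2\theta+\lambda_x\sin2\theta+\mu\bigl(\tfrac12u^2+\gamma(S_z\cos2\theta+S_x\sin2\theta)\bigr),$$ that is: for a.e. $t$ the value $u(t)$ maximizes $\hat H$ over $\mathbb R$; $\dot\lambda_\theta=-\partial_\theta\hat H$, $\dot\lambda_z=-\partial_{S_z}\hat H$, $\dot\lambda_x=-\partial_{S_x}\hat H$; $\hat H$ is constant along the trajectory; and $\lambda_z(1)=\lambda_x(1)=0$.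 The control of an extremal is taken to be continuous on $[0,1]$ (its continuous representative) when $u(0)$ and switches are considered; a switch is a time in $(0,1)$ at which $u$ changes sign. For $k\ge0$ let $$I(k)=\int_0^{\pi/2}\frac{dx}{\sqrt{k+\sin x}},\qquad J(k)=\int_0^{\pi/2}\frac{\sin x\,dx}{\sqrt{k+\sin x}},$$ for $0\le k<1$ let $$A(k)=\int_{-\arcsin k}^0\frac{dx}{\sqrt{k+\sin x}},\qquad B(k)=\int_{-\arcsin k}^0\frac{\sin x\,dx}{\sqrt{k+\sin x}},$$ and put $I_1=2A+I$, $J_1=2B+J$, $I_{+m}=2mA+(2m+1)I$, $J_{+m}=2mB+(2m+1)J$, $C_{+m}(k)=\frac{I_{+m}(k)}2\bigl(kI_{+m}(k)+\frac32J_{+m}(k)\bigr)$, and $\gamma_c=I(0)^3/(2J(0))$. The simplest extremal for $\gamma\ge0$ is the solution on $[0,1]$ of $\dot\theta=u$, $\dot u=2\gamma S\cos2\theta$, $\theta(0)=0$, $u(0)=c$, where - if $\gamma=0$: $c=\pi/2$, $S=2/\pi$; - if $0<\gamma\le\gamma_c$: $c=\sqrt k\,I(k)$, $S=J(k)/I(k)$,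 with $k\ge0$ such that $2\gamma=I(k)^3/J(k)$; - if $\gamma>\gamma_c$: $c=-\sqrt k\,I_1(k)$, $S=I_1(k)^2/(2\gamma)$, with $k\in(0,1)$ such that $2\gamma=I_1(k)^3/J_1(k)$. **Proposition.** The function $J_1$ has exactly one zero $k_{\lim}$ in $(0,1)$. Put $U=\frac12k_{\lim}I_1(k_{\lim})^2$; then $U<3\pi$. For every $\gamma\ge0$ the simplest extremal exists and is unique, it is an extremal with $S_x(1)=S$, and its cost is at most $U$. Moreover, for every $\gamma\ge0$: 1. If an extremal has $u(0)=c\ge0$ and exactly $2m$ switches with $m\ge1$, then $\gamma>0$, $S_x(1)>0$, the number $k=c^2/(2\gamma S_x(1))$ lies in $[0,1)$ and satisfies $I_{+m}(k)=\sqrt{2\gamma S_x(1)}$ and $2\gamma=I_{+m}(k)^3/J_{+m}(k)$, and the cost of the extremal is $$C_{+m}(k)\ \ge\ \frac{(2m+1)^2\pi}{3}\ \ge\ 3\pi\ >\ U .$$ 2. No extremal with $u(0)\ge0$ has a cost lower than that of the simplest extremal. 3. The simplest extremal is optimal: $C_\gamma$ at its control is at most $C_\gamma(u)$ for every measurable bounded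 control $u$ that realizes a NOT gate, i.e. with $\theta(1)\in\frac\pi2+\pi\mathbb Z$. -/

import Mathlib

open Set MeasureTheory

namespace NotGate

/-- The angle of the nominal evolution, `θ' = u`, `θ(0) = 0`. -/
noncomputable def angle (u : ℝ → ℝ) (t : ℝ) : ℝ := ∫ s in (0 : ℝ)..t, u s

/-- The sensitivity component `S_z' = cos (2 θ)`, `S_z(0) = 0`. -/
noncomputable def Sz (u : ℝ → ℝ) (t : ℝ) : ℝ := ∫ s in (0 : ℝ)..t, Real.cos (2 * angle u s)

/-- The sensitivity component `S_x' = sin (2 θ)`, `S_x(0) = 0`. -/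
noncomputable def Sx (u : ℝ → ℝ) (t : ℝ) : ℝ := ∫ s in (0 : ℝ)..t, Real.sin (2 * angle u s)

/-- Controls on the time interval `[0, 1]`: (Lebesgue) measurable and bounded. The values of `u`
outside `[0, 1]` play no role. -/
structure IsControl (u : ℝ → ℝ) : Prop where
  measurable : AEMeasurable u (volume.restrict (Icc 0 1))
  bounded : ∃ M : ℝ, ∀ t ∈ Icc (0 : ℝ) 1, |u t| ≤ M

/-- The cost: energy plus `γ` times the sensitivity cost. -/
noncomputable def cost (γ : ℝ) (u : ℝ → ℝ) : ℝ :=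
  (1 / 2) * (∫ t in (0 : ℝ)..1, u t ^ 2) + γ * ((1 / 2) * (Sz u 1 ^ 2 + Sx u 1 ^ 2))

/-- The control Hamiltonian of the maximum principle, with costate `(pθ, pz, px)`, multiplier `μ`,
state `(θ, z, x)`, control value `v`, and running cost `v² / 2 + γ (z cos 2θ + x sin 2θ)`
(whose integral is `cost`). -/
noncomputable def hamiltonian (γ μ pθ pz px θ z x v : ℝ) : ℝ :=
  pθ * v + pz * Real.cos (2 * θ) + px * Real.sin (2 * θ)
    + μ * ((1 / 2) * v ^ 2 + γ * (z * Real.cos (2 * θ) + x * Real.sin (2 * θ)))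

/-- The control `u` and its trajectory form an extremal of the problem of steering `θ` from `0` to
`π / 2` on `[0, 1]` with `S_z(1)`, `S_x(1)` free: `u` is a control with `θ(1) = π / 2` and the
conditions of the Pontryagin maximum principle hold. -/
def IsExtremal (γ : ℝ) (u : ℝ → ℝ) : Prop :=
  IsControl u ∧ angle u 1 = Real.pi / 2 ∧
  ∃ (μ : ℝ) (pθ pz px : ℝ → ℝ),
    -- the multiplier is nonpositive, and the multiplier and the costate do not both vanish
    μ ≤ 0 ∧ (μ ≠ 0 ∨ ∃ t ∈ Icc (0 : ℝ) 1, pθ t ≠ 0 ∨ pz t ≠ 0 ∨ px t ≠ 0) ∧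
    -- maximization of the Hamiltonian
    (∀ᵐ t ∂(volume.restrict (Icc (0 : ℝ) 1)), ∀ v : ℝ,
      hamiltonian γ μ (pθ t) (pz t) (px t) (angle u t) (Sz u t) (Sx u t) v
        ≤ hamiltonian γ μ (pθ t) (pz t) (px t) (angle u t) (Sz u t) (Sx u t) (u t)) ∧
    -- costate equations: minus the partial derivatives of the Hamiltonian in `θ`, `z`, `x`
    (∀ t ∈ Icc (0 : ℝ) 1,
      HasDerivWithinAt pθ (2 * (pz t + μ * γ * Sz u t) * Real.sin (2 * angle u t)
        - 2 * (px t + μ * γ * Sx u t) * Real.cos (2 * angle u t)) (Icc 0 1) t) ∧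
    (∀ t ∈ Icc (0 : ℝ) 1,
      HasDerivWithinAt pz (-(μ * γ * Real.cos (2 * angle u t))) (Icc 0 1) t) ∧
    (∀ t ∈ Icc (0 : ℝ) 1,
      HasDerivWithinAt px (-(μ * γ * Real.sin (2 * angle u t))) (Icc 0 1) t) ∧
    -- the Hamiltonian is constant along the trajectory
    (∃ h : ℝ, ∀ᵐ t ∂(volume.restrict (Icc (0 : ℝ) 1)),
      hamiltonian γ μ (pθ t) (pz t) (px t) (angle u t) (Sz u t) (Sx u t) (u t) = h) ∧
    -- transversality
    pz 1 = 0 ∧ px 1 = 0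

/-- A switch: an interior time at which the control changes sign. -/
def IsSwitch (u : ℝ → ℝ) (t : ℝ) : Prop :=
  t ∈ Ioo (0 : ℝ) 1 ∧ ∃ ε > 0,
    ((∀ s ∈ Ioo (t - ε) t, u s < 0) ∧ (∀ s ∈ Ioo t (t + ε), 0 < u s)) ∨
    ((∀ s ∈ Ioo (t - ε) t, 0 < u s) ∧ (∀ s ∈ Ioo t (t + ε), u s < 0))

/-- The elliptic integral `I(k)`. -/
noncomputable def ellI (k : ℝ) : ℝ :=
  ∫ x in (0 : ℝ)..(Real.pi / 2), 1 / Real.sqrt (k + Real.sin x)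

/-- The elliptic integral `J(k)`. -/
noncomputable def ellJ (k : ℝ) : ℝ :=
  ∫ x in (0 : ℝ)..(Real.pi / 2), Real.sin x / Real.sqrt (k + Real.sin x)

/-- The elliptic integral `A(k)`. -/
noncomputable def ellA (k : ℝ) : ℝ :=
  ∫ x in (-Real.arcsin k)..(0 : ℝ), 1 / Real.sqrt (k + Real.sin x)

/-- The elliptic integral `B(k)`. -/
noncomputable def ellB (k : ℝ) : ℝ :=
  ∫ x in (-Real.arcsin k)..(0 : ℝ), Real.sin x / Real.sqrt (k + Real.sin x)

/-- `I_1(k)`. -/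
noncomputable def Ione (k : ℝ) : ℝ := 2 * ellA k + ellI k

/-- `J_1(k)`. -/
noncomputable def Jone (k : ℝ) : ℝ := 2 * ellB k + ellJ k

/-- `I_{+m}(k)`. -/
noncomputable def Iplus (m : ℕ) (k : ℝ) : ℝ := 2 * m * ellA k + (2 * m + 1) * ellI k

/-- `J_{+m}(k)`. -/
noncomputable def Jplus (m : ℕ) (k : ℝ) : ℝ := 2 * m * ellB k + (2 * m + 1) * ellJ k

/-- `C_{+m}(k)`. -/
noncomputable def Cplus (m : ℕ) (k : ℝ) : ℝ :=
  Iplus m k / 2 * (k * Iplus m k + 3 / 2 * Jplus m k)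

/-- The critical value of `γ`. -/
noncomputable def γc : ℝ := ellI 0 ^ 3 / (2 * ellJ 0)

/-- The parameters `c = u(0)` and `S = S_x(1)` of the simplest extremal. -/
def SimplestParams (γ c S : ℝ) : Prop :=
  (γ = 0 ∧ c = Real.pi / 2 ∧ S = 2 / Real.pi) ∨
  (0 < γ ∧ γ ≤ γc ∧ ∃ k : ℝ, 0 ≤ k ∧ 2 * γ = ellI k ^ 3 / ellJ k ∧
    c = Real.sqrt k * ellI k ∧ S = ellJ k / ellI k) ∨
  (γc < γ ∧ ∃ k : ℝ, 0 < k ∧ k < 1 ∧ 2 * γ = Ione k ^ 3 / Jone k ∧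
    c = -(Real.sqrt k * Ione k) ∧ S = Ione k ^ 2 / (2 * γ))

/-- The control `u` of the simplest extremal: the solution on `[0, 1]` of `θ' = u`,
`u' = 2 γ S cos (2 θ)`, `θ(0) = 0`, `u(0) = c` with the above parameters. -/
def IsSimplest (γ : ℝ) (u : ℝ → ℝ) : Prop :=
  ∃ c S : ℝ, SimplestParams γ c S ∧ u 0 = c ∧
    ∀ t ∈ Icc (0 : ℝ) 1,
      HasDerivWithinAt u (2 * γ * S * Real.cos (2 * angle u t)) (Icc 0 1) t

end NotGate

/-! Extremals are pendulum motions. The costate equations and transversality give `u' = 2γ(S_x cos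
2θ - S_z sin 2θ)` with the terminal values `S_x`, `S_z`. Integrating gives `u(1) = u(0)`, and the
energy balance between `θ = 0` and `θ = π/2` then forces `γ S_z = 0` (`IsExtremal.pendulum`). With
`ε = 2γS_x > 0` and `u² = ε(k + sin 2θ)`, `0 ≤ k < 1`, the motion is `sin(θ - π/4) = √m sin φ`, `m =
(1 + k)/2`, for an increasing phase `φ`. Duration and `S_x` become Legendre integrals over the phase
interval, and switches are the zeros of `cos φ` (`IsPendulum.structure`).

Optimality does not come from comparing extremals but from a lower bound for every control with
`θ(1) = π/2` (`IsControl.cost_ge`). Completing the square replaces the sensitivity cost by a linear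
term with multiplier `ε`. Then `u²/2 + (ε/2)(k + sin 2θ) ≥ √ε |u| √(k + sin 2θ)` bounds the cost by
a weighted length of the path, which is controlled by the range of `θ` alone. If `θ` overshoots `[0,
π/2]` by `a` below and `b` above, rotating the sensitivity vector by `b - a` centres the range. Only
`s = a + b`, capped at `π/2`, then matters, and for `k = sin s` the length is at least `turnAction
(sin s)`.

The function `turnAction k = k I₁ + J₁` lies above its tangents of slope `I₁/2`
(`turnAction_tangent_le`), being twice a convex integral minus a concave one. With `ε = I₁(k)²`, the
tangent at `k` cancels the dependence on `s` and leaves exactly the cost of the simplest extremal.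
For `γ ≤ γ_c` the same works with `I` and `zeroAction`. The tangent inequality also shows that `J₁`
decreases strictly, hence has at most one zero, and at `k = 1` it yields `U < 3π`.

The path with parameter `k_lim` has zero sensitivity, so it costs `U` for every `γ`, and optimality
bounds the simplest extremal by `U`. The bound on `C_{+m}` is Cauchy–Schwarz (`pi_div_two_sq_le`).
Among the other gates, `θ(1) = -π/2` is a mirror image and the rest cost at least `9π²/8 > 3π`. -/

namespace NotGate
open Real

/-! ### Legendre normal form of the elliptic integrals -/

/-- The substitution `sin x = 1 - 2 m sin² φ`. -/
noncomputable def turn (m φ : ℝ) : ℝ := π / 2 - 2 * arcsin (√m * sin φ)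

/-- The square root in the Legendre form of the elliptic integrals. -/
noncomputable def delta (m φ : ℝ) : ℝ := √(1 - m * sin φ ^ 2)

theorem mul_sin_sq_lt_one {m φ : ℝ} (hm : m < 1) : m * sin φ ^ 2 < 1 := by
  rcases le_total m 0 with h | h
  · linarith [mul_nonpos_of_nonpos_of_nonneg h (sq_nonneg (sin φ))]
  · linarith [mul_le_mul_of_nonneg_left (sin_sq_le_one φ) h]

theorem delta_pos {m : ℝ} (hm : m < 1) (φ : ℝ) : 0 < delta m φ :=
  sqrt_pos.2 (sub_pos.2 (mul_sin_sq_lt_one hm))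

theorem delta_sq {m : ℝ} (hm : m ≤ 1) (φ : ℝ) : delta m φ ^ 2 = 1 - m * sin φ ^ 2 := by
  rw [delta, sq_sqrt]
  nlinarith [sin_sq_le_one φ, sq_nonneg (sin φ)]

theorem continuous_delta (m : ℝ) : Continuous (delta m) := by
  unfold delta; fun_prop

theorem sqrt_mul_sin_mem {m φ : ℝ} (hm : m ≤ 1) :
    √m * sin φ ∈ Icc (-1 : ℝ) 1 := by
  have h1 : √m ≤ 1 := sqrt_le_one.2 hm
  have h2 := sqrt_nonneg m
  constructor <;> nlinarith [sin_le_one φ, neg_one_le_sin φ]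

theorem sin_turn {m φ : ℝ} (hm0 : 0 ≤ m) (hm : m ≤ 1) :
    sin (turn m φ) = 1 - 2 * m * sin φ ^ 2 := by
  have h := sqrt_mul_sin_mem (φ := φ) hm
  rw [turn, sin_pi_div_two_sub, cos_two_mul', cos_sq', sin_arcsin h.1 h.2, mul_pow, sq_sqrt hm0]
  ring

theorem strictAntiOn_turn {m : ℝ} (hm0 : 0 < m) (hm : m ≤ 1) :
    StrictAntiOn (turn m) (Icc 0 (π / 2)) := by
  intro a ha b hb hab
  have h1 : sin a < sin b := strictMonoOn_sin ⟨by linarith [ha.1, pi_pos], ha.2⟩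
    ⟨by linarith [hb.1, pi_pos], hb.2⟩ hab
  have h2 : arcsin (√m * sin a) < arcsin (√m * sin b) :=
    strictMonoOn_arcsin (sqrt_mul_sin_mem hm) (sqrt_mul_sin_mem hm)
      (mul_lt_mul_of_pos_left h1 (sqrt_pos.2 hm0))
  simp only [turn]; linarith

theorem continuous_turn (m : ℝ) : Continuous (turn m) := by
  unfold turn; fun_prop

theorem sqrt_mul_sin_ne {m φ : ℝ} (hm0 : 0 ≤ m)
    (h : m * sin φ ^ 2 < 1) : √m * sin φ ≠ -1 ∧ √m * sin φ ≠ 1 := by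
  have : (√m * sin φ) ^ 2 < 1 := by rwa [mul_pow, sq_sqrt hm0]
  constructor <;> intro h <;> rw [h] at this <;> norm_num at this

theorem hasDerivAt_arcsin_sqrt_mul_sin {m φ : ℝ} (hm0 : 0 ≤ m)
    (h : m * sin φ ^ 2 < 1) :
    HasDerivAt (fun φ => arcsin (√m * sin φ)) (√m * cos φ / delta m φ) φ := by
  obtain ⟨h1, h2⟩ := sqrt_mul_sin_ne hm0 h
  have := (hasDerivAt_arcsin h1 h2).comp φ ((hasDerivAt_sin φ).const_mul (√m))
  rw [mul_pow, sq_sqrt hm0] at this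
  convert! this using 1
  rw [delta]; ring

theorem image_turn {m β : ℝ} (hm0 : 0 < m) (hm : m ≤ 1) (hβ : β ∈ Icc 0 (π / 2)) :
    turn m '' Ioo 0 β = Ioo (turn m β) (π / 2) := by
  have h0 : turn m 0 = π / 2 := by simp [turn]
  have hanti := strictAntiOn_turn hm0 hm
  apply Subset.antisymm
  · rintro _ ⟨φ, hφ, rfl⟩
    have hφ' : φ ∈ Icc 0 (π / 2) := ⟨hφ.1.le, hφ.2.le.trans hβ.2⟩
    refine ⟨hanti hφ' hβ hφ.2, ?_⟩
    rw [← h0]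
    exact hanti ⟨le_rfl, by positivity⟩ hφ' hφ.1
  · have := intermediate_value_Ioo' hβ.1 (continuous_turn m).continuousOn (f := turn m)
    rwa [h0] at this

theorem mul_sin_sq_lt_one_of_mem {m φ : ℝ} (hm : m ≤ 1) (hφ : φ ∈ Ioo 0 (π / 2)) :
    m * sin φ ^ 2 < 1 := by
  have h1 : 0 < cos φ := cos_pos_of_mem_Ioo ⟨by linarith [hφ.1, pi_pos], hφ.2⟩
  nlinarith [sin_sq_add_cos_sq φ, sq_nonneg (sin φ), sq_pos_of_pos h1]

/-- Under the substitution `2m - 1 + sin x = 2m cos² φ`, so the square root in the denominator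
cancels the factor `cos φ` of the Jacobian. This removes the singularity at the turning point. -/
theorem abs_deriv_turn_mul {m φ : ℝ} (F : ℝ → ℝ) (hm0 : 0 < m) (hm : m ≤ 1)
    (hφ : φ ∈ Ioo 0 (π / 2)) :
    |-(2 * (√m * cos φ / delta m φ))| • (F (sin (turn m φ)) / √(2 * m - 1 + sin (turn m φ)))
      = √2 * F (1 - 2 * m * sin φ ^ 2) / delta m φ := by
  have h1 : 0 < cos φ := cos_pos_of_mem_Ioo ⟨by linarith [hφ.1, pi_pos], hφ.2⟩
  have h2 : 0 < delta m φ := sqrt_pos.2 (sub_pos.2 (mul_sin_sq_lt_one_of_mem hm hφ))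
  have h3 : 0 < √m := sqrt_pos.2 hm0
  rw [sin_turn hm0.le hm]
  have h4 : 2 * m - 1 + (1 - 2 * m * sin φ ^ 2) = 2 * (m * cos φ ^ 2) := by
    rw [cos_sq']; ring
  rw [h4, sqrt_mul (by norm_num), sqrt_mul hm0.le, sqrt_sq h1.le, abs_neg, abs_of_pos (by positivity),
    smul_eq_mul]
  have h5 : √2 * √2 = 2 := by norm_num
  field_simp
  linear_combination -F (1 - 2 * m * sin φ ^ 2) * h5

section Substitution

variable {m β : ℝ} (F : ℝ → ℝ)

theorem hasDerivAt_turn {m φ : ℝ} (hm0 : 0 ≤ m) (h : m * sin φ ^ 2 < 1) :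
    HasDerivAt (turn m) (-(2 * (√m * cos φ / delta m φ))) φ :=
  ((hasDerivAt_arcsin_sqrt_mul_sin hm0 h).const_mul 2).const_sub (π / 2)

theorem turn_le (hm0 : 0 < m) (hm : m ≤ 1) (hβ : β ∈ Icc 0 (π / 2)) : turn m β ≤ π / 2 := by
  have h0 : turn m 0 = π / 2 := by simp [turn]
  rw [← h0]
  exact (strictAntiOn_turn hm0 hm).antitoneOn ⟨le_rfl, by positivity⟩ hβ hβ.1

/-- The change of variables for injective maps on an open interval needs neither integrability nor
regularity at the endpoints, so `F` is arbitrary and `m = 1` is allowed. -/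
theorem integral_turn (hm0 : 0 < m) (hm : m ≤ 1) (hβ : β ∈ Icc 0 (π / 2)) :
    ∫ x in turn m β..π / 2, F (sin x) / √(2 * m - 1 + sin x)
      = ∫ φ in 0..β, √2 * F (1 - 2 * m * sin φ ^ 2) / delta m φ := by
  have hsub : ∀ φ ∈ Ioo 0 β, φ ∈ Ioo 0 (π / 2) := fun φ hφ => ⟨hφ.1, hφ.2.trans_le hβ.2⟩
  have hinj : InjOn (turn m) (Ioo 0 β) := (strictAntiOn_turn hm0 hm).injOn.mono
    (Ioo_subset_Icc_self.trans (Icc_subset_Icc le_rfl hβ.2))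
  rw [intervalIntegral.integral_of_le (turn_le hm0 hm hβ), intervalIntegral.integral_of_le hβ.1,
    integral_Ioc_eq_integral_Ioo, integral_Ioc_eq_integral_Ioo, ← image_turn hm0 hm hβ,
    integral_image_eq_integral_abs_deriv_smul measurableSet_Ioo
      (fun φ hφ => (hasDerivAt_turn hm0.le
        (mul_sin_sq_lt_one_of_mem hm (hsub φ hφ))).hasDerivWithinAt) hinj]
  exact setIntegral_congr_fun measurableSet_Ioo fun φ hφ =>
    abs_deriv_turn_mul F hm0 hm (hsub φ hφ)

theorem intervalIntegrable_turn_iff (hm0 : 0 < m) (hm : m ≤ 1) (hβ : β ∈ Icc 0 (π / 2)) :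
    IntervalIntegrable (fun x => F (sin x) / √(2 * m - 1 + sin x)) volume (turn m β) (π / 2)
      ↔ IntervalIntegrable (fun φ => √2 * F (1 - 2 * m * sin φ ^ 2) / delta m φ) volume 0 β := by
  have hsub : ∀ φ ∈ Ioo 0 β, φ ∈ Ioo 0 (π / 2) := fun φ hφ => ⟨hφ.1, hφ.2.trans_le hβ.2⟩
  have hinj : InjOn (turn m) (Ioo 0 β) := (strictAntiOn_turn hm0 hm).injOn.mono
    (Ioo_subset_Icc_self.trans (Icc_subset_Icc le_rfl hβ.2))
  rw [intervalIntegrable_iff_integrableOn_Ioo_of_le (turn_le hm0 hm hβ) (by simp) (by simp),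
    intervalIntegrable_iff_integrableOn_Ioo_of_le hβ.1 (by simp) (by simp),
    ← image_turn hm0 hm hβ,
    integrableOn_image_iff_integrableOn_abs_deriv_smul measurableSet_Ioo
      (fun φ hφ => (hasDerivAt_turn hm0.le
        (mul_sin_sq_lt_one_of_mem hm (hsub φ hφ))).hasDerivWithinAt) hinj]
  exact integrableOn_congr_fun (fun φ hφ => abs_deriv_turn_mul F hm0 hm (hsub φ hφ))
    measurableSet_Ioo

end Substitution

/-- The phase `π / 2` is the turning point: both sides lie in `[-π/2, π/2]` and have sine `-k`. -/
theorem turn_pi_div_two {k : ℝ} (h0 : -1 ≤ k) (h1 : k ≤ 1) :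
    turn ((1 + k) / 2) (π / 2) = -arcsin k := by
  have hm0 : (0 : ℝ) ≤ (1 + k) / 2 := by linarith
  have hm1 : √((1 + k) / 2) ≤ 1 := sqrt_le_one.2 (by linarith)
  have hs := sqrt_nonneg ((1 + k) / 2)
  have hc := sin_turn (φ := π / 2) hm0 (by linarith : (1 + k) / 2 ≤ 1)
  have ha0 : 0 ≤ arcsin (√((1 + k) / 2)) := arcsin_nonneg.2 hs
  have ha1 := arcsin_le_pi_div_two (√((1 + k) / 2))
  have hmem : turn ((1 + k) / 2) (π / 2) ∈ Icc (-(π / 2)) (π / 2) := by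
    simp only [turn, sin_pi_div_two, mul_one]
    constructor <;> linarith
  rw [← arcsin_neg, ← arcsin_sin hmem.1 hmem.2, hc, sin_pi_div_two]
  congr 1; ring

/-- The amplitude at which `turn` vanishes. -/
noncomputable def ampZero (k : ℝ) : ℝ := arcsin (1 / √(1 + k))

theorem ampZero_mem {k : ℝ} (h0 : 0 ≤ k) : ampZero k ∈ Ioc 0 (π / 2) :=
  ⟨arcsin_pos.2 (by positivity), arcsin_le_pi_div_two _⟩

theorem sin_ampZero {k : ℝ} (h0 : 0 ≤ k) : sin (ampZero k) = 1 / √(1 + k) := by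
  have h1 : (1 : ℝ) ≤ √(1 + k) := by rw [one_le_sqrt]; linarith
  have : 1 / √(1 + k) ≤ 1 := by rw [div_le_one (by positivity)]; exact h1
  exact sin_arcsin (by linarith [show 0 ≤ 1 / √(1 + k) by positivity]) this

theorem sqrt_mul_sin_ampZero {k : ℝ} (h0 : 0 ≤ k) :
    √((1 + k) / 2) * sin (ampZero k) = √2 / 2 := by
  have h1 : (0 : ℝ) < √(1 + k) := by positivity
  rw [sin_ampZero h0, sqrt_div (by linarith)]
  field_simp
  norm_num

theorem cos_ampZero {k : ℝ} (h0 : 0 ≤ k) : √(1 + k) * cos (ampZero k) = √k := by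
  have h1 : (0 : ℝ) < √(1 + k) := by positivity
  rw [ampZero, cos_arcsin, ← sqrt_mul (by linarith), div_pow, sq_sqrt (by linarith)]
  congr 1
  field_simp
  ring

theorem turn_ampZero {k : ℝ} (h0 : 0 ≤ k) : turn ((1 + k) / 2) (ampZero k) = 0 := by
  rw [turn, sqrt_mul_sin_ampZero h0, ← sin_pi_div_four, arcsin_sin]
  · ring
  · linarith [pi_pos]
  · linarith [pi_pos]

/-- The integrands of the Legendre forms. -/
noncomputable def legendre (F : ℝ → ℝ) (m φ : ℝ) : ℝ := √2 * F (1 - 2 * m * sin φ ^ 2) / delta m φ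

theorem continuous_legendre {F : ℝ → ℝ} (hF : Continuous F) {m : ℝ} (hm : m < 1) :
    Continuous (legendre F m) := by
  unfold legendre
  exact Continuous.div (by fun_prop) (continuous_delta m) fun φ => (delta_pos hm φ).ne'

/-- The complete integral `A + I`. -/
noncomputable def quarterI (k : ℝ) : ℝ :=
  ∫ φ in 0..π / 2, legendre (fun _ => 1) ((1 + k) / 2) φ

/-- The complete integral `B + J`. -/
noncomputable def quarterJ (k : ℝ) : ℝ :=
  ∫ φ in 0..π / 2, legendre (fun s => s) ((1 + k) / 2) φ

theorem pi_div_two_mem : π / 2 ∈ Icc (0 : ℝ) (π / 2) := ⟨by positivity, le_rfl⟩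

/-! ### Continuity, positivity and monotonicity of `I`, `J`, `I₁`, `J₁` -/

section Legendre

variable {k : ℝ}

theorem integral_legendre_quarter (h0 : 0 ≤ k) (h1 : k ≤ 1) (F : ℝ → ℝ) :
    ∫ x in (-arcsin k)..π / 2, F (sin x) / √(k + sin x)
      = ∫ φ in 0..π / 2, legendre F ((1 + k) / 2) φ := by
  have := integral_turn F (m := (1 + k) / 2) (by linarith) (by linarith) pi_div_two_mem
  rw [turn_pi_div_two (by linarith) h1] at this
  rw [show 2 * ((1 + k) / 2) - 1 = k by ring] at this
  exact this

theorem intervalIntegrable_legendre_quarter (h0 : 0 ≤ k) (h1 : k ≤ 1) (F : ℝ → ℝ) :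
    IntervalIntegrable (fun x => F (sin x) / √(k + sin x)) volume (-arcsin k) (π / 2)
      ↔ IntervalIntegrable (legendre F ((1 + k) / 2)) volume 0 (π / 2) := by
  have := intervalIntegrable_turn_iff F (m := (1 + k) / 2) (by linarith) (by linarith)
    pi_div_two_mem
  rw [turn_pi_div_two (by linarith) h1] at this
  rw [show 2 * ((1 + k) / 2) - 1 = k by ring] at this
  exact this

theorem integral_legendre_zero (h0 : 0 ≤ k) (h1 : k ≤ 1) (F : ℝ → ℝ) :
    ∫ x in 0..π / 2, F (sin x) / √(k + sin x)
      = ∫ φ in 0..ampZero k, legendre F ((1 + k) / 2) φ := by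
  have := integral_turn F (m := (1 + k) / 2) (by linarith) (by linarith)
    (Ioc_subset_Icc_self (ampZero_mem h0))
  rw [turn_ampZero h0] at this
  rw [show 2 * ((1 + k) / 2) - 1 = k by ring] at this
  exact this

theorem intervalIntegrable_quarter (h0 : 0 ≤ k) (h1 : k < 1) {F : ℝ → ℝ} (hF : Continuous F) :
    IntervalIntegrable (fun x => F (sin x) / √(k + sin x)) volume (-arcsin k) (π / 2) :=
  (intervalIntegrable_legendre_quarter h0 h1.le F).2
    ((continuous_legendre hF (by linarith)).intervalIntegrable _ _)

theorem intervalIntegrable_inv_sqrt_sin :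
    IntervalIntegrable (fun x => 1 / √(sin x)) volume 0 (π / 2) := by
  simpa using intervalIntegrable_quarter le_rfl one_pos (F := fun _ => 1) continuous_const

theorem measurable_div_sqrt {F : ℝ → ℝ} (hF : Continuous F) (k : ℝ) :
    Measurable fun x => F (sin x) / √(k + sin x) :=
  (hF.comp continuous_sin).measurable.div (by fun_prop)

theorem norm_div_sqrt_le (h0 : 0 ≤ k) {F : ℝ → ℝ} (hF1 : ∀ s ∈ Icc (0 : ℝ) 1, |F s| ≤ 1) {x : ℝ}
    (hx : x ∈ Ioc 0 (π / 2)) : ‖F (sin x) / √(k + sin x)‖ ≤ 1 / √(sin x) := by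
  have hs : 0 < sin x := sin_pos_of_pos_of_lt_pi hx.1 (by linarith [hx.2, pi_pos])
  rw [norm_div, Real.norm_eq_abs, Real.norm_eq_abs, abs_of_nonneg (sqrt_nonneg _)]
  exact div_le_div₀ zero_le_one (hF1 _ ⟨hs.le, sin_le_one x⟩) (sqrt_pos.2 hs)
    (sqrt_le_sqrt (by linarith))

theorem intervalIntegrable_zero (h0 : 0 ≤ k) {F : ℝ → ℝ} (hF : Continuous F)
    (hF1 : ∀ s ∈ Icc (0 : ℝ) 1, |F s| ≤ 1) :
    IntervalIntegrable (fun x => F (sin x) / √(k + sin x)) volume 0 (π / 2) := by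
  refine intervalIntegrable_inv_sqrt_sin.mono_fun
    (measurable_div_sqrt hF k).aestronglyMeasurable ?_
  rw [uIoc_of_le pi_div_two_mem.1]
  refine (ae_restrict_iff' measurableSet_Ioc).2 (ae_of_all _ fun x hx => ?_)
  exact (norm_div_sqrt_le h0 hF1 hx).trans (le_abs_self _)

/-- Dominated convergence: for all `k ≥ 0` at once the integrand is bounded by `1 / √(sin x)`, which
the substitution at `k = 0` shows to be integrable. -/
theorem continuousOn_integral_div_sqrt {F : ℝ → ℝ} (hF : Continuous F)
    (hF1 : ∀ s ∈ Icc (0 : ℝ) 1, |F s| ≤ 1) :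
    ContinuousOn (fun k => ∫ x in 0..π / 2, F (sin x) / √(k + sin x)) (Ici 0) := by
  intro k hk
  refine intervalIntegral.continuousWithinAt_of_dominated_interval
    (bound := fun x => 1 / √(sin x)) ?_ ?_ intervalIntegrable_inv_sqrt_sin ?_
  · exact Filter.Eventually.of_forall fun k => (measurable_div_sqrt hF k).aestronglyMeasurable
  · refine eventually_nhdsWithin_of_forall fun k hk => ae_of_all _ fun x hx => ?_
    rw [uIoc_of_le pi_div_two_mem.1] at hx
    exact norm_div_sqrt_le hk hF1 hx
  · refine ae_of_all _ fun x hx => ?_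
    rw [uIoc_of_le pi_div_two_mem.1] at hx
    have hs : 0 < sin x := sin_pos_of_pos_of_lt_pi hx.1 (by linarith [hx.2, pi_pos])
    have hk' : (0 : ℝ) ≤ k := hk
    refine ContinuousAt.continuousWithinAt (ContinuousAt.div (by fun_prop) (by fun_prop) ?_)
    exact (sqrt_pos.2 (by linarith)).ne'

theorem continuousOn_ellI : ContinuousOn ellI (Ici 0) :=
  continuousOn_integral_div_sqrt (F := fun _ => 1) continuous_const (by simp)

theorem abs_le_one_of_mem : ∀ s ∈ Icc (0 : ℝ) 1, |s| ≤ 1 := fun s hs =>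
  abs_le.2 ⟨by linarith [hs.1], hs.2⟩

theorem continuousOn_ellJ : ContinuousOn ellJ (Ici 0) :=
  continuousOn_integral_div_sqrt (F := fun s => s) continuous_id abs_le_one_of_mem

theorem intervalIntegrable_ellI (h0 : 0 ≤ k) :
    IntervalIntegrable (fun x => 1 / √(k + sin x)) volume 0 (π / 2) :=
  intervalIntegrable_zero h0 (F := fun _ => 1) continuous_const (by simp)

theorem intervalIntegrable_ellJ (h0 : 0 ≤ k) :
    IntervalIntegrable (fun x => sin x / √(k + sin x)) volume 0 (π / 2) :=
  intervalIntegrable_zero h0 (F := fun s => s) continuous_id abs_le_one_of_mem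

theorem ellI_eq (h0 : 0 ≤ k) (h1 : k ≤ 1) :
    ellI k = ∫ φ in 0..ampZero k, legendre (fun _ => 1) ((1 + k) / 2) φ :=
  integral_legendre_zero h0 h1 fun _ => 1

theorem ellJ_eq (h0 : 0 ≤ k) (h1 : k ≤ 1) :
    ellJ k = ∫ φ in 0..ampZero k, legendre (fun s => s) ((1 + k) / 2) φ :=
  integral_legendre_zero h0 h1 fun s => s

theorem integral_add_eq_quarter (h0 : 0 ≤ k) (h1 : k < 1) {F : ℝ → ℝ} (hF : Continuous F) :
    (∫ x in (-arcsin k)..0, F (sin x) / √(k + sin x)) + ∫ x in 0..π / 2, F (sin x) / √(k + sin x)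
      = ∫ φ in 0..π / 2, legendre F ((1 + k) / 2) φ := by
  rw [← integral_legendre_quarter h0 h1.le]
  have h := intervalIntegrable_quarter h0 h1 hF
  have ha : 0 ≤ arcsin k := arcsin_nonneg.2 h0
  have hsub : (0 : ℝ) ∈ uIcc (-arcsin k) (π / 2) := by
    rw [uIcc_of_le] <;> [constructor; skip] <;> linarith [pi_pos]
  exact intervalIntegral.integral_add_adjacent_intervals
    (h.mono_set (uIcc_subset_uIcc left_mem_uIcc hsub))
    (h.mono_set (uIcc_subset_uIcc hsub right_mem_uIcc))

theorem ellA_add_ellI (h0 : 0 ≤ k) (h1 : k < 1) : ellA k + ellI k = quarterI k :=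
  integral_add_eq_quarter h0 h1 (F := fun _ => 1) continuous_const

theorem ellB_add_ellJ (h0 : 0 ≤ k) (h1 : k < 1) : ellB k + ellJ k = quarterJ k :=
  integral_add_eq_quarter h0 h1 (F := fun s => s) continuous_id

/-- Twice a complete integral, which has a fixed range and a continuous integrand, minus an integral
whose singularity is harmless. The moving endpoint `-arcsin k` is gone. -/
theorem Ione_eq (h0 : 0 ≤ k) (h1 : k < 1) : Ione k = 2 * quarterI k - ellI k := by
  rw [Ione, ← ellA_add_ellI h0 h1]; ring

theorem Jone_eq (h0 : 0 ≤ k) (h1 : k < 1) : Jone k = 2 * quarterJ k - ellJ k := by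
  rw [Jone, ← ellB_add_ellJ h0 h1]; ring

theorem ellA_nonneg (h0 : 0 ≤ k) : 0 ≤ ellA k :=
  intervalIntegral.integral_nonneg (by linarith [arcsin_nonneg.2 h0]) fun x _ => by positivity

theorem ellI_pos (h0 : 0 ≤ k) : 0 < ellI k := by
  refine intervalIntegral.intervalIntegral_pos_of_pos_on (intervalIntegrable_ellI h0)
    (fun x hx => ?_) (by positivity)
  have hs : 0 < sin x := sin_pos_of_pos_of_lt_pi hx.1 (by linarith [hx.2, pi_pos])
  positivity

theorem ellJ_pos (h0 : 0 ≤ k) : 0 < ellJ k := by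
  refine intervalIntegral.intervalIntegral_pos_of_pos_on (intervalIntegrable_ellJ h0)
    (fun x hx => ?_) (by positivity)
  have hs : 0 < sin x := sin_pos_of_pos_of_lt_pi hx.1 (by linarith [hx.2, pi_pos])
  positivity

theorem ellI_le_Ione (h0 : 0 ≤ k) : ellI k ≤ Ione k := by
  rw [Ione]; linarith [ellA_nonneg h0]

theorem Ione_pos (h0 : 0 ≤ k) : 0 < Ione k := (ellI_pos h0).trans_le (ellI_le_Ione h0)

theorem strictAntiOn_ellI : StrictAntiOn ellI (Ici 0) := by
  intro k hk l hl hkl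
  have hk' : (0 : ℝ) ≤ k := hk
  rw [← sub_pos, ellI, ellI, ← intervalIntegral.integral_sub (intervalIntegrable_ellI hk)
    (intervalIntegrable_ellI hl)]
  refine intervalIntegral.intervalIntegral_pos_of_pos_on
    ((intervalIntegrable_ellI hk).sub (intervalIntegrable_ellI hl)) (fun x hx => ?_) (by positivity)
  have hs : 0 < sin x := sin_pos_of_pos_of_lt_pi hx.1 (by linarith [hx.2, pi_pos])
  rw [sub_pos]
  exact one_div_lt_one_div_of_lt (by positivity) (sqrt_lt_sqrt (by positivity) (by linarith))

theorem monotoneOn_quarterI : MonotoneOn quarterI (Ico 0 1) := by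
  intro k hk l hl hkl
  refine intervalIntegral.integral_mono_on pi_div_two_mem.1
    ((continuous_legendre continuous_const (by linarith [hk.2])).intervalIntegrable _ _)
    ((continuous_legendre continuous_const (by linarith [hl.2])).intervalIntegrable _ _)
    fun φ _ => ?_
  refine div_le_div_of_nonneg_left (by positivity) (delta_pos (by linarith [hl.2]) φ) ?_
  refine sqrt_le_sqrt ?_
  nlinarith [mul_le_mul_of_nonneg_right hkl (sq_nonneg (sin φ))]

theorem monotoneOn_Ione : MonotoneOn Ione (Ico 0 1) := by
  intro k hk l hl hkl
  rw [Ione_eq hk.1 hk.2, Ione_eq hl.1 hl.2]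
  linarith [monotoneOn_quarterI hk hl hkl, strictAntiOn_ellI.antitoneOn hk.1 hl.1 hkl]

theorem continuousOn_legendre_integral {F : ℝ → ℝ} (hF : Continuous F) :
    ContinuousOn (fun k => ∫ φ in 0..π / 2, legendre F ((1 + k) / 2) φ) (Ico 0 1) := by
  intro k hk
  obtain ⟨l, hl⟩ := exists_between hk.2
  -- The truncation at `(1 - l) / 2` makes the integrand jointly continuous for all parameters; it
  -- is inactive for `0 ≤ k' < l`, hence near `k`.
  have hc : Continuous fun k => ∫ φ in 0..π / 2,
      √2 * F (1 - 2 * ((1 + k) / 2) * sin φ ^ 2)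
        / √(max (1 - (1 + k) / 2 * sin φ ^ 2) ((1 - l) / 2)) := by
    refine intervalIntegral.continuous_parametric_intervalIntegral_of_continuous' ?_ _ _
    refine Continuous.div (by fun_prop) (by fun_prop) fun p => ?_
    exact (sqrt_pos.2 (lt_max_of_lt_right (by linarith [hl.2]))).ne'
  refine (hc.continuousWithinAt (s := Ico 0 1) (x := k)).congr_of_eventuallyEq ?_ ?_
  · filter_upwards [self_mem_nhdsWithin, mem_nhdsWithin_of_mem_nhds (Iio_mem_nhds hl.1)]
      with k' h1 h2
    refine intervalIntegral.integral_congr fun φ _ => ?_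
    have : (1 - l) / 2 ≤ 1 - (1 + k') / 2 * sin φ ^ 2 := by
      have := mul_le_mul_of_nonneg_left (sin_sq_le_one φ) (show 0 ≤ (1 + k') / 2 by linarith [h1.1])
      have h2 : k' < l := h2
      linarith
    simp only [legendre, delta, max_eq_left this]
  · refine intervalIntegral.integral_congr fun φ _ => ?_
    have : (1 - l) / 2 ≤ 1 - (1 + k) / 2 * sin φ ^ 2 := by
      have := mul_le_mul_of_nonneg_left (sin_sq_le_one φ) (show 0 ≤ (1 + k) / 2 by linarith [hk.1])
      linarith [hl.1]
    simp only [legendre, delta, max_eq_left this]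

theorem continuousOn_Ione : ContinuousOn Ione (Ico 0 1) :=
  ((continuousOn_legendre_integral (F := fun _ => 1) continuous_const).const_mul 2 |>.sub
    (continuousOn_ellI.mono fun _ h => h.1)).congr fun _ h => Ione_eq h.1 h.2

theorem continuousOn_Jone : ContinuousOn Jone (Ico 0 1) :=
  ((continuousOn_legendre_integral (F := fun s => s) continuous_id).const_mul 2 |>.sub
    (continuousOn_ellJ.mono fun _ h => h.1)).congr fun _ h => Jone_eq h.1 h.2

theorem Ione_zero : Ione 0 = ellI 0 := by simp [Ione, ellA]

theorem Jone_zero : Jone 0 = ellJ 0 := by simp [Jone, ellB]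

end Legendre

/-! ### Reduced actions and their tangent inequalities -/

/-- The reduced action of a quarter oscillation. -/
noncomputable def quarterAction (k : ℝ) : ℝ := ∫ x in (-arcsin k)..π / 2, √(k + sin x)

/-- The reduced action of the monotone part. -/
noncomputable def zeroAction (k : ℝ) : ℝ := ∫ x in 0..π / 2, √(k + sin x)

/-- The reduced action of the path that turns at both ends. -/
noncomputable def turnAction (k : ℝ) : ℝ := 2 * quarterAction k - zeroAction k

theorem continuous_sqrt_add_sin (k : ℝ) : Continuous fun x => √(k + sin x) := by fun_prop

theorem zeroAction_eq {k : ℝ} (h0 : 0 ≤ k) : zeroAction k = k * ellI k + ellJ k := by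
  rw [ellI, ellJ, ← intervalIntegral.integral_const_mul, ← intervalIntegral.integral_add
    ((intervalIntegrable_ellI h0).const_mul k) (intervalIntegrable_ellJ h0)]
  refine intervalIntegral.integral_congr fun x _ => ?_
  rw [mul_one_div, ← add_div, div_sqrt]

/-- The separatrix value `k = 1` is included, unlike in the splitting `k (A + I) + (B + J)`; it is
needed for the bound on `U`. -/
theorem quarterAction_eq_legendre {k : ℝ} (h0 : 0 ≤ k) (h1 : k ≤ 1) :
    quarterAction k = ∫ φ in 0..π / 2, legendre (fun s => k + s) ((1 + k) / 2) φ := by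
  rw [← integral_legendre_quarter h0 h1, quarterAction]
  exact intervalIntegral.integral_congr fun x _ => div_sqrt.symm

theorem intervalIntegrable_quarterAction {k : ℝ} (h0 : 0 ≤ k) (h1 : k ≤ 1) :
    IntervalIntegrable (legendre (fun s => k + s) ((1 + k) / 2)) volume 0 (π / 2) := by
  rw [← intervalIntegrable_legendre_quarter h0 h1]
  simp only [div_sqrt]
  exact (continuous_sqrt_add_sin k).intervalIntegrable _ _

theorem quarterAction_eq {k : ℝ} (h0 : 0 ≤ k) (h1 : k < 1) :
    quarterAction k = k * quarterI k + quarterJ k := by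
  have hm : (1 + k) / 2 < 1 := by linarith
  rw [quarterAction_eq_legendre h0 h1.le, quarterI, quarterJ, ← intervalIntegral.integral_const_mul,
    ← intervalIntegral.integral_add
      (((continuous_legendre continuous_const hm).intervalIntegrable _ _).const_mul k)
      ((continuous_legendre continuous_id' hm).intervalIntegrable _ _)]
  refine intervalIntegral.integral_congr fun φ _ => ?_
  simp only [legendre]
  ring

theorem turnAction_eq {k : ℝ} (h0 : 0 ≤ k) (h1 : k < 1) :
    turnAction k = k * Ione k + Jone k := by
  rw [turnAction, quarterAction_eq h0 h1, zeroAction_eq h0, Ione_eq h0 h1, Jone_eq h0 h1]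
  ring

theorem sqrt_le_tangent {x y : ℝ} (hx : 0 < x) (hy : 0 ≤ y) :
    √y ≤ √x + (y - x) / 2 * (1 / √x) := by
  have h1 := sqrt_pos.2 hx
  have h2 := sq_sqrt hx.le
  have h3 := sq_sqrt hy
  rw [← sub_nonneg]
  have : √x + (y - x) / 2 * (1 / √x) - √y = (√x - √y) ^ 2 / (2 * √x) := by
    field_simp
    linear_combination h2 - h3
  rw [this]; positivity

/-- Concavity of the square root, integrated: the slope in `k` is `I / 2`. -/
theorem zeroAction_le_tangent {k k₀ : ℝ} (h0 : 0 ≤ k) (h0' : 0 ≤ k₀) :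
    zeroAction k ≤ zeroAction k₀ + (k - k₀) / 2 * ellI k₀ := by
  have hi := ((intervalIntegrable_ellI h0').const_mul ((k - k₀) / 2))
  have hc := (continuous_sqrt_add_sin k₀).intervalIntegrable (μ := volume) 0 (π / 2)
  rw [ellI, ← intervalIntegral.integral_const_mul, zeroAction, zeroAction,
    ← intervalIntegral.integral_add hc hi]
  refine intervalIntegral.integral_mono_on_of_le_Ioo pi_div_two_mem.1
    ((continuous_sqrt_add_sin k).intervalIntegrable _ _) (hc.add hi) fun x hx => ?_
  have hs : 0 < sin x := sin_pos_of_pos_of_lt_pi hx.1 (by linarith [hx.2, pi_pos])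
  have := sqrt_le_tangent (x := k₀ + sin x) (y := k + sin x) (by positivity) (by positivity)
  rwa [show k + sin x - (k₀ + sin x) = k - k₀ by ring] at this

/-- Tangent inequality for `m ↦ m / √(1 - m σ)`. -/
theorem div_sqrt_tangent {m m₀ σ p q : ℝ} (hm : 0 ≤ m) (hσ : 0 ≤ σ) (hp : 0 < p) (hq : 0 < q)
    (hp2 : p ^ 2 = 1 - m₀ * σ) (hq2 : q ^ 2 = 1 - m * σ) :
    m₀ / p + (1 / p + m₀ * σ / (2 * p ^ 3)) * (m - m₀) ≤ m / q := by
  -- Tangent of the convex function `r ↦ 1 / √r` at `r = p²`. Multiplying it by `m` exceeds the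
  -- tangent of the product by a nonnegative quadratic term.
  have h1 : 1 / p + σ * (m - m₀) / (2 * p ^ 3) ≤ 1 / q := by
    have h2 : σ * (m - m₀) = p ^ 2 - q ^ 2 := by rw [hp2, hq2]; ring
    rw [h2, ← sub_nonneg]
    have : 1 / q - (1 / p + (p ^ 2 - q ^ 2) / (2 * p ^ 3))
        = (p - q) ^ 2 * (2 * p + q) / (2 * p ^ 3 * q) := by
      field_simp; ring
    rw [this]; positivity
  have h3 := mul_le_mul_of_nonneg_left h1 hm
  have h4 : m₀ / p + (1 / p + m₀ * σ / (2 * p ^ 3)) * (m - m₀)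
      = m * (1 / p + σ * (m - m₀) / (2 * p ^ 3)) - σ * (m - m₀) ^ 2 / (2 * p ^ 3) := by
    field_simp; ring
  have h5 : 0 ≤ σ * (m - m₀) ^ 2 / (2 * p ^ 3) := by positivity
  rw [h4]
  calc _ ≤ m * (1 / p + σ * (m - m₀) / (2 * p ^ 3)) := by linarith
    _ ≤ m * (1 / q) := h3
    _ = m / q := by ring

theorem hasDerivAt_delta {m : ℝ} (hm : m < 1) (φ : ℝ) :
    HasDerivAt (delta m) (-(m * sin φ * cos φ / delta m φ)) φ := by
  have h1 : 1 - m * sin φ ^ 2 ≠ 0 := (sub_pos.2 (mul_sin_sq_lt_one hm)).ne'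
  have := ((((hasDerivAt_sin φ).pow 2).const_mul m).const_sub 1).sqrt h1
  convert! this using 1
  have h2 := (delta_pos hm φ).ne'
  rw [delta] at h2 ⊢
  simp
  field_simp

/-- The difference of the integrands is the derivative of `sin φ cos φ / Δ`, which vanishes at both
ends. This identifies the slope of `quarterAction` in `k` as `quarterI / 2`. -/
theorem integral_legendre_identity {m : ℝ} (hm : m < 1) :
    ∫ φ in 0..π / 2, 2 * cos φ ^ 2 * (1 / delta m φ + m * sin φ ^ 2 / (2 * delta m φ ^ 3))
      = ∫ φ in 0..π / 2, 1 / delta m φ := by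
  have hc : Continuous fun φ =>
      2 * cos φ ^ 2 * (1 / delta m φ + m * sin φ ^ 2 / (2 * delta m φ ^ 3)) := by
    have := continuous_delta m
    have hne := fun φ => (delta_pos hm φ).ne'
    refine Continuous.mul (by fun_prop) (Continuous.add ?_ ?_)
    · exact continuous_const.div this hne
    · exact Continuous.div (by fun_prop) (by fun_prop) fun φ => by simpa using hne φ
  have hc' : Continuous fun φ => 1 / delta m φ :=
    continuous_const.div (continuous_delta m) fun φ => (delta_pos hm φ).ne'
  rw [← sub_eq_zero, ← intervalIntegral.integral_sub (hc.intervalIntegrable _ _)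
    (hc'.intervalIntegrable _ _),
    intervalIntegral.integral_eq_sub_of_hasDerivAt (f := fun φ => sin φ * cos φ / delta m φ)]
  · simp
  · intro φ _
    have hne := (delta_pos hm φ).ne'
    have := ((hasDerivAt_sin φ).mul (hasDerivAt_cos φ)).div (hasDerivAt_delta hm φ) hne
    convert! this using 1
    have h2 := delta_sq hm.le φ
    have h3 := sin_sq_add_cos_sq φ
    simp only [Pi.mul_apply]
    field_simp
    rw [show delta m φ ^ 2 = 1 - m * sin φ ^ 2 from h2, cos_sq']
    ring
  · exact (hc.sub hc').intervalIntegrable _ _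

/-- After the substitution the integrand is `2√2 cos² φ · m / √(1 - m sin² φ)` on a fixed interval,
and each `m ↦ m / √(1 - mσ)` is convex. Integrating the pointwise tangents gives the inequality. -/
theorem quarterAction_tangent_le {k k₀ : ℝ} (hk : k ∈ Icc 0 1) (hk₀ : k₀ ∈ Ico 0 1) :
    quarterAction k₀ + (k - k₀) / 2 * quarterI k₀ ≤ quarterAction k := by
  set m := (1 + k) / 2 with hm
  set m₀ := (1 + k₀) / 2 with hm₀
  have hm₀1 : m₀ < 1 := by linarith [hk₀.2]
  have hm1 : m ≤ 1 := by linarith [hk.2]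
  have hne := fun φ => (delta_pos hm₀1 φ).ne'
  have hcd := continuous_delta m₀
  have hc : Continuous fun φ =>
      2 * cos φ ^ 2 * (1 / delta m₀ φ + m₀ * sin φ ^ 2 / (2 * delta m₀ φ ^ 3)) := by
    refine Continuous.mul (by fun_prop) (Continuous.add ?_ ?_)
    · exact continuous_const.div hcd hne
    · exact Continuous.div (by fun_prop) (by fun_prop) fun φ => by simpa using hne φ
  have h1 : quarterI k₀ = √2 * ∫ φ in 0..π / 2, 1 / delta m₀ φ := by
    rw [quarterI, ← intervalIntegral.integral_const_mul]
    refine intervalIntegral.integral_congr fun φ _ => ?_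
    simp only [legendre]; rw [← hm₀]; ring
  have hi₀ := intervalIntegrable_quarterAction hk₀.1 hk₀.2.le
  have hi := intervalIntegrable_quarterAction hk.1 hk.2
  rw [h1, ← integral_legendre_identity hm₀1, ← intervalIntegral.integral_const_mul,
    ← intervalIntegral.integral_const_mul, quarterAction_eq_legendre hk.1 hk.2,
    quarterAction_eq_legendre hk₀.1 hk₀.2.le, ← intervalIntegral.integral_add hi₀
      (((hc.intervalIntegrable _ _).const_mul _).const_mul _)]
  refine intervalIntegral.integral_mono_on_of_le_Ioo pi_div_two_mem.1
    (hi₀.add (((hc.intervalIntegrable _ _).const_mul _).const_mul _)) hi fun φ hφ => ?_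
  have hq : 0 < delta m φ := sqrt_pos.2 (sub_pos.2 (mul_sin_sq_lt_one_of_mem hm1 hφ))
  have ht := div_sqrt_tangent (m := m) (m₀ := m₀) (by linarith [hk.1]) (sq_nonneg (sin φ))
    (delta_pos hm₀1 φ) hq (delta_sq hm₀1.le φ) (delta_sq hm1 φ)
  have ht := mul_le_mul_of_nonneg_left ht (show 0 ≤ √2 * 2 * cos φ ^ 2 by positivity)
  simp only [legendre]
  rw [← hm, ← hm₀]
  have e1 : √2 * (k₀ + (1 - 2 * m₀ * sin φ ^ 2)) / delta m₀ φ
      = √2 * 2 * cos φ ^ 2 * (m₀ / delta m₀ φ) := by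
    rw [cos_sq', show k₀ = 2 * m₀ - 1 by rw [hm₀]; ring]; ring
  have e2 : √2 * (k + (1 - 2 * m * sin φ ^ 2)) / delta m φ
      = √2 * 2 * cos φ ^ 2 * (m / delta m φ) := by
    rw [cos_sq', show k = 2 * m - 1 by rw [hm]; ring]; ring
  rw [e1, e2, show k - k₀ = 2 * (m - m₀) by rw [hm, hm₀]; ring]
  refine le_trans (le_of_eq ?_) ht
  ring

theorem turnAction_tangent_le {k k₀ : ℝ} (hk : k ∈ Icc 0 1) (hk₀ : k₀ ∈ Ico 0 1) :
    turnAction k₀ + (k - k₀) / 2 * Ione k₀ ≤ turnAction k := by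
  have h1 := quarterAction_tangent_le hk hk₀
  have h2 := zeroAction_le_tangent hk.1 hk₀.1
  rw [turnAction, turnAction, Ione_eq hk₀.1 hk₀.2]
  linarith

/-- For `k < l`, the tangent of `k I₁ + J₁` at `l`, evaluated at `k`, together with the monotonicity
of `I₁`, gives `J₁(l) ≤ J₁(k) - (l - k) I₁(l) / 2`. -/
theorem strictAntiOn_Jone : StrictAntiOn Jone (Ico 0 1) := by
  intro k hk l hl hkl
  have h1 := turnAction_tangent_le (Ico_subset_Icc_self hk) hl
  rw [turnAction_eq hk.1 hk.2, turnAction_eq hl.1 hl.2] at h1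
  have h2 := mul_nonneg hk.1 (sub_nonneg.2 (monotoneOn_Ione hk hl hkl.le))
  have h3 := mul_pos (sub_pos.2 hkl) (Ione_pos hl.1)
  linarith

/-! ### The zero of `J₁` and the bound `U < 3π` -/

theorem quarterJ_le {k : ℝ} (h0 : 0 ≤ k) (h1 : k < 1) : quarterJ k ≤ √2 * π - quarterI k := by
  have hm : (1 + k) / 2 < 1 := by linarith
  have hi := (continuous_legendre (F := fun _ => 1) continuous_const hm).intervalIntegrable
    (μ := volume) 0 (π / 2)
  have hj := (continuous_legendre (F := fun s => s) continuous_id' hm).intervalIntegrable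
    (μ := volume) 0 (π / 2)
  have h2 : quarterJ k + quarterI k ≤ ∫ φ in 0..π / 2, 2 * √2 := by
    rw [quarterJ, quarterI, ← intervalIntegral.integral_add hj hi]
    refine intervalIntegral.integral_mono_on pi_div_two_mem.1 (hj.add hi) (by simp) fun φ _ => ?_
    have hd := delta_pos hm φ
    have hd2 := delta_sq hm.le φ
    have hd1 : delta ((1 + k) / 2) φ ≤ 1 := sqrt_le_one.2 (by nlinarith [sq_nonneg (sin φ)])
    rw [legendre, legendre, ← add_div, div_le_iff₀ hd]
    have : √2 * (1 - 2 * ((1 + k) / 2) * sin φ ^ 2) + √2 * 1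
        = 2 * √2 * delta ((1 + k) / 2) φ ^ 2 := by rw [hd2]; ring
    rw [this]
    have : delta ((1 + k) / 2) φ ^ 2 ≤ delta ((1 + k) / 2) φ := by nlinarith
    exact mul_le_mul_of_nonneg_left this (by positivity)
  rw [intervalIntegral.integral_const, smul_eq_mul] at h2
  linarith

/-- Logarithmic divergence at the separatrix: with `m = 1 - d²`, `Δ² = cos² φ + d² sin² φ ≤ (π/2 - φ
+ d)²`. -/
theorem le_quarterI {d : ℝ} (hd0 : 0 < d) :
    √2 * log ((π / 2 + d) / d) ≤ quarterI (1 - 2 * d ^ 2) := by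
  have hm : (1 + (1 - 2 * d ^ 2)) / 2 = 1 - d ^ 2 := by ring
  have hm1 : 1 - d ^ 2 < 1 := by linarith [sq_pos_of_pos hd0]
  have h1 : ∫ φ in 0..π / 2, 1 / (π / 2 + d - φ) = log ((π / 2 + d) / d) := by
    rw [intervalIntegral.integral_comp_sub_left (fun x => 1 / x) (π / 2 + d), integral_one_div]
    · simp
    · rw [uIcc_of_le (by linarith [pi_pos])]
      exact fun h => by linarith [h.1]
  rw [← h1, ← intervalIntegral.integral_const_mul, quarterI, hm]
  have hcont : ContinuousOn (fun φ => √2 * (1 / (π / 2 + d - φ))) (uIcc 0 (π / 2)) := by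
    rw [uIcc_of_le pi_div_two_mem.1]
    refine continuousOn_const.mul (continuousOn_const.div (by fun_prop) fun φ hφ => ?_)
    linarith [hφ.2]
  refine intervalIntegral.integral_mono_on pi_div_two_mem.1 hcont.intervalIntegrable
    ((continuous_legendre continuous_const hm1).intervalIntegrable _ _) fun φ hφ => ?_
  rw [legendre, mul_div_assoc]
  refine mul_le_mul_of_nonneg_left ?_ (sqrt_nonneg 2)
  refine one_div_le_one_div_of_le (delta_pos hm1 φ) ?_
  have hc : cos φ ≤ π / 2 - φ := by
    rw [← sin_pi_div_two_sub]
    exact sin_le (by linarith [hφ.2])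
  have hc0 : 0 ≤ cos φ := cos_nonneg_of_mem_Icc ⟨by linarith [hφ.1, pi_pos], hφ.2⟩
  rw [delta, sqrt_le_left (by linarith [hφ.2])]
  nlinarith [sin_sq_add_cos_sq φ, sin_sq_le_one φ, sq_nonneg d, mul_nonneg hc0 hd0.le,
    mul_nonneg (sub_nonneg.2 hφ.2) hd0.le]

theorem exists_Jone_neg : ∃ k ∈ Ioo (0 : ℝ) 1, Jone k < 0 := by
  -- This makes the logarithm at least `4 ≥ π`, so `quarterI ≥ 4√2` and `2 quarterJ ≤ 2√2 (π - 4) ≤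
  -- 0`; subtracting `ellJ > 0` gives strictness.
  set d := exp (-4) with hd
  have hd0 : 0 < d := exp_pos _
  have hd1 : d ≤ 1 / 2 := by
    have h1 : (1 : ℝ) + 1 ≤ exp 1 := add_one_le_exp 1
    have h2 : exp 1 ≤ exp 4 := exp_le_exp.2 (by norm_num)
    rw [hd, exp_neg, one_div]
    exact inv_anti₀ (by norm_num) (by linarith)
  have hk : 1 - 2 * d ^ 2 ∈ Ioo (0 : ℝ) 1 := ⟨by nlinarith, by linarith [sq_pos_of_pos hd0]⟩
  refine ⟨1 - 2 * d ^ 2, hk, ?_⟩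
  have h1 := le_quarterI hd0
  have h2 : 4 ≤ log ((π / 2 + d) / d) := by
    rw [le_log_iff_exp_le (by positivity), le_div_iff₀ hd0, hd, ← exp_add]
    norm_num
    linarith [pi_gt_three, exp_pos (-4)]
  have h3 : 4 * √2 ≤ quarterI (1 - 2 * d ^ 2) := by nlinarith [sqrt_nonneg 2]
  rw [Jone_eq hk.1.le hk.2]
  have h4 := quarterJ_le hk.1.le hk.2
  have h5 := ellJ_pos hk.1.le
  have h6 : √2 * π ≤ √2 * 4 := mul_le_mul_of_nonneg_left pi_le_four (sqrt_nonneg 2)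
  linarith

theorem exists_Jone_eq_zero : ∃ k ∈ Ioo (0 : ℝ) 1, Jone k = 0 := by
  obtain ⟨l, hl, hneg⟩ := exists_Jone_neg
  have hpos : 0 < Jone 0 := by rw [Jone_zero]; exact ellJ_pos le_rfl
  obtain ⟨k, hk, hk0⟩ := intermediate_value_Ioo' hl.1.le
    (continuousOn_Jone.mono (Icc_subset_Ico_right hl.2)) ⟨hneg, hpos⟩
  exact ⟨k, ⟨hk.1, hk.2.trans hl.2⟩, hk0⟩

theorem pi_div_two_le_zeroAction_one : π / 2 ≤ zeroAction 1 := by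
  have : ∫ _x in 0..π / 2, (1 : ℝ) ≤ zeroAction 1 := by
    refine intervalIntegral.integral_mono_on pi_div_two_mem.1 (by simp)
      ((continuous_sqrt_add_sin 1).intervalIntegrable _ _) fun x hx => ?_
    rw [one_le_sqrt]
    linarith [sin_nonneg_of_nonneg_of_le_pi hx.1 (by linarith [hx.2, pi_pos])]
  simpa using this

theorem quarterAction_one : quarterAction 1 = 2 * √2 := by
  rw [quarterAction_eq_legendre zero_le_one le_rfl]
  have : ∫ φ in 0..π / 2, legendre (fun s => 1 + s) ((1 + 1) / 2) φ
      = ∫ φ in 0..π / 2, 2 * √2 * cos φ := by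
    refine intervalIntegral.integral_congr fun φ hφ => ?_
    rw [uIcc_of_le pi_div_two_mem.1] at hφ
    have hc0 : 0 ≤ cos φ := cos_nonneg_of_mem_Icc ⟨by linarith [hφ.1, pi_pos], hφ.2⟩
    simp only [legendre, delta]
    rw [show 1 - (1 + 1) / 2 * sin φ ^ 2 = cos φ ^ 2 by rw [cos_sq']; ring, sqrt_sq hc0,
      show √2 * (1 + (1 - 2 * ((1 + 1) / 2) * sin φ ^ 2)) = 2 * √2 * (cos φ * cos φ) by
        rw [← sq, cos_sq']; ring, mul_div_assoc, mul_self_div_self]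
  rw [this]
  simp

theorem half_mul_sq_lt_three_pi {k : ℝ} (hk : k ∈ Ioo (0 : ℝ) 1) (hJ : Jone k = 0) :
    1 / 2 * k * Ione k ^ 2 < 3 * π := by
  -- With `J₁(k) = 0` the tangent at `k`, evaluated at `1`, reads `(1 + k)/2 · I₁ ≤ 4√2 - zeroAction
  -- 1 < 4.1`. Then `4k ≤ (1 + k)²` gives `U < 4.1²/2 < 3π`.
  have h1 := turnAction_tangent_le (k := 1) ⟨zero_le_one, le_rfl⟩ (Ioo_subset_Ico_self hk)
  rw [turnAction_eq hk.1.le hk.2, hJ, turnAction, quarterAction_one] at h1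
  have h2 := pi_div_two_le_zeroAction_one
  have h3 : √2 < 1.415 := by rw [sqrt_lt' (by norm_num)]; norm_num
  have h4 := pi_gt_d2
  have hI := Ione_pos hk.1.le
  have h5 : (1 + k) / 2 * Ione k < 4.1 := by linarith
  have h6 : 0 < (1 + k) / 2 * Ione k := mul_pos (by linarith [hk.1]) hI
  have h7 : ((1 + k) / 2 * Ione k) ^ 2 < 4.1 ^ 2 := pow_lt_pow_left₀ h5 h6.le two_ne_zero
  nlinarith [mul_nonneg (sq_nonneg (1 - k)) (sq_nonneg (Ione k))]

/-! ### Existence and uniqueness of the parameter `k` -/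

/-- Existence of the parameter for `γ > γc`. -/
theorem exists_Ione_param {γ : ℝ} (hγ : γc < γ) :
    ∃ k ∈ Ioo (0 : ℝ) 1, 0 < Jone k ∧ 2 * γ = Ione k ^ 3 / Jone k := by
  obtain ⟨l, hl, hl0⟩ := exists_Jone_eq_zero
  have hc : ContinuousOn (fun k => 2 * γ * Jone k - Ione k ^ 3) (Icc 0 l) :=
    ((continuousOn_Jone.const_mul _).sub (continuousOn_Ione.pow 3)).mono
      (Icc_subset_Ico_right hl.2)
  have h0 : 0 < 2 * γ * Jone 0 - Ione 0 ^ 3 := by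
    have hJ := ellJ_pos (le_refl (0 : ℝ))
    rw [γc, div_lt_iff₀ (by positivity)] at hγ
    rw [Jone_zero, Ione_zero]; linarith
  have h1 : 2 * γ * Jone l - Ione l ^ 3 < 0 := by
    rw [hl0]; have := pow_pos (Ione_pos hl.1.le) 3; linarith
  obtain ⟨k, hk, hk0⟩ := intermediate_value_Ioo' hl.1.le hc ⟨h1, h0⟩
  have hJ : 0 < Jone k := by
    rw [← hl0]
    exact strictAntiOn_Jone ⟨hk.1.le, hk.2.trans hl.2⟩ (Ioo_subset_Ico_self hl) hk.2
  refine ⟨k, ⟨hk.1, hk.2.trans hl.2⟩, hJ, ?_⟩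
  rw [eq_div_iff hJ.ne']
  simp only at hk0
  linarith

theorem γc_pos : 0 < γc := by
  have h1 := ellI_pos (le_refl (0 : ℝ))
  have h2 := ellJ_pos (le_refl (0 : ℝ))
  unfold γc; positivity

theorem Jone_pos_of_param {γ k : ℝ} (hγ : 0 < γ) (hk : 0 ≤ k) (h : 2 * γ = Ione k ^ 3 / Jone k) :
    0 < Jone k := by
  by_contra hJ
  have := div_nonpos_of_nonneg_of_nonpos (pow_pos (Ione_pos hk) 3).le (not_lt.1 hJ)
  linarith

/-- Where `J₁ > 0`, the quotient `I₁³ / J₁` is strictly increasing, since `I₁` increases and `J₁`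
strictly decreases. -/
theorem Ione_param_unique {γ k l : ℝ} (hγ : 0 < γ) (hk : k ∈ Ioo (0 : ℝ) 1)
    (hl : l ∈ Ioo (0 : ℝ) 1)
    (hk' : 2 * γ = Ione k ^ 3 / Jone k) (hl' : 2 * γ = Ione l ^ 3 / Jone l) : k = l := by
  wlog hkl : k ≤ l generalizing k l
  · exact (this hl hk hl' hk' (le_of_not_ge hkl)).symm
  by_contra hne
  have hlt := lt_of_le_of_ne hkl hne
  have hJk := Jone_pos_of_param hγ hk.1.le hk'
  have hJl := Jone_pos_of_param hγ hl.1.le hl'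
  have hJ := strictAntiOn_Jone (Ioo_subset_Ico_self hk) (Ioo_subset_Ico_self hl) hlt
  have hI := monotoneOn_Ione (Ioo_subset_Ico_self hk) (Ioo_subset_Ico_self hl) hkl
  rw [eq_div_iff hJk.ne'] at hk'
  rw [eq_div_iff hJl.ne'] at hl'
  have := pow_le_pow_left₀ (Ione_pos hk.1.le).le hI 3
  nlinarith

theorem one_div_sqrt_le_ellJ {k : ℝ} (h0 : 0 ≤ k) : 1 / √(k + 1) ≤ ellJ k := by
  have h1 : ∫ x in 0..π / 2, sin x * (1 / √(k + 1)) = 1 / √(k + 1) := by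
    rw [intervalIntegral.integral_mul_const]; simp
  rw [← h1]
  refine intervalIntegral.integral_mono_on_of_le_Ioo pi_div_two_mem.1
    ((continuous_sin.mul continuous_const).intervalIntegrable _ _) (intervalIntegrable_ellJ h0)
    fun x hx => ?_
  have hs : 0 < sin x := sin_pos_of_pos_of_lt_pi hx.1 (by linarith [hx.2, pi_pos])
  rw [mul_one_div]
  exact div_le_div_of_nonneg_left hs.le (by positivity) (sqrt_le_sqrt (by linarith [sin_le_one x]))

theorem ellI_le {k : ℝ} (h0 : 0 < k) : ellI k ≤ π / 2 * (1 / √k) := by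
  have h1 : ∫ x in 0..π / 2, 1 / √k = π / 2 * (1 / √k) := by simp
  rw [← h1]
  refine intervalIntegral.integral_mono_on pi_div_two_mem.1 (intervalIntegrable_ellI h0.le)
    (by simp) fun x hx => ?_
  refine one_div_le_one_div_of_le (by positivity) (sqrt_le_sqrt ?_)
  linarith [sin_nonneg_of_nonneg_of_le_pi hx.1 (by linarith [hx.2, pi_pos])]

theorem exists_ellI_param {γ : ℝ} (h0 : 0 < γ) (hγ : γ ≤ γc) :
    ∃ k : ℝ, 0 ≤ k ∧ 2 * γ = ellI k ^ 3 / ellJ k := by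
  -- Large enough to reverse the sign: `γK ≥ 4 > (π/2)³`, while `I(K) ≤ (π/2)/√K` and `J(K) ≥ 1/√(K
  -- + 1) ≥ 1/(2√K)`.
  set K := 1 + 4 / γ with hK
  have hK0 : 0 < K := by positivity
  have hc : ContinuousOn (fun k => 2 * γ * ellJ k - ellI k ^ 3) (Icc 0 K) :=
    ((continuousOn_ellJ.const_mul _).sub (continuousOn_ellI.pow 3)).mono Icc_subset_Ici_self
  have h1 : 2 * γ * ellJ 0 - ellI 0 ^ 3 ≤ 0 := by
    have hJ := ellJ_pos (le_refl (0 : ℝ))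
    rw [γc, le_div_iff₀ (by positivity)] at hγ
    linarith
  have h2 : 0 ≤ 2 * γ * ellJ K - ellI K ^ 3 := by
    have hs : 0 < √K := sqrt_pos.2 hK0
    have hs2 := sq_sqrt hK0.le
    have hK1 : 1 ≤ K := by rw [hK]; linarith [show 0 < 4 / γ by positivity]
    have hKγ : 4 ≤ γ * K := by rw [hK]; field_simp; linarith
    have hJ : 1 / (2 * √K) ≤ ellJ K := by
      refine le_trans ?_ (one_div_sqrt_le_ellJ hK0.le)
      refine one_div_le_one_div_of_le (by positivity) ?_
      rw [sqrt_le_left (by positivity)]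
      nlinarith
    have hI := pow_le_pow_left₀ (ellI_pos hK0.le).le (ellI_le hK0) 3
    have hpi : (π / 2) ^ 3 ≤ 1.58 ^ 3 :=
      pow_le_pow_left₀ (by positivity) (by linarith [pi_lt_d2]) 3
    have hI2 : ellI K ^ 3 ≤ γ * K * (1 / √K) ^ 3 := by
      refine hI.trans ?_
      rw [mul_pow]
      exact mul_le_mul_of_nonneg_right (by norm_num at hpi; linarith) (by positivity)
    have e1 : γ * K * (1 / √K) ^ 3 = 2 * γ * (1 / (2 * √K)) := by
      nth_rewrite 1 [← hs2]
      field_simp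
    have := mul_le_mul_of_nonneg_left hJ (show 0 ≤ 2 * γ by positivity)
    linarith
  obtain ⟨k, hk, hk0⟩ := intermediate_value_Icc hK0.le hc ⟨h1, h2⟩
  refine ⟨k, hk.1, ?_⟩
  rw [eq_div_iff (ellJ_pos hk.1).ne']
  simp only at hk0
  linarith

/-- The integral of `(a√(k + sin x) - b√(l + sin x))² / √(k + sin x) ≥ 0`. It replaces monotonicity
of `I³ / J`, where numerator and denominator both decrease. -/
theorem mul_zeroAction_le {a b k l : ℝ} (hk : 0 ≤ k) (hl : 0 ≤ l) :
    2 * a * b * zeroAction l ≤ a ^ 2 * zeroAction k + b ^ 2 * (l * ellI k + ellJ k) := by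
  have h1 := (intervalIntegrable_ellI hk).const_mul l
  have h2 := intervalIntegrable_ellJ hk
  have hc := (continuous_sqrt_add_sin k).intervalIntegrable (μ := volume) 0 (π / 2)
  have hc' := (continuous_sqrt_add_sin l).intervalIntegrable (μ := volume) 0 (π / 2)
  rw [zeroAction, zeroAction, ellI, ellJ, ← intervalIntegral.integral_const_mul l,
    ← intervalIntegral.integral_add h1 h2, ← intervalIntegral.integral_const_mul,
    ← intervalIntegral.integral_const_mul, ← intervalIntegral.integral_const_mul,
    ← intervalIntegral.integral_add (hc.const_mul _) ((h1.add h2).const_mul _)]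
  refine intervalIntegral.integral_mono_on_of_le_Ioo pi_div_two_mem.1 (hc'.const_mul _)
    ((hc.const_mul _).add ((h1.add h2).const_mul _)) fun x hx => ?_
  have hs : 0 < sin x := sin_pos_of_pos_of_lt_pi hx.1 (by linarith [hx.2, pi_pos])
  have hp : 0 < √(k + sin x) := sqrt_pos.2 (by positivity)
  have hq := sq_sqrt (show 0 ≤ l + sin x by positivity)
  have e : a ^ 2 * √(k + sin x) + b ^ 2 * (l * (1 / √(k + sin x)) + sin x / √(k + sin x))
      - 2 * a * b * √(l + sin x)
      = (a * √(k + sin x) - b * √(l + sin x)) ^ 2 / √(k + sin x) := by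
    field_simp
    linear_combination (-b ^ 2) * hq
  have : 0 ≤ (a * √(k + sin x) - b * √(l + sin x)) ^ 2 / √(k + sin x) := by positivity
  linarith

theorem ellI_param_unique {γ k l : ℝ} (hγ : 0 < γ) (hk : 0 ≤ k) (hl : 0 ≤ l)
    (hk' : 2 * γ = ellI k ^ 3 / ellJ k) (hl' : 2 * γ = ellI l ^ 3 / ellJ l) : k = l := by
  have h1 := mul_zeroAction_le (a := ellI k) (b := ellI l) hk hl
  have h2 := mul_zeroAction_le (a := ellI l) (b := ellI k) hl hk
  rw [eq_div_iff (ellJ_pos hk).ne'] at hk'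
  rw [eq_div_iff (ellJ_pos hl).ne'] at hl'
  rw [zeroAction_eq hk, zeroAction_eq hl] at h1 h2
  have hI := ellI_pos hk
  have hI' := ellI_pos hl
  have hJ : ellJ k = ellI k ^ 3 / (2 * γ) := by field_simp; linarith
  have hJ' : ellJ l = ellI l ^ 3 / (2 * γ) := by field_simp; linarith
  rw [hJ, hJ'] at h1 h2
  set a := ellI k
  set b := ellI l
  -- With `J = I³/(2γ)` inserted, the two inequalities are divided by `a` and `b` and added. The
  -- terms in `k` and `l` cancel, leaving `(a² - b²)²/(2γ) ≤ 0`.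
  have h4 : (a ^ 2 - b ^ 2) ^ 2 ≤ 0 := by
    have e1 : 2 * b * (l * b + b ^ 3 / (2 * γ))
        ≤ a ^ 2 * (k + a ^ 2 / (2 * γ)) + b ^ 2 * (l + a ^ 2 / (2 * γ)) := by
      have := div_le_div_of_nonneg_right h1 hI.le
      have ea : 2 * a * b * (l * b + b ^ 3 / (2 * γ)) / a = 2 * b * (l * b + b ^ 3 / (2 * γ)) := by
        field_simp
      have eb : (a ^ 2 * (k * a + a ^ 3 / (2 * γ)) + b ^ 2 * (l * a + a ^ 3 / (2 * γ))) / a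
          = a ^ 2 * (k + a ^ 2 / (2 * γ)) + b ^ 2 * (l + a ^ 2 / (2 * γ)) := by field_simp
      rwa [ea, eb] at this
    have e2 : 2 * a * (k * a + a ^ 3 / (2 * γ))
        ≤ b ^ 2 * (l + b ^ 2 / (2 * γ)) + a ^ 2 * (k + b ^ 2 / (2 * γ)) := by
      have := div_le_div_of_nonneg_right h2 hI'.le
      have ea : 2 * b * a * (k * a + a ^ 3 / (2 * γ)) / b = 2 * a * (k * a + a ^ 3 / (2 * γ)) := by
        field_simp
      have eb : (b ^ 2 * (l * b + b ^ 3 / (2 * γ)) + a ^ 2 * (k * b + b ^ 3 / (2 * γ))) / b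
          = b ^ 2 * (l + b ^ 2 / (2 * γ)) + a ^ 2 * (k + b ^ 2 / (2 * γ)) := by field_simp
      rwa [ea, eb] at this
    have e3 : (a ^ 2 - b ^ 2) ^ 2 / (2 * γ) ≤ 0 := by
      have : (a ^ 2 - b ^ 2) ^ 2 / (2 * γ) = 2 * b * (l * b + b ^ 3 / (2 * γ))
          + 2 * a * (k * a + a ^ 3 / (2 * γ)) - (a ^ 2 * (k + a ^ 2 / (2 * γ))
          + b ^ 2 * (l + a ^ 2 / (2 * γ))) - (b ^ 2 * (l + b ^ 2 / (2 * γ))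
          + a ^ 2 * (k + b ^ 2 / (2 * γ))) := by ring
      linarith
    have := mul_nonpos_of_nonpos_of_nonneg e3 (show 0 ≤ 2 * γ by positivity)
    rwa [div_mul_cancel₀ _ (by positivity)] at this
  have h5 : a ^ 2 = b ^ 2 := by
    have := pow_eq_zero_iff two_ne_zero |>.1 (le_antisymm h4 (sq_nonneg _))
    linarith
  exact strictAntiOn_ellI.injOn hk hl ((sq_eq_sq₀ hI.le hI'.le).1 h5)

/-! ### Measurable controls: change of variables and the weighted length -/

section Control

variable {u : ℝ → ℝ}

theorem IsControl.intervalIntegrable (hu : IsControl u) : IntervalIntegrable u volume 0 1 := by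
  obtain ⟨M, hM⟩ := hu.bounded
  rw [intervalIntegrable_iff_integrableOn_Icc_of_le zero_le_one]
  refine Integrable.of_bound hu.measurable.aestronglyMeasurable M ?_
  exact (ae_restrict_iff' measurableSet_Icc).2 (ae_of_all _ hM)

theorem IsControl.intervalIntegrable_sq (hu : IsControl u) :
    IntervalIntegrable (fun t => u t ^ 2) volume 0 1 := by
  obtain ⟨M, hM⟩ := hu.bounded
  rw [intervalIntegrable_iff_integrableOn_Icc_of_le zero_le_one]
  refine Integrable.of_bound (hu.measurable.pow_const 2).aestronglyMeasurable (M ^ 2) ?_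
  refine (ae_restrict_iff' measurableSet_Icc).2 (ae_of_all _ fun t ht => ?_)
  rw [norm_pow]
  exact pow_le_pow_left₀ (norm_nonneg _) (hM t ht) 2

theorem IsControl.mono (hu : IsControl u) {s t : ℝ} (hs : s ∈ Icc (0 : ℝ) 1)
    (ht : t ∈ Icc (0 : ℝ) 1) : IntervalIntegrable u volume s t :=
  hu.intervalIntegrable.mono_set (by rw [uIcc_of_le zero_le_one]; exact uIcc_subset_Icc hs ht)

theorem IsControl.exists_lipschitz (hu : IsControl u) :
    ∃ K, LipschitzOnWith K (angle u) (Icc 0 1) := by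
  obtain ⟨M, hM⟩ := hu.bounded
  refine ⟨M.toNNReal, LipschitzOnWith.of_dist_le_mul fun t ht s hs => ?_⟩
  have h0 : (0 : ℝ) ∈ Icc (0 : ℝ) 1 := ⟨le_rfl, zero_le_one⟩
  have hM0 : 0 ≤ M := (abs_nonneg _).trans (hM 0 h0)
  rw [dist_eq_norm, Real.dist_eq, angle, angle,
    intervalIntegral.integral_interval_sub_left (hu.mono h0 ht) (hu.mono h0 hs),
    coe_toNNReal _ hM0]
  refine intervalIntegral.norm_integral_le_of_norm_le_const fun x hx => hM x ?_
  exact uIcc_subset_Icc hs ht (uIoc_subset_uIcc hx)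

theorem IsControl.continuousOn_angle (hu : IsControl u) : ContinuousOn (angle u) (Icc 0 1) :=
  hu.exists_lipschitz.choose_spec.continuousOn

theorem IsControl.intervalIntegrable_comp (hu : IsControl u) {g : ℝ → ℝ} (hg : Continuous g) :
    IntervalIntegrable (fun t => g (angle u t)) volume 0 1 := by
  refine ContinuousOn.intervalIntegrable ?_
  rw [uIcc_of_le zero_le_one]
  exact hg.comp_continuousOn hu.continuousOn_angle

theorem IsControl.intervalIntegrable_abs_mul_comp (hu : IsControl u) {g : ℝ → ℝ}
    (hg : Continuous g) : IntervalIntegrable (fun t => |u t| * g (angle u t)) volume 0 1 := by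
  refine hu.intervalIntegrable.abs.mul_continuousOn ?_
  rw [uIcc_of_le zero_le_one]
  exact hg.comp_continuousOn hu.continuousOn_angle

/-- Change of variables along the trajectory of a control. -/
theorem IsControl.integral_mul_comp (hu : IsControl u) {g : ℝ → ℝ} (hg : Continuous g)
    {s t : ℝ} (hs : s ∈ Icc (0 : ℝ) 1) (ht : t ∈ Icc (0 : ℝ) 1) :
    ∫ τ in s..t, u τ * g (angle u τ) = ∫ x in angle u s..angle u t, g x := by
  obtain ⟨K, hK⟩ := hu.exists_lipschitz
  have hsub : uIcc s t ⊆ Icc 0 1 := uIcc_subset_Icc hs ht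
  set G : ℝ → ℝ := fun x => ∫ y in 0..x, g y with hG
  have hGd : ∀ x, HasDerivAt G (g x) x := fun x => hg.integral_hasStrictDerivAt 0 x |>.hasDerivAt
  obtain ⟨r, hr⟩ := (isCompact_Icc.image_of_continuousOn
    hu.continuousOn_angle).isBounded.subset_closedBall 0
  obtain ⟨C, hC⟩ := (isCompact_closedBall (0 : ℝ) r).exists_bound_of_continuousOn hg.continuousOn
  have hL : LipschitzOnWith C.toNNReal G (Metric.closedBall 0 r) := by
    refine (convex_closedBall _ _).lipschitzOnWith_of_nnnorm_hasDerivWithin_le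
      (f' := g) (fun x _ => (hGd x).hasDerivWithinAt) fun x hx => ?_
    rw [← NNReal.coe_le_coe, coe_nnnorm]
    exact (hC x hx).trans (le_coe_toNNReal C)
  -- The composition is Lipschitz, hence absolutely continuous, so the fundamental theorem applies
  -- although `θ' = u` holds only almost everywhere.
  have hcompL : LipschitzOnWith (C.toNNReal * K) (G ∘ angle u) (uIcc s t) :=
    hL.comp (hK.mono hsub) fun x hx => hr ⟨x, hsub hx, rfl⟩
  have hac := hcompL.absolutelyContinuousOnInterval.integral_deriv_eq_sub
  have h1 : ∫ x in angle u s..angle u t, g x = G (angle u t) - G (angle u s) := by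
    rw [hG]
    exact (intervalIntegral.integral_interval_sub_left (hg.intervalIntegrable _ _)
      (hg.intervalIntegrable _ _)).symm
  rw [h1, ← show (G ∘ angle u) t = G (angle u t) from rfl,
    ← show (G ∘ angle u) s = G (angle u s) from rfl, ← hac]
  refine intervalIntegral.integral_congr_ae ?_
  filter_upwards [hu.intervalIntegrable.ae_hasDerivAt_integral] with x hx hxs
  have hx01 : x ∈ uIcc (0 : ℝ) 1 := by
    rw [uIcc_of_le zero_le_one]; exact hsub (uIoc_subset_uIcc hxs)
  have hd : HasDerivAt (angle u) (u x) x := hx hx01 0 left_mem_uIcc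
  rw [((hGd (angle u x)).comp x hd).deriv, mul_comm]

theorem IsControl.abs_integral_le (hu : IsControl u) {g : ℝ → ℝ} (hg : Continuous g)
    (hg0 : ∀ x, 0 ≤ g x) {s t : ℝ} (hs : s ∈ Icc (0 : ℝ) 1) (ht : t ∈ Icc (0 : ℝ) 1)
    (hst : s ≤ t) :
    |∫ x in angle u s..angle u t, g x| ≤ ∫ τ in s..t, |u τ| * g (angle u τ) := by
  rw [← hu.integral_mul_comp hg hs ht]
  refine (intervalIntegral.abs_integral_le_integral_abs hst).trans (le_of_eq ?_)
  refine intervalIntegral.integral_congr fun τ _ => ?_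
  simp only [abs_mul, abs_of_nonneg (hg0 _)]

/-- A path from `0` to `π / 2` with given range crosses the levels outside `[0, π / 2]` twice. -/
theorem IsControl.crossing_le (hu : IsControl u) (h1 : angle u 1 = π / 2) {g : ℝ → ℝ}
    (hg : Continuous g) (hg0 : ∀ x, 0 ≤ g x) {s t : ℝ} (hs : s ∈ Icc (0 : ℝ) 1)
    (ht : t ∈ Icc (0 : ℝ) 1) :
    2 * (∫ x in angle u s..angle u t, g x) - ∫ x in 0..π / 2, g x
      ≤ ∫ τ in 0..1, |u τ| * g (angle u τ) := by
  have z : (0 : ℝ) ∈ Icc (0 : ℝ) 1 := ⟨le_rfl, zero_le_one⟩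
  have o : (1 : ℝ) ∈ Icc (0 : ℝ) 1 := ⟨zero_le_one, le_rfl⟩
  have hz : angle u 0 = 0 := by simp [angle]
  have hii : ∀ a b : ℝ, IntervalIntegrable g volume a b := fun a b => hg.intervalIntegrable a b
  have hint : ∀ {a b : ℝ}, a ∈ Icc (0 : ℝ) 1 → b ∈ Icc (0 : ℝ) 1 →
      IntervalIntegrable (fun τ => |u τ| * g (angle u τ)) volume a b := fun ha hb =>
    (hu.intervalIntegrable_abs_mul_comp hg).mono_set
      (by rw [uIcc_of_le zero_le_one]; exact uIcc_subset_Icc ha hb)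
  have e1 : (∫ x in angle u s..angle u t, g x) = (∫ x in angle u s..0, g x)
      + (∫ x in 0..π / 2, g x) + ∫ x in π / 2..angle u t, g x := by
    rw [intervalIntegral.integral_add_adjacent_intervals (hii _ _) (hii _ _),
      intervalIntegral.integral_add_adjacent_intervals (hii _ _) (hii _ _)]
  have p0 : 0 ≤ ∫ x in 0..π / 2, g x :=
    intervalIntegral.integral_nonneg (by positivity) fun x _ => hg0 x
  rcases le_total s t with hst | hst
  · have a1 := hu.abs_integral_le hg hg0 z hs hs.1
    have a2 := hu.abs_integral_le hg hg0 hs ht hst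
    have a3 := hu.abs_integral_le hg hg0 ht o ht.2
    have e2 := intervalIntegral.integral_add_adjacent_intervals (hint z hs) (hint hs ht)
    have e3 := intervalIntegral.integral_add_adjacent_intervals (hint z ht) (hint ht o)
    rw [hz, intervalIntegral.integral_symm, abs_neg] at a1
    rw [h1, intervalIntegral.integral_symm, abs_neg] at a3
    have b1 := le_abs_self (∫ x in angle u s..0, g x)
    have b2 := le_abs_self (∫ x in angle u s..angle u t, g x)
    have b3 := le_abs_self (∫ x in π / 2..angle u t, g x)
    linarith
  -- If the upper level is reached first, the path is even longer: the three pieces add up to twice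
  -- the window plus, not minus, the middle part.
  · have a1 := hu.abs_integral_le hg hg0 z ht ht.1
    have a2 := hu.abs_integral_le hg hg0 ht hs hst
    have a3 := hu.abs_integral_le hg hg0 hs o hs.2
    have e2 := intervalIntegral.integral_add_adjacent_intervals (hint z ht) (hint ht hs)
    have e3 := intervalIntegral.integral_add_adjacent_intervals (hint z hs) (hint hs o)
    rw [hz] at a1
    rw [intervalIntegral.integral_symm, abs_neg] at a2
    rw [h1] at a3
    have b1 := le_abs_self (∫ x in 0..angle u t, g x)
    have b2 := le_abs_self (∫ x in angle u s..angle u t, g x)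
    have b3 := le_abs_self (∫ x in angle u s..π / 2, g x)
    have c1 := intervalIntegral.integral_add_adjacent_intervals (hii 0 (π / 2)) (hii (π / 2) (angle u t))
    have c2 := intervalIntegral.integral_add_adjacent_intervals (hii (angle u s) 0) (hii 0 (π / 2))
    linarith

/-- Completing the square in the sensitivity, for a rotated multiplier. -/
theorem IsControl.cost_ge_action (hu : IsControl u) {γ ε : ℝ} (hγ : 0 < γ) (d : ℝ) :
    (1 / 2) * (∫ t in 0..1, u t ^ 2) + ε / 2 * (∫ t in 0..1, sin (2 * angle u t - d))
      - ε ^ 2 / (8 * γ) ≤ cost γ u := by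
  have e : ∫ t in 0..1, sin (2 * angle u t - d) = cos d * Sx u 1 - sin d * Sz u 1 := by
    rw [Sx, Sz, ← intervalIntegral.integral_const_mul, ← intervalIntegral.integral_const_mul,
      ← intervalIntegral.integral_sub
        ((hu.intervalIntegrable_comp (g := fun x => sin (2 * x)) (by fun_prop)).const_mul _)
        ((hu.intervalIntegrable_comp (g := fun x => cos (2 * x)) (by fun_prop)).const_mul _)]
    refine intervalIntegral.integral_congr fun t _ => ?_
    simp only [sin_sub]; ring
  rw [e, cost]
  set X := Sx u 1
  set Z := Sz u 1
  have h1 : (cos d * X - sin d * Z) ^ 2 ≤ Z ^ 2 + X ^ 2 := by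
    nlinarith [sq_nonneg (sin d * X + cos d * Z), sin_sq_add_cos_sq d]
  have h2 : 0 ≤ (γ * (cos d * X - sin d * Z) - ε / 2) ^ 2 / (2 * γ) := by positivity
  have h3 : (γ * (cos d * X - sin d * Z) - ε / 2) ^ 2 / (2 * γ)
      = γ * ((1 / 2) * (cos d * X - sin d * Z) ^ 2) - ε / 2 * (cos d * X - sin d * Z)
        + ε ^ 2 / (8 * γ) := by field_simp; ring
  have h4 := mul_le_mul_of_nonneg_left h1 hγ.le
  linarith

/-- Pointwise this is `(|u| - √ε √(k + sin))² ≥ 0`, integrated over unit time. Equality holds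
exactly when the motion has energy `u² = ε(k + sin)` almost everywhere. -/
theorem IsControl.action_ge (hu : IsControl u) {ε k d : ℝ} (hε : 0 ≤ ε)
    (hk : ∀ t ∈ Icc (0 : ℝ) 1, 0 ≤ k + sin (2 * angle u t - d)) :
    √ε * (∫ t in 0..1, |u t| * √(k + sin (2 * angle u t - d))) - ε * k / 2
      ≤ (1 / 2) * (∫ t in 0..1, u t ^ 2) + ε / 2 * (∫ t in 0..1, sin (2 * angle u t - d)) := by
  have i1 := hu.intervalIntegrable_abs_mul_comp (g := fun x => √(k + sin (2 * x - d)))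
    (by fun_prop)
  have i2 := hu.intervalIntegrable_comp (g := fun x => sin (2 * x - d)) (by fun_prop)
  have i3 := hu.intervalIntegrable_sq
  have : √ε * (∫ t in 0..1, |u t| * √(k + sin (2 * angle u t - d)))
      ≤ ∫ t in 0..1, ((1 / 2) * u t ^ 2 + ε / 2 * sin (2 * angle u t - d) + ε * k / 2) := by
    rw [← intervalIntegral.integral_const_mul]
    refine intervalIntegral.integral_mono_on zero_le_one (i1.const_mul _)
      (((i3.const_mul _).add (i2.const_mul _)).add (by simp)) fun t ht => ?_
    have h1 := sq_sqrt hε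
    have h2 := sq_sqrt (hk t ht)
    have h3 := sq_abs (u t)
    nlinarith [sq_nonneg (|u t| - √ε * √(k + sin (2 * angle u t - d))),
      mul_pow (√ε) (√(k + sin (2 * angle u t - d))) 2]
  rw [intervalIntegral.integral_add ((i3.const_mul _).add (i2.const_mul _)) (by simp),
    intervalIntegral.integral_add (i3.const_mul _) (i2.const_mul _),
    intervalIntegral.integral_const_mul, intervalIntegral.integral_const_mul] at this
  simp only [intervalIntegral.integral_const, sub_zero, one_smul] at this
  linarith

end Control

/-! ### Shifted windows and the calibration bounds -/

section Window

theorem neg_sin_le_sin {s y : ℝ} (hs : s ∈ Icc 0 (π / 2)) (hy : y ∈ Icc (-s) (π + s)) :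
    -sin s ≤ sin y := by
  rw [← sin_neg]
  rcases le_total y (π / 2) with h | h
  · exact sin_le_sin_of_le_of_le_pi_div_two (by linarith [hs.2]) h hy.1
  · rw [← sin_pi_sub y]
    exact sin_le_sin_of_le_of_le_pi_div_two (by linarith [hs.2]) (by linarith) (by linarith [hy.2])

theorem integral_sqrt_reflect (k a b : ℝ) :
    ∫ x in (π - b)..(π - a), √(k + sin x) = ∫ x in a..b, √(k + sin x) := by
  rw [← intervalIntegral.integral_comp_sub_left (fun x => √(k + sin x)) π]
  simp only [sin_pi_sub]

/-- Among the windows of length `π`, the one centred at `π / 2` has the largest integral. -/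
theorem window_le {k d : ℝ} (hd : |d| ≤ π) :
    ∫ x in (-d)..(π - d), √(k + sin x) ≤ ∫ x in 0..π, √(k + sin x) := by
  wlog hd0 : 0 ≤ d generalizing d
  · have := this (d := -d) (by rwa [abs_neg]) (by linarith)
    rwa [← integral_sqrt_reflect, show π - (π - -d) = -d by ring,
      show π - - -d = π - d by ring] at this
  have hii : ∀ a b : ℝ, IntervalIntegrable (fun x => √(k + sin x)) volume a b := fun a b =>
    (continuous_sqrt_add_sin k).intervalIntegrable a b
  have e1 := intervalIntegral.integral_add_adjacent_intervals (hii (-d) 0) (hii 0 (π - d))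
  have e2 := intervalIntegral.integral_add_adjacent_intervals (hii 0 (π - d)) (hii (π - d) π)
  have e3 : ∫ x in (π - d)..π, √(k + sin x) = ∫ x in 0..d, √(k + sin x) := by
    have := integral_sqrt_reflect k 0 d
    rwa [sub_zero] at this
  have e4 : ∫ x in (-d)..0, √(k + sin x) = ∫ x in 0..d, √(k + sin (-x)) := by
    rw [intervalIntegral.integral_comp_neg (fun x => √(k + sin x)), neg_zero]
  have e5 : ∫ x in 0..d, √(k + sin (-x)) ≤ ∫ x in 0..d, √(k + sin x) := by
    refine intervalIntegral.integral_mono_on hd0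
      (Continuous.intervalIntegrable (by fun_prop) _ _) (hii _ _) fun x hx => ?_
    refine sqrt_le_sqrt ?_
    rw [sin_neg]
    linarith [sin_nonneg_of_nonneg_of_le_pi hx.1 (hx.2.trans ((le_abs_self d).trans hd))]
  linarith

theorem integral_symm_window (k s : ℝ) :
    ∫ x in (-s)..(π + s), √(k + sin x) = 2 * ∫ x in (-s)..(π / 2), √(k + sin x) := by
  have hii : ∀ a b : ℝ, IntervalIntegrable (fun x => √(k + sin x)) volume a b := fun a b =>
    (continuous_sqrt_add_sin k).intervalIntegrable a b
  have e1 := intervalIntegral.integral_add_adjacent_intervals (hii (-s) (π / 2))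
    (hii (π / 2) (π + s))
  have e2 := integral_sqrt_reflect k (-s) (π / 2)
  rw [show π - π / 2 = π / 2 by ring, sub_neg_eq_add] at e2
  linarith

theorem integral_double_angle (k d a b : ℝ) :
    ∫ x in a..b, √(k + sin (2 * x - d))
      = 1 / 2 * ∫ y in (2 * a - d)..(2 * b - d), √(k + sin y) := by
  rw [intervalIntegral.integral_comp_mul_sub (fun y => √(k + sin y)) two_ne_zero d]
  simp

end Window

/-- The calibration lower bound for the cost. -/
theorem IsControl.cost_ge {u : ℝ → ℝ} (hu : IsControl u) (h1 : angle u 1 = π / 2) {γ ε : ℝ}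
    (hγ : 0 < γ) (hε : 0 ≤ ε) :
    ∃ s ∈ Icc 0 (π / 2), ∀ k, sin s ≤ k →
      √ε * (2 * (∫ x in (-s)..(π / 2), √(k + sin x)) - zeroAction k) - ε * k / 2
        - ε ^ 2 / (8 * γ) ≤ cost γ u := by
  have hne : (Icc (0 : ℝ) 1).Nonempty := ⟨0, le_rfl, zero_le_one⟩
  obtain ⟨p, hp, hpmin⟩ := isCompact_Icc.exists_isMinOn hne hu.continuousOn_angle
  obtain ⟨q, hq, hqmax⟩ := isCompact_Icc.exists_isMaxOn hne hu.continuousOn_angle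
  have hz : angle u 0 = 0 := by simp [angle]
  have hp0 : angle u p ≤ 0 := hz ▸ hpmin (show (0 : ℝ) ∈ Icc 0 1 from ⟨le_rfl, zero_le_one⟩)
  have hq1 : π / 2 ≤ angle u q := h1 ▸ hqmax (show (1 : ℝ) ∈ Icc 0 1 from ⟨zero_le_one, le_rfl⟩)
  -- `a` and `b` are the overshoots below `0` and above `π/2`, reduced so that their sum is at most
  -- `π/2`. In the reduced case `sin s = 1`, and `k ≥ 1` makes `k + sin` nonnegative everywhere, so
  -- the true range is irrelevant.
  obtain ⟨a, b, ha0, hb0, ha, hb, hab, hrange⟩ : ∃ a b : ℝ, 0 ≤ a ∧ 0 ≤ b ∧ a ≤ -angle u p ∧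
      b ≤ angle u q - π / 2 ∧ a + b ≤ π / 2 ∧
      (a + b = π / 2 ∨ (a = -angle u p ∧ b = angle u q - π / 2)) := by
    by_cases h : -angle u p + (angle u q - π / 2) ≤ π / 2
    · exact ⟨_, _, by linarith, by linarith, le_rfl, le_rfl, h, Or.inr ⟨rfl, rfl⟩⟩
    · rcases le_total (-angle u p) (π / 2) with h' | h'
      · exact ⟨-angle u p, π / 2 + angle u p, by linarith, by linarith, le_rfl, by linarith,
          by linarith, Or.inl (by ring)⟩
      · exact ⟨π / 2, 0, by positivity, le_rfl, h', by linarith, by linarith, Or.inl (by ring)⟩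
  set s := a + b with hs
  -- With this shift, `x ↦ 2x - d` maps `[-a, π/2 + b]` onto `[-s, π + s]`, symmetric about `π/2`.
  -- The middle part `[0, π/2]`, no longer centred, enters with a minus sign and is handled by
  -- `window_le`.
  set d := b - a with hd
  have hsmem : s ∈ Icc 0 (π / 2) := ⟨by positivity, hab⟩
  refine ⟨s, hsmem, fun k hk => ?_⟩
  have hpos : ∀ t ∈ Icc (0 : ℝ) 1, 0 ≤ k + sin (2 * angle u t - d) := by
    intro t ht
    rcases hrange with h | ⟨h, h'⟩
    · rw [h, sin_pi_div_two] at hk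
      linarith [neg_one_le_sin (2 * angle u t - d)]
    · have l1 : angle u p ≤ angle u t := hpmin ht
      have l2 : angle u t ≤ angle u q := hqmax ht
      have := neg_sin_le_sin hsmem (y := 2 * angle u t - d) ⟨by linarith, by linarith⟩
      linarith
  have hgc : Continuous fun x => √(k + sin (2 * x - d)) := by fun_prop
  have c1 := hu.crossing_le h1 hgc (fun x => sqrt_nonneg _) hp hq
  have c2 : ∫ x in (-a)..(π / 2 + b), √(k + sin (2 * x - d))
      ≤ ∫ x in angle u p..angle u q, √(k + sin (2 * x - d)) := by
    refine intervalIntegral.integral_mono_interval (by linarith) (by linarith [pi_pos])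
      (by linarith) (ae_of_all _ fun x => sqrt_nonneg _) (hgc.intervalIntegrable _ _)
  rw [integral_double_angle, show 2 * -a - d = -s by rw [hs, hd]; ring,
    show 2 * (π / 2 + b) - d = π + s by rw [hs, hd]; ring, integral_symm_window] at c2
  have c3 : ∫ x in 0..π / 2, √(k + sin (2 * x - d)) ≤ zeroAction k := by
    rw [integral_double_angle, show 2 * 0 - d = -d by ring, show 2 * (π / 2) - d = π - d by ring]
    have w := window_le (k := k) (d := d) (by rw [abs_le]; constructor <;> linarith [pi_pos])
    have w2 := integral_symm_window k 0
    rw [neg_zero, add_zero] at w2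
    rw [w2] at w
    rw [zeroAction]
    linarith
  have c4 := hu.cost_ge_action (ε := ε) hγ d
  have c5 := hu.action_ge hε hpos
  have c6 := mul_le_mul_of_nonneg_left
    (show 2 * (∫ x in (-s)..(π / 2), √(k + sin x)) - zeroAction k
      ≤ ∫ t in 0..1, |u t| * √(k + sin (2 * angle u t - d)) by linarith) (sqrt_nonneg ε)
  linarith

theorem turnAction_sin {s : ℝ} (hs : s ∈ Icc 0 (π / 2)) :
    turnAction (sin s) = 2 * (∫ x in (-s)..(π / 2), √(sin s + sin x)) - zeroAction (sin s) := by
  rw [turnAction, quarterAction, arcsin_sin (by linarith [hs.1, pi_pos]) hs.2]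

/-- Lower bound by the action of the path with two turning points. -/
theorem IsControl.cost_ge_of_Ione {u : ℝ → ℝ} (hu : IsControl u) (h1 : angle u 1 = π / 2)
    {γ k : ℝ} (hγ : 0 < γ) (hk : k ∈ Ico (0 : ℝ) 1) :
    Ione k * turnAction k - Ione k ^ 2 * k / 2 - (Ione k ^ 2) ^ 2 / (8 * γ) ≤ cost γ u := by
  obtain ⟨s, hs, h⟩ := hu.cost_ge h1 hγ (sq_nonneg (Ione k))
  have hI := Ione_pos hk.1
  have hs0 : 0 ≤ sin s := sin_nonneg_of_nonneg_of_le_pi hs.1 (by linarith [hs.2, pi_pos])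
  -- At the smallest admissible level the bound contains `turnAction (sin s)`. Its tangent at `k`
  -- has slope `I₁(k)/2`, and with `√ε = I₁(k)` the terms in `sin s` cancel.
  have h := h (sin s) le_rfl
  have ht := turnAction_tangent_le ⟨hs0, sin_le_one s⟩ hk
  rw [turnAction_sin hs] at ht
  rw [sqrt_sq hI.le] at h
  have := mul_le_mul_of_nonneg_left ht hI.le
  linarith

/-- Lower bound by the action of the monotone path. -/
theorem IsControl.cost_ge_of_ellI {u : ℝ → ℝ} (hu : IsControl u) (h1 : angle u 1 = π / 2)
    {γ k : ℝ} (hγ : 0 < γ) (hk : 0 ≤ k) :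
    ellI k * zeroAction k - ellI k ^ 2 * k / 2 - (ellI k ^ 2) ^ 2 / (8 * γ) ≤ cost γ u := by
  obtain ⟨s, hs, h⟩ := hu.cost_ge h1 hγ (sq_nonneg (ellI k))
  have hI := ellI_pos hk
  have hs0 : 0 ≤ sin s := sin_nonneg_of_nonneg_of_le_pi hs.1 (by linarith [hs.2, pi_pos])
  rw [sqrt_sq hI.le] at h
  have hmono : ∀ {r l : ℝ}, 0 ≤ r →
      zeroAction l ≤ ∫ x in (-r)..(π / 2), √(l + sin x) := fun {r l} hr =>
    intervalIntegral.integral_mono_interval (by linarith) (by positivity) le_rfl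
      (ae_of_all _ fun x => sqrt_nonneg _) ((continuous_sqrt_add_sin l).intervalIntegrable _ _)
  rcases le_or_gt (sin s) k with hsk | hsk
  · have h := h k hsk
    have := mul_le_mul_of_nonneg_left (hmono (l := k) hs.1) hI.le
    linarith
  -- The level `k` is inadmissible here, so `sin s` is used. The tangent at `k` has slope `I₁/2 ≥
  -- I/2` and `turnAction k ≥ zeroAction k`, which suffices because `sin s > k`.
  · have hk' : k ∈ Ico (0 : ℝ) 1 := ⟨hk, hsk.trans_le (sin_le_one s)⟩
    have h := h (sin s) le_rfl
    have ht := turnAction_tangent_le ⟨hs0, sin_le_one s⟩ hk'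
    rw [turnAction_sin hs, turnAction, quarterAction] at ht
    have hm := hmono (l := k) (arcsin_nonneg.2 hk)
    have hII := mul_le_mul_of_nonneg_left (ellI_le_Ione hk) (show 0 ≤ (sin s - k) / 2 by linarith)
    have := mul_le_mul_of_nonneg_left (show zeroAction k + (sin s - k) / 2 * ellI k
      ≤ 2 * (∫ x in (-s)..(π / 2), √(sin s + sin x)) - zeroAction (sin s) by linarith) hI.le
    linarith

/-! ### Flows of positive autonomous scalar equations -/

/-- Separation of variables: the solution is the inverse of `Ψ(x) = ∫ dy / f(y)`. The upper bound on
`f` gives `Ψ' ≥ 1/M`, so `Ψ` is onto and the solution is global. -/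
theorem exists_flow {f : ℝ → ℝ} (hf : Continuous f) (hpos : ∀ x, 0 < f x) {M : ℝ}
    (hM : ∀ x, f x ≤ M) (x₀ : ℝ) :
    ∃ φ : ℝ → ℝ, φ 0 = x₀ ∧ ∀ t, HasDerivAt φ (f (φ t)) t := by
  have hg : Continuous fun x => 1 / f x := continuous_const.div hf fun x => (hpos x).ne'
  set Ψ : ℝ → ℝ := fun x => ∫ y in x₀..x, 1 / f y with hΨ
  have hd : ∀ x, HasDerivAt Ψ (1 / f x) x := fun x =>
    (hg.integral_hasStrictDerivAt x₀ x).hasDerivAt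
  have hmono : StrictMono Ψ := strictMono_of_hasDerivAt_pos hd fun x => by
    have := hpos x; positivity
  have hM0 : 0 < M := (hpos 0).trans_le (hM 0)
  have hmono2 : Monotone fun x => Ψ x - x / M :=
    monotone_of_hasDerivAt_nonneg (fun x => (hd x).sub ((hasDerivAt_id x).div_const M)) fun x => by
      have := one_div_le_one_div_of_le (hpos x) (hM x)
      simpa using this
  have hΨ0 : Ψ x₀ = 0 := by simp [hΨ]
  have hsurj : Function.Surjective Ψ := by
    intro t
    have hc : Continuous Ψ := continuous_iff_continuousAt.2 fun x => (hd x).continuousAt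
    have h0 : 0 ≤ M * |t| := by positivity
    have h1 := hmono2 (show x₀ ≤ x₀ + M * |t| by linarith)
    have h2 := hmono2 (show x₀ - M * |t| ≤ x₀ by linarith)
    have e1 : (x₀ + M * |t|) / M = x₀ / M + |t| := by field_simp
    have e2 : (x₀ - M * |t|) / M = x₀ / M - |t| := by field_simp
    simp only [hΨ0, e1, e2] at h1 h2
    obtain ⟨x, -, hx⟩ := intermediate_value_Icc (show x₀ - M * |t| ≤ x₀ + M * |t| by linarith)
      hc.continuousOn (show t ∈ Icc (Ψ (x₀ - M * |t|)) (Ψ (x₀ + M * |t|)) from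
        ⟨by linarith [neg_abs_le t], by linarith [le_abs_self t]⟩)
    exact ⟨x, hx⟩
  set e := hmono.orderIsoOfSurjective Ψ hsurj
  have he : ∀ t, Ψ (e.symm t) = t := fun t => e.apply_symm_apply t
  refine ⟨e.symm, e.symm_apply_eq.2 hΨ0.symm, fun t => ?_⟩
  have := (hd (e.symm t)).of_local_left_inverse (g := e.symm) e.symm.continuous.continuousAt
    (by have := hpos (e.symm t); positivity) (Filter.Eventually.of_forall he)
  simpa using this

theorem flow_integral {f φ g : ℝ → ℝ} (hf : Continuous f) (hpos : ∀ x, 0 < f x)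
    (hφ : ∀ t, HasDerivAt φ (f (φ t)) t) (hg : Continuous g) (t : ℝ) :
    ∫ τ in 0..t, g (φ τ) = ∫ x in φ 0..φ t, g x / f x := by
  have hc : Continuous φ := continuous_iff_continuousAt.2 fun x => (hφ x).continuousAt
  rw [← intervalIntegral.integral_comp_mul_deriv (g := fun x => g x / f x) (fun x _ => hφ x)
    (hf.comp hc).continuousOn (hg.div hf fun x => (hpos x).ne')]
  refine intervalIntegral.integral_congr fun τ _ => ?_
  simp only [Function.comp]
  rw [div_mul_cancel₀ _ (hpos _).ne']

theorem flow_eq {f φ : ℝ → ℝ} (hf : Continuous f) (hpos : ∀ x, 0 < f x)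
    (hφ : ∀ t, HasDerivAt φ (f (φ t)) t) {x t : ℝ} (h : ∫ y in φ 0..x, 1 / f y = t) : φ t = x := by
  have hg : Continuous fun x => 1 / f x := continuous_const.div hf fun x => (hpos x).ne'
  have h1 := flow_integral hf hpos hφ (g := fun _ => 1) continuous_const t
  have hmono : StrictMono fun x => ∫ y in φ 0..x, 1 / f y :=
    strictMono_of_hasDerivAt_pos (fun x => (hg.integral_hasStrictDerivAt _ x).hasDerivAt)
      fun x => by have := hpos x; positivity
  apply hmono.injective
  simp only
  rw [← h1, h]
  simp

/-! ### Trajectories of continuous controls -/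

theorem hasDerivWithinAt_integral {g : ℝ → ℝ} (hg : ContinuousOn g (Icc 0 1)) {t : ℝ}
    (ht : t ∈ Icc (0 : ℝ) 1) :
    HasDerivWithinAt (fun t => ∫ s in 0..t, g s) (g t) (Icc 0 1) t := by
  -- Clamping the argument extends `g` continuously to the line, which covers the endpoints.
  set h : ℝ → ℝ := fun s => g (max 0 (min 1 s)) with hh
  have hc : Continuous h := hg.comp_continuous (by fun_prop) fun s =>
    ⟨le_max_left _ _, max_le zero_le_one (min_le_left _ _)⟩
  have heq : ∀ s ∈ Icc (0 : ℝ) 1, h s = g s := fun s hs => by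
    simp only [hh]; rw [min_eq_right hs.2, max_eq_right hs.1]
  rw [← heq t ht]
  refine (hc.integral_hasStrictDerivAt 0 t).hasDerivAt.hasDerivWithinAt.congr_of_mem ?_ ht
  intro s hs
  refine intervalIntegral.integral_congr fun r hr => (heq r ?_).symm
  exact uIcc_subset_Icc ⟨le_rfl, zero_le_one⟩ hs hr

theorem isControl_of_continuousOn {u : ℝ → ℝ} (hu : ContinuousOn u (Icc 0 1)) : IsControl u :=
  ⟨hu.aemeasurable measurableSet_Icc, isCompact_Icc.exists_bound_of_continuousOn hu⟩

theorem angle_eqOn {u v : ℝ → ℝ} (h : EqOn u v (Icc 0 1)) : EqOn (angle u) (angle v) (Icc 0 1) :=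
  fun _ ht => intervalIntegral.integral_congr fun _ hs =>
    h (uIcc_subset_Icc ⟨le_rfl, zero_le_one⟩ ht hs)

theorem Sx_eqOn {u v : ℝ → ℝ} (h : EqOn u v (Icc 0 1)) : EqOn (Sx u) (Sx v) (Icc 0 1) :=
  fun _ ht => intervalIntegral.integral_congr fun _ hs => by
    simp only [angle_eqOn h (uIcc_subset_Icc ⟨le_rfl, zero_le_one⟩ ht hs)]

theorem eq_of_hasDerivWithinAt_zero {f : ℝ → ℝ}
    (hf : ∀ t ∈ Icc (0 : ℝ) 1, HasDerivWithinAt f 0 (Icc 0 1) t) {s t : ℝ}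
    (hs : s ∈ Icc (0 : ℝ) 1) (ht : t ∈ Icc (0 : ℝ) 1) : f s = f t := by
  have h : ∀ t ∈ Icc (0 : ℝ) 1, f t = f 0 := constant_of_has_deriv_right_zero
    (fun t ht => (hf t ht).continuousWithinAt) fun t ht =>
      (hf t ⟨ht.1, ht.2.le⟩).mono_of_mem_nhdsWithin (Icc_mem_nhdsGE_of_mem ht)
  rw [h s hs, h t ht]

/-! ### The pendulum equation -/

/-- The control `u` solves `θ' = u`, `u' = ε cos 2θ` on `[0, 1]`. -/
def IsPendulum (ε : ℝ) (u : ℝ → ℝ) : Prop :=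
  ∀ t ∈ Icc (0 : ℝ) 1, HasDerivWithinAt u (ε * cos (2 * angle u t)) (Icc 0 1) t

section Pendulum

variable {ε : ℝ} {u v : ℝ → ℝ}

theorem IsPendulum.continuousOn (hu : IsPendulum ε u) : ContinuousOn u (Icc 0 1) :=
  fun t ht => (hu t ht).continuousWithinAt

theorem IsPendulum.isControl (hu : IsPendulum ε u) : IsControl u :=
  isControl_of_continuousOn hu.continuousOn

theorem IsPendulum.hasDerivWithinAt_angle (hu : IsPendulum ε u) {t : ℝ} (ht : t ∈ Icc (0 : ℝ) 1) :
    HasDerivWithinAt (angle u) (u t) (Icc 0 1) t :=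
  hasDerivWithinAt_integral hu.continuousOn ht

theorem angle_zero (u : ℝ → ℝ) : angle u 0 = 0 := by simp [angle]

theorem zero_mem : (0 : ℝ) ∈ Icc (0 : ℝ) 1 := ⟨le_rfl, zero_le_one⟩

theorem one_mem : (1 : ℝ) ∈ Icc (0 : ℝ) 1 := ⟨zero_le_one, le_rfl⟩

theorem IsPendulum.energy (hu : IsPendulum ε u) {t : ℝ} (ht : t ∈ Icc (0 : ℝ) 1) :
    u t ^ 2 = u 0 ^ 2 + ε * sin (2 * angle u t) := by
  have h : ∀ t ∈ Icc (0 : ℝ) 1,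
      HasDerivWithinAt (fun t => u t ^ 2 - ε * sin (2 * angle u t)) 0 (Icc 0 1) t := by
    intro t ht
    have := ((hu t ht).pow 2).sub ((((hu.hasDerivWithinAt_angle ht).const_mul 2).sin).const_mul ε)
    convert! this using 1
    simp; ring
  have := eq_of_hasDerivWithinAt_zero h ht zero_mem
  simp only [angle_zero, mul_zero, sin_zero] at this
  linarith

/-- The vector field of the pendulum equation. -/
noncomputable def pendulumField (ε : ℝ) (p : ℝ × ℝ) : ℝ × ℝ := (p.2, ε * cos (2 * p.1))

theorem lipschitzWith_pendulumField (ε : ℝ) : ∃ K, LipschitzWith K (pendulumField ε) := by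
  have h1 : LipschitzWith (2 * |ε|).toNNReal fun x : ℝ => ε * cos (2 * x) := by
    refine LipschitzWith.of_dist_le_mul fun x y => ?_
    rw [coe_toNNReal _ (by positivity), Real.dist_eq, Real.dist_eq, ← mul_sub, abs_mul]
    have := abs_cos_sub_cos_le (2 * x) (2 * y)
    rw [← mul_sub, abs_mul, abs_two] at this
    nlinarith [abs_nonneg ε]
  exact ⟨_, LipschitzWith.prod_snd.prodMk (h1.comp LipschitzWith.prod_fst)⟩

theorem IsPendulum.hasDerivWithinAt_pair (hu : IsPendulum ε u) {t : ℝ} (ht : t ∈ Icc (0 : ℝ) 1) :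
    HasDerivWithinAt (fun t => (angle u t, u t)) (pendulumField ε (angle u t, u t)) (Icc 0 1) t :=
  (hu.hasDerivWithinAt_angle ht).prodMk (hu t ht)

theorem IsPendulum.eqOn (hu : IsPendulum ε u) (hv : IsPendulum ε v) (h : u 0 = v 0) :
    EqOn u v (Icc 0 1) := by
  obtain ⟨K, hK⟩ := lipschitzWith_pendulumField ε
  have := ODE_solution_unique_of_mem_Icc_right (v := fun _ => pendulumField ε)
    (s := fun _ => univ) (K := K) (a := 0) (b := 1) (f := fun t => (angle u t, u t))
    (g := fun t => (angle v t, v t)) (fun t _ => hK.lipschitzOnWith)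
    (fun t ht => (hu.hasDerivWithinAt_pair ht).continuousWithinAt)
    (fun t ht => (hu.hasDerivWithinAt_pair ⟨ht.1, ht.2.le⟩).mono_of_mem_nhdsWithin
      (Icc_mem_nhdsGE_of_mem ht)) (fun _ _ => mem_univ _)
    (fun t ht => (hv.hasDerivWithinAt_pair ht).continuousWithinAt)
    (fun t ht => (hv.hasDerivWithinAt_pair ⟨ht.1, ht.2.le⟩).mono_of_mem_nhdsWithin
      (Icc_mem_nhdsGE_of_mem ht)) (fun _ _ => mem_univ _)
    (by simp only [angle_zero, h])
  exact fun t ht => congrArg Prod.snd (this ht)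

/-- A nonconstant trajectory does not pass through an equilibrium. -/
theorem IsPendulum.cos_ne_zero (hu : IsPendulum ε u) (h1 : angle u 1 ≠ 0) {t₀ : ℝ}
    (ht₀ : t₀ ∈ Ioo (0 : ℝ) 1) (h0 : u t₀ = 0) : cos (2 * angle u t₀) ≠ 0 := by
  intro hc
  obtain ⟨K, hK⟩ := lipschitzWith_pendulumField ε
  have hd : ∀ t ∈ Ioo (0 : ℝ) 1, HasDerivAt (fun t => (angle u t, u t))
      (pendulumField ε (angle u t, u t)) t := fun t ht =>
    (hu.hasDerivWithinAt_pair ⟨ht.1.le, ht.2.le⟩).hasDerivAt (Icc_mem_nhds ht.1 ht.2)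
  have := ODE_solution_unique_of_mem_Icc (v := fun _ => pendulumField ε)
    (s := fun _ => univ) (K := K) (a := 0) (b := 1) (f := fun t => (angle u t, u t))
    (g := fun _ => (angle u t₀, 0)) (fun t _ => hK.lipschitzOnWith) ht₀
    (fun t ht => (hu.hasDerivWithinAt_pair ht).continuousWithinAt) hd (fun _ _ => mem_univ _)
    continuousOn_const (fun t _ => by
      have : pendulumField ε (angle u t₀, 0) = 0 := by simp [pendulumField, hc]
      rw [this]; exact hasDerivAt_const _ _) (fun _ _ => mem_univ _) (by simp only [h0])
  have e0 := congrArg Prod.fst (this zero_mem)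
  have e1 := congrArg Prod.fst (this one_mem)
  simp only [angle_zero] at e0 e1
  exact h1 (e1.trans e0.symm)

theorem IsPendulum.sub_eq (hu : IsPendulum ε u) : u 1 - u 0 = ε * Sz u 1 := by
  have hc : IntervalIntegrable (fun t => ε * cos (2 * angle u t)) volume 0 1 :=
    (hu.isControl.intervalIntegrable_comp (g := fun x => cos (2 * x)) (by fun_prop)).const_mul ε
  rw [Sz, ← intervalIntegral.integral_const_mul]
  exact (intervalIntegral.integral_eq_sub_of_hasDerivAt_of_le zero_le_one hu.continuousOn
    (fun t ht => (hu t ⟨ht.1.le, ht.2.le⟩).hasDerivAt (Icc_mem_nhds ht.1 ht.2)) hc).symm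

theorem IsPendulum.integral_sq (hu : IsPendulum ε u) :
    ∫ t in 0..1, u t ^ 2 = u 0 ^ 2 + ε * Sx u 1 := by
  have hc := hu.isControl.intervalIntegrable_comp (g := fun x => sin (2 * x)) (by fun_prop)
  have : ∫ t in 0..1, u t ^ 2 = ∫ t in 0..1, (u 0 ^ 2 + ε * sin (2 * angle u t)) := by
    refine intervalIntegral.integral_congr fun t ht => ?_
    rw [uIcc_of_le zero_le_one] at ht
    exact hu.energy ht
  rw [this, intervalIntegral.integral_add (by simp) (hc.const_mul ε),
    intervalIntegral.integral_const_mul, Sx]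
  simp

theorem IsPendulum.cost_eq (hu : IsPendulum ε u) (hz : Sz u 1 = 0) {γ : ℝ}
    (hε : ε = 2 * γ * Sx u 1) : cost γ u = u 0 ^ 2 / 2 + 3 / 4 * ε * Sx u 1 := by
  rw [cost, hu.integral_sq, hz, hε]; ring

theorem IsPendulum.isExtremal {γ : ℝ} (hu : IsPendulum (2 * γ * Sx u 1) u) (hz : γ * Sz u 1 = 0)
    (h1 : angle u 1 = π / 2) : IsExtremal γ u := by
  have hca := hu.isControl.continuousOn_angle
  have dz : ∀ t ∈ Icc (0 : ℝ) 1, HasDerivWithinAt (Sz u) (cos (2 * angle u t)) (Icc 0 1) t :=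
    fun t ht => hasDerivWithinAt_integral (g := fun t => cos (2 * angle u t))
      (continuous_cos.comp_continuousOn (hca.const_mul 2)) ht
  have dx : ∀ t ∈ Icc (0 : ℝ) 1, HasDerivWithinAt (Sx u) (sin (2 * angle u t)) (Icc 0 1) t :=
    fun t ht => hasDerivWithinAt_integral (g := fun t => sin (2 * angle u t))
      (continuous_sin.comp_continuousOn (hca.const_mul 2)) ht
  -- Normal multiplier `μ = -1`: maximization forces `pθ = u`, and transversality fixes the
  -- constants in the other two costates.
  refine ⟨hu.isControl, h1, -1, u, fun t => γ * (Sz u t - Sz u 1), fun t => γ * (Sx u t - Sx u 1),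
    by norm_num, Or.inl (by norm_num), ae_of_all _ fun t v => ?_, fun t ht => ?_, fun t ht => ?_,
    fun t ht => ?_, ⟨u 0 ^ 2 / 2, ?_⟩, by simp, by simp⟩
  · simp only [hamiltonian]
    nlinarith [sq_nonneg (v - u t)]
  · convert! hu t ht using 1
    linear_combination (-2 * sin (2 * angle u t)) * hz
  · convert! ((dz t ht).sub_const (Sz u 1)).const_mul γ using 1
    ring
  · convert! ((dx t ht).sub_const (Sx u 1)).const_mul γ using 1
    ring
  · refine (ae_restrict_iff' measurableSet_Icc).2 (ae_of_all _ fun t ht => ?_)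
    have := hu.energy ht
    simp only [hamiltonian]
    linear_combination this / 2 - cos (2 * angle u t) * hz

end Pendulum

/-! ### Oscillating solutions -/

section Legendre

variable {F : ℝ → ℝ} {m : ℝ}

theorem legendre_neg (F : ℝ → ℝ) (m φ : ℝ) : legendre F m (-φ) = legendre F m φ := by
  simp [legendre, delta]

theorem legendre_periodic (F : ℝ → ℝ) (m : ℝ) : Function.Periodic (legendre F m) π := fun φ => by
  simp [legendre, delta, sin_add_pi]

theorem legendre_pi_sub (F : ℝ → ℝ) (m φ : ℝ) : legendre F m (π - φ) = legendre F m φ := by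
  simp [legendre, delta]

theorem integral_legendre_reflect (F : ℝ → ℝ) (m a b : ℝ) :
    ∫ φ in (π - b)..(π - a), legendre F m φ = ∫ φ in a..b, legendre F m φ := by
  rw [← intervalIntegral.integral_comp_sub_left (legendre F m) π]
  simp only [legendre_pi_sub]

theorem integral_legendre_neg (F : ℝ → ℝ) (m a b : ℝ) :
    ∫ φ in (-b)..(-a), legendre F m φ = ∫ φ in a..b, legendre F m φ := by
  rw [← intervalIntegral.integral_comp_neg (legendre F m)]
  simp only [legendre_neg]

theorem integral_legendre_pi (hF : Continuous F) (hm : m < 1) :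
    ∫ φ in 0..π, legendre F m φ = 2 * ∫ φ in 0..π / 2, legendre F m φ := by
  have hii : ∀ a b, IntervalIntegrable (legendre F m) volume a b :=
    fun a b => (continuous_legendre hF hm).intervalIntegrable a b
  have e := integral_legendre_reflect F m 0 (π / 2)
  rw [sub_zero, show π - π / 2 = π / 2 by ring] at e
  rw [← intervalIntegral.integral_add_adjacent_intervals (hii 0 (π / 2)) (hii _ _), e]
  ring

/-- The Legendre integral over `2 n` half-oscillations and both ends. -/
theorem integral_legendre_oscillations (hF : Continuous F) (hm : m < 1) (α : ℝ) (n : ℕ) :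
    ∫ φ in (-α)..(α + n * (2 * π)), legendre F m φ
      = 2 * (∫ φ in 0..α, legendre F m φ) + 4 * n * ∫ φ in 0..π / 2, legendre F m φ := by
  have hii : ∀ a b, IntervalIntegrable (legendre F m) volume a b :=
    fun a b => (continuous_legendre hF hm).intervalIntegrable a b
  induction n with
  | zero =>
    have e := integral_legendre_neg F m 0 α
    rw [neg_zero] at e
    rw [← intervalIntegral.integral_add_adjacent_intervals (hii (-α) 0) (hii _ _), e]
    simp; ring
  | succ n ih =>
    have e1 := (legendre_periodic F m).intervalIntegral_add_eq (α + n * (2 * π)) 0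
    have e2 := (legendre_periodic F m).intervalIntegral_add_eq (α + n * (2 * π) + π) 0
    rw [zero_add, integral_legendre_pi hF hm] at e1 e2
    rw [show α + n * (2 * π) + π + π = α + ↑(n + 1) * (2 * π) by push_cast; ring] at e2
    rw [← intervalIntegral.integral_add_adjacent_intervals (hii (-α) (α + n * (2 * π))) (hii _ _),
      ← intervalIntegral.integral_add_adjacent_intervals
        (hii (α + n * (2 * π)) (α + n * (2 * π) + π)) (hii _ _), ih, e1, e2]
    push_cast; ring

/-- For small `α` this phase interval passes both turning points `±π/2`. Reflection in `π/2`
expresses each half as a full half-period minus the integral from `0` to `α`. -/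
theorem integral_legendre_turns (hF : Continuous F) (hm : m < 1) (α : ℝ) :
    ∫ φ in (α - π)..(π - α), legendre F m φ
      = 2 * (2 * (∫ φ in 0..π / 2, legendre F m φ) - ∫ φ in 0..α, legendre F m φ) := by
  have hii : ∀ a b, IntervalIntegrable (legendre F m) volume a b :=
    fun a b => (continuous_legendre hF hm).intervalIntegrable a b
  have e1 := integral_legendre_neg F m 0 (π - α)
  have e2 := integral_legendre_reflect F m 0 α
  have e3 := intervalIntegral.integral_add_adjacent_intervals (hii 0 (π - α)) (hii (π - α) π)
  have e4 := intervalIntegral.integral_add_adjacent_intervals (hii (α - π) 0) (hii 0 (π - α))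
  rw [integral_legendre_pi hF hm] at e3
  rw [neg_zero, show -(π - α) = α - π by ring] at e1
  rw [sub_zero] at e2
  linarith

end Legendre

/-- An oscillation with phase `φ`: the trajectory is `sin (θ - π / 4) = √m sin φ`. -/
structure IsOscillation (ε k : ℝ) (φ u : ℝ → ℝ) : Prop where
  hasDerivAt_phase : ∀ t, HasDerivAt φ (√(2 * ε) * delta ((1 + k) / 2) (φ t)) t
  control_eq : ∀ t, u t = √(2 * ε) * (√((1 + k) / 2) * cos (φ t))
  angle_eq : ∀ t, angle u t = π / 4 + arcsin (√((1 + k) / 2) * sin (φ t))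

/-- The phase obeys a first-order equation with positive right-hand side even where `θ` turns back,
so separation of variables suffices. The condition on `φ₀` encodes `θ(0) = 0`. -/
theorem exists_isOscillation {ε k φ₀ : ℝ} (hε : 0 < ε) (hk : k ∈ Ico (0 : ℝ) 1)
    (h0 : √((1 + k) / 2) * sin φ₀ = -(√2 / 2)) :
    ∃ φ u, IsOscillation ε k φ u ∧ φ 0 = φ₀ := by
  have hm0 : 0 ≤ (1 + k) / 2 := by linarith [hk.1]
  have hm : (1 + k) / 2 < 1 := by linarith [hk.2]
  have hε2 : 0 < √(2 * ε) := by positivity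
  obtain ⟨φ, hφ0, hφ⟩ := exists_flow (f := fun x => √(2 * ε) * delta ((1 + k) / 2) x)
    ((continuous_delta _).const_mul _) (fun x => mul_pos hε2 (delta_pos hm x))
    (M := √(2 * ε) * 1) (fun x => by
      refine mul_le_mul_of_nonneg_left ?_ hε2.le
      exact sqrt_le_one.2 (by nlinarith [sq_nonneg (sin x)])) φ₀
  refine ⟨φ, fun t => √(2 * ε) * (√((1 + k) / 2) * cos (φ t)), ⟨hφ, fun _ => rfl, fun t => ?_⟩, hφ0⟩
  have hφc : Continuous φ := continuous_iff_continuousAt.2 fun x => (hφ x).continuousAt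
  have hd : ∀ t, HasDerivAt (fun t => arcsin (√((1 + k) / 2) * sin (φ t)))
      (√(2 * ε) * (√((1 + k) / 2) * cos (φ t))) t := by
    intro t
    have := (hasDerivAt_arcsin_sqrt_mul_sin hm0 (mul_sin_sq_lt_one (φ := φ t) hm)).comp t (hφ t)
    convert! this using 1
    have := (delta_pos hm (φ t)).ne'
    field_simp
  rw [angle, intervalIntegral.integral_eq_sub_of_hasDerivAt (fun t _ => hd t)
    (Continuous.intervalIntegrable (by fun_prop) _ _), hφ0, h0, ← sin_pi_div_four, ← sin_neg,
    arcsin_sin (by linarith [pi_pos]) (by linarith [pi_pos])]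
  ring

section Oscillation

variable {ε k : ℝ} {φ u : ℝ → ℝ}

theorem IsOscillation.sin_two_angle (h : IsOscillation ε k φ u) (hk : k ∈ Ico (0 : ℝ) 1) (t : ℝ) :
    sin (2 * angle u t) = 1 - 2 * ((1 + k) / 2) * sin (φ t) ^ 2 := by
  rw [← sin_turn (by linarith [hk.1]) (by linarith [hk.2]), h.angle_eq, turn, ← sin_pi_sub]
  congr 1; ring

theorem IsOscillation.isPendulum (h : IsOscillation ε k φ u) (hε : 0 < ε)
    (hk : k ∈ Ico (0 : ℝ) 1) : IsPendulum ε u := by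
  intro t _
  have hm0 : 0 ≤ (1 + k) / 2 := by linarith [hk.1]
  have hu : u = fun t => √(2 * ε) * (√((1 + k) / 2) * cos (φ t)) := funext h.control_eq
  have hd := ((((h.hasDerivAt_phase t).cos).const_mul (√((1 + k) / 2))).const_mul (√(2 * ε)))
  have hcos : cos (2 * angle u t)
      = -(2 * (√((1 + k) / 2) * sin (φ t)) * delta ((1 + k) / 2) (φ t)) := by
    have hmem := sqrt_mul_sin_mem (φ := φ t) (show (1 + k) / 2 ≤ 1 by linarith [hk.2])
    rw [h.angle_eq, show 2 * (π / 4 + arcsin (√((1 + k) / 2) * sin (φ t)))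
      = 2 * arcsin (√((1 + k) / 2) * sin (φ t)) + π / 2 by ring, cos_add_pi_div_two, sin_two_mul,
      cos_arcsin, sin_arcsin hmem.1 hmem.2, delta, mul_pow, sq_sqrt hm0]
  rw [hcos]
  refine HasDerivAt.hasDerivWithinAt ?_
  convert! hd using 1
  have := sq_sqrt (show 0 ≤ 2 * ε by positivity)
  linear_combination (sin (φ t) * delta ((1 + k) / 2) (φ t) * √((1 + k) / 2)) * this

theorem IsOscillation.integral_eq (h : IsOscillation ε k φ u) (hε : 0 < ε)
    (hk : k ∈ Ico (0 : ℝ) 1) {F : ℝ → ℝ} (hF : Continuous F) (t : ℝ) :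
    2 * √ε * ∫ τ in 0..t, F (sin (2 * angle u τ))
      = ∫ x in φ 0..φ t, legendre F ((1 + k) / 2) x := by
  have hm : (1 + k) / 2 < 1 := by linarith [hk.2]
  have hε2 : 0 < √(2 * ε) := by positivity
  have := flow_integral (f := fun x => √(2 * ε) * delta ((1 + k) / 2) x)
    ((continuous_delta _).const_mul _) (fun x => mul_pos hε2 (delta_pos hm x)) h.hasDerivAt_phase
    (g := fun x => F (1 - 2 * ((1 + k) / 2) * sin x ^ 2)) (by fun_prop) t
  simp only [h.sin_two_angle hk]
  rw [this, ← intervalIntegral.integral_const_mul]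
  refine intervalIntegral.integral_congr fun x _ => ?_
  have h2 := (delta_pos hm x).ne'
  have h3 : 0 < √ε := by positivity
  simp only [legendre]
  rw [sqrt_mul zero_le_two]
  have h4 : √2 * √2 = 2 := by norm_num
  field_simp
  linear_combination (-F (1 - (1 + k) * sin x ^ 2)) * h4

theorem IsOscillation.phase_eq (h : IsOscillation ε k φ u) (hε : 0 < ε)
    (hk : k ∈ Ico (0 : ℝ) 1) {x : ℝ}
    (hx : ∫ x in φ 0..x, legendre (fun _ => 1) ((1 + k) / 2) x = 2 * √ε) : φ 1 = x := by
  have hm : (1 + k) / 2 < 1 := by linarith [hk.2]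
  have hε2 : 0 < √(2 * ε) := by positivity
  refine flow_eq (f := fun x => √(2 * ε) * delta ((1 + k) / 2) x)
    ((continuous_delta _).const_mul _) (fun x => mul_pos hε2 (delta_pos hm x)) h.hasDerivAt_phase ?_
  have h3 : 0 < √ε := by positivity
  have : ∫ y in φ 0..x, 1 / (√(2 * ε) * delta ((1 + k) / 2) y)
      = 1 / (2 * √ε) * ∫ x in φ 0..x, legendre (fun _ => 1) ((1 + k) / 2) x := by
    rw [← intervalIntegral.integral_const_mul]
    refine intervalIntegral.integral_congr fun x _ => ?_
    have h2 := (delta_pos hm x).ne'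
    simp only [legendre]
    rw [sqrt_mul zero_le_two]
    have h4 : √2 * √2 = 2 := by norm_num
    field_simp
    linear_combination -h4
  rw [this, hx]
  field_simp

theorem IsOscillation.phase_strictMono (h : IsOscillation ε k φ u) (hε : 0 < ε)
    (hk : k ∈ Ico (0 : ℝ) 1) : StrictMono φ :=
  strictMono_of_hasDerivAt_pos h.hasDerivAt_phase fun t =>
    mul_pos (by positivity) (delta_pos (by linarith [hk.2]) _)

theorem sqrt_two_mul_mul (hε : 0 ≤ ε) (x : ℝ) :
    √(2 * ε) * (√((1 + k) / 2) * x) = √ε * (√(1 + k) * x) := by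
  rw [← mul_assoc, ← mul_assoc, ← sqrt_mul (by positivity), ← sqrt_mul hε]
  congr 2; ring

/-- The data of a symmetric solution with half action `L` and half moment `N`. -/
theorem exists_symmetric_oscillation {φ₀ L N : ℝ} (hL : 0 < L) (hk : k ∈ Ico (0 : ℝ) 1)
    (h0 : √((1 + k) / 2) * sin φ₀ = -(√2 / 2))
    (hI : ∫ x in φ₀..(-φ₀), legendre (fun _ => 1) ((1 + k) / 2) x = 2 * L)
    (hJ : ∫ x in φ₀..(-φ₀), legendre (fun s => s) ((1 + k) / 2) x = 2 * N) :
    ∃ u, IsPendulum (L ^ 2) u ∧ u 0 = L * (√(1 + k) * cos φ₀) ∧ Sz u 1 = 0 ∧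
      angle u 1 = π / 2 ∧ Sx u 1 = N / L := by
  have hε : 0 < L ^ 2 := by positivity
  obtain ⟨φ, u, h, hφ0⟩ := exists_isOscillation hε hk h0
  have hφ1 : φ 1 = -φ₀ := h.phase_eq hε hk (by rw [hφ0, hI, sqrt_sq hL.le])
  have hu0 : u 0 = L * (√(1 + k) * cos φ₀) := by
    rw [h.control_eq, sqrt_two_mul_mul hε.le, hφ0, sqrt_sq hL.le]
  have hu1 : u 1 = u 0 := by rw [h.control_eq, h.control_eq, hφ1, hφ0, cos_neg]
  have hp := h.isPendulum hε hk
  refine ⟨u, hp, hu0, ?_, ?_, ?_⟩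
  -- The phase interval is symmetric, so the end velocities agree; integrating `u' = ε cos 2θ` then
  -- gives `S_z(1) = 0`.
  · have := hp.sub_eq
    rw [hu1, sub_self] at this
    exact (mul_eq_zero.1 this.symm).resolve_left hε.ne'
  · rw [h.angle_eq, hφ1, sin_neg, mul_neg, h0, neg_neg, ← sin_pi_div_four,
      arcsin_sin (by linarith [pi_pos]) (by linarith [pi_pos])]
    ring
  · have := h.integral_eq hε hk (F := fun s => s) continuous_id' 1
    rw [hφ0, hφ1, hJ, sqrt_sq hL.le] at this
    rw [Sx, eq_div_iff hL.ne']
    linarith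

end Oscillation

/-- The path with two turning points. -/
theorem exists_turning_path {k : ℝ} (hk : k ∈ Ico (0 : ℝ) 1) :
    ∃ u, IsPendulum (Ione k ^ 2) u ∧ u 0 = -(√k * Ione k) ∧ Sz u 1 = 0 ∧
      angle u 1 = π / 2 ∧ Sx u 1 = Jone k / Ione k := by
  have hm : (1 + k) / 2 < 1 := by linarith [hk.2]
  have hs : sin (ampZero k - π) = -sin (ampZero k) := sin_sub_pi _
  have hc : cos (ampZero k - π) = -cos (ampZero k) := cos_sub_pi _
  -- This starting phase has the same sine as `-ampZero k` but a nonpositive cosine: the motion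
  -- starts backwards (or at rest when `k = 0`).
  have := exists_symmetric_oscillation (φ₀ := ampZero k - π) (L := Ione k) (N := Jone k)
    (Ione_pos hk.1) hk (by rw [hs, mul_neg, sqrt_mul_sin_ampZero hk.1])
    (by rw [neg_sub, integral_legendre_turns continuous_const hm, Ione_eq hk.1 hk.2,
          ellI_eq hk.1 hk.2.le, quarterI])
    (by rw [neg_sub, integral_legendre_turns continuous_id' hm, Jone_eq hk.1 hk.2,
          ellJ_eq hk.1 hk.2.le, quarterJ])
  rw [hc, mul_neg, cos_ampZero hk.1] at this
  convert! this using 5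
  ring

theorem exists_monotone_path_of_one_le {k : ℝ} (hk : 1 ≤ k) :
    ∃ u, IsPendulum (ellI k ^ 2) u ∧ u 0 = √k * ellI k ∧ Sz u 1 = 0 ∧
      angle u 1 = π / 2 ∧ Sx u 1 = ellJ k / ellI k := by
  have hk0 : 0 ≤ k := by linarith
  have hI := ellI_pos hk0
  set L := ellI k with hL
  set f : ℝ → ℝ := fun x => L * √(k + max 0 (sin (2 * x))) with hf
  -- For `k ≥ 1` no arcsine phase is available, and `θ` itself is taken as the flow variable. The
  -- truncation `max 0` keeps the speed positive everywhere, also at `k = 1`, and is inactive on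
  -- `[0, π/2]`.
  have hfc : Continuous f := by fun_prop
  have hfpos : ∀ x, 0 < f x := fun x => mul_pos hI (sqrt_pos.2 (by
    linarith [le_max_left 0 (sin (2 * x))]))
  obtain ⟨φ, hφ0, hφ⟩ := exists_flow hfc hfpos (M := L * √(k + 1)) (fun x =>
    mul_le_mul_of_nonneg_left (sqrt_le_sqrt (by
      have : max 0 (sin (2 * x)) ≤ 1 := max_le zero_le_one (sin_le_one _)
      linarith)) hI.le) 0
  have hφc : Continuous φ := continuous_iff_continuousAt.2 fun x => (hφ x).continuousAt
  have hsin : ∀ x ∈ Icc 0 (π / 2), 0 ≤ sin (2 * x) := fun x hx =>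
    sin_nonneg_of_nonneg_of_le_pi (by linarith [hx.1]) (by linarith [hx.2])
  have hsub : ∀ F : ℝ → ℝ, ∫ x in 0..π / 2, F (sin (2 * x)) / f x
      = 1 / L * ∫ x in 0..π / 2, F (sin x) / √(k + sin x) := by
    intro F
    have e1 : ∫ x in 0..π / 2, F (sin (2 * x)) / f x
        = ∫ x in 0..π / 2, 1 / L * (F (sin (2 * x)) / √(k + sin (2 * x))) := by
      refine intervalIntegral.integral_congr fun x hx => ?_
      rw [uIcc_of_le pi_div_two_mem.1] at hx
      simp only [hf, max_eq_right (hsin x hx)]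
      rw [div_mul_div_comm, one_mul]
    rw [e1, intervalIntegral.integral_const_mul,
      intervalIntegral.integral_comp_mul_left (fun y => F (sin y) / √(k + sin y)) two_ne_zero,
      mul_zero, show 2 * (π / 2) = π by ring, smul_eq_mul]
    congr 1
    have e2 : ∫ y in π / 2..π, F (sin y) / √(k + sin y)
        = ∫ y in 0..π / 2, F (sin y) / √(k + sin y) := by
      have := intervalIntegral.integral_comp_sub_left (a := 0) (b := π / 2)
        (fun y => F (sin y) / √(k + sin y)) π
      simp only [sin_pi_sub, sub_zero, show π - π / 2 = π / 2 by ring] at this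
      exact this.symm
    -- Without integrability both integrals take the default value `0`, so the folding identity
    -- holds for every `F`.
    by_cases hint : IntervalIntegrable (fun y => F (sin y) / √(k + sin y)) volume 0 (π / 2)
    · have hint2 : IntervalIntegrable (fun y => F (sin y) / √(k + sin y)) volume (π / 2) π := by
        have := (hint.comp_sub_left π).symm
        simp only [sin_pi_sub, sub_zero, show π - π / 2 = π / 2 by ring] at this
        exact this
      rw [← intervalIntegral.integral_add_adjacent_intervals hint hint2, e2]
      ring
    · have hint3 : ¬ IntervalIntegrable (fun y => F (sin y) / √(k + sin y)) volume 0 π :=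
        fun h => hint (h.mono_set (uIcc_subset_uIcc left_mem_uIcc (by
          rw [uIcc_of_le pi_pos.le]; constructor <;> linarith [pi_pos])))
      rw [intervalIntegral.integral_undef hint, intervalIntegral.integral_undef hint3, mul_zero]
  have hφ1 : φ 1 = π / 2 := by
    refine flow_eq hfc hfpos hφ ?_
    rw [hφ0]
    have := hsub fun _ => 1
    rw [this]
    exact div_mul_cancel₀ 1 hI.ne' |>.symm ▸ rfl
  have hmono : StrictMono φ := strictMono_of_hasDerivAt_pos hφ fun t => hfpos _
  have hrange : ∀ t ∈ Icc (0 : ℝ) 1, φ t ∈ Icc 0 (π / 2) := fun t ht =>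
    ⟨hφ0 ▸ hmono.monotone ht.1, hφ1 ▸ hmono.monotone ht.2⟩
  set u : ℝ → ℝ := fun t => L * √(k + sin (2 * φ t)) with hu
  have huf : ∀ t ∈ Icc (0 : ℝ) 1, u t = f (φ t) := fun t ht => by
    simp only [hu, hf, max_eq_right (hsin _ (hrange t ht))]
  have hang : ∀ t ∈ Icc (0 : ℝ) 1, angle u t = φ t := by
    intro t ht
    have e : angle u t = ∫ s in 0..t, f (φ s) := intervalIntegral.integral_congr fun s hs =>
      huf s (uIcc_subset_Icc zero_mem ht hs)
    rw [e, intervalIntegral.integral_eq_sub_of_hasDerivAt (fun t _ => hφ t)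
      (Continuous.intervalIntegrable (by fun_prop) _ _), hφ0, sub_zero]
  have hp : IsPendulum (L ^ 2) u := by
    intro t ht
    have hpos : 0 < k + sin (2 * φ t) := by linarith [hsin _ (hrange t ht)]
    have hd := ((((hφ t).const_mul 2).sin.const_add k).sqrt hpos.ne').const_mul L
    refine HasDerivAt.hasDerivWithinAt ?_
    convert! hd using 1
    rw [hang t ht, ← huf t ht]
    have := (sqrt_pos.2 hpos).ne'
    simp only [hu]
    field_simp
  have hu0 : u 0 = √k * L := by simp [hu, hφ0, mul_comm]
  refine ⟨u, hp, hu0, ?_, ?_, ?_⟩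
  · have h1 : u 1 = u 0 := by
      simp only [hu, hφ0, hφ1, show 2 * (π / 2) = π by ring, sin_pi, mul_zero, sin_zero]
    have := hp.sub_eq
    rw [h1, sub_self] at this
    exact (mul_eq_zero.1 this.symm).resolve_left (by positivity)
  · rw [hang 1 one_mem, hφ1]
  · have e : Sx u 1 = ∫ t in 0..1, sin (2 * φ t) := intervalIntegral.integral_congr fun s hs => by
      rw [uIcc_of_le zero_le_one] at hs
      simp only [hang s hs]
    have h1 := flow_integral hfc hfpos hφ (g := fun x => sin (2 * x)) (by fun_prop) 1
    rw [e, h1, hφ0, hφ1, hsub fun s => s, ellJ]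
    ring

/-- The path without turning points. -/
theorem exists_monotone_path {k : ℝ} (hk : 0 ≤ k) :
    ∃ u, IsPendulum (ellI k ^ 2) u ∧ u 0 = √k * ellI k ∧ Sz u 1 = 0 ∧
      angle u 1 = π / 2 ∧ Sx u 1 = ellJ k / ellI k := by
  rcases lt_or_ge k 1 with h1 | h1
  · have hm : (1 + k) / 2 < 1 := by linarith
    have hosc := fun {F : ℝ → ℝ} (hF : Continuous F) =>
      integral_legendre_oscillations hF hm (ampZero k) 0
    simp only [CharP.cast_eq_zero, zero_mul, add_zero, mul_zero] at hosc
    have := exists_symmetric_oscillation (φ₀ := -ampZero k) (L := ellI k) (N := ellJ k)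
      (ellI_pos hk) ⟨hk, h1⟩ (by rw [sin_neg, mul_neg, sqrt_mul_sin_ampZero hk])
      (by rw [neg_neg, hosc continuous_const, ellI_eq hk h1.le])
      (by rw [neg_neg, hosc continuous_id', ellJ_eq hk h1.le])
    rw [cos_neg, cos_ampZero hk, mul_comm] at this
    exact this
  · exact exists_monotone_path_of_one_le h1

/-- An extremal with continuous control solves the pendulum equation. -/
theorem IsExtremal.pendulum {γ : ℝ} {u : ℝ → ℝ} (h : IsExtremal γ u)
    (hc : ContinuousOn u (Icc 0 1)) :
    IsPendulum (2 * γ * Sx u 1) u ∧ γ * Sz u 1 = 0 := by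
  obtain ⟨hu, h1, μ, pθ, pz, px, hμ, hne, hmax, hpθ, hpz, hpx, -, hz1, hx1⟩ := h
  have hca := hu.continuousOn_angle
  have da : ∀ t ∈ Icc (0 : ℝ) 1, HasDerivWithinAt (angle u) (u t) (Icc 0 1) t :=
    fun t ht => hasDerivWithinAt_integral hc ht
  have dz : ∀ t ∈ Icc (0 : ℝ) 1, HasDerivWithinAt (Sz u) (cos (2 * angle u t)) (Icc 0 1) t :=
    fun t ht => hasDerivWithinAt_integral (g := fun t => cos (2 * angle u t))
      (continuous_cos.comp_continuousOn (hca.const_mul 2)) ht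
  have dx : ∀ t ∈ Icc (0 : ℝ) 1, HasDerivWithinAt (Sx u) (sin (2 * angle u t)) (Icc 0 1) t :=
    fun t ht => hasDerivWithinAt_integral (g := fun t => sin (2 * angle u t))
      (continuous_sin.comp_continuousOn (hca.const_mul 2)) ht
  have ez : ∀ t ∈ Icc (0 : ℝ) 1, pz t + μ * γ * Sz u t = μ * γ * Sz u 1 := by
    intro t ht
    have := eq_of_hasDerivWithinAt_zero (f := fun t => pz t + μ * γ * Sz u t) (fun t ht => by
      convert! (hpz t ht).add ((dz t ht).const_mul (μ * γ)) using 1; ring) ht one_mem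
    simpa [hz1] using this
  have ex : ∀ t ∈ Icc (0 : ℝ) 1, px t + μ * γ * Sx u t = μ * γ * Sx u 1 := by
    intro t ht
    have := eq_of_hasDerivWithinAt_zero (f := fun t => px t + μ * γ * Sx u t) (fun t ht => by
      convert! (hpx t ht).add ((dx t ht).const_mul (μ * γ)) using 1; ring) ht one_mem
    simpa [hx1] using this
  -- For `μ < 0` the test value is the vertex `-pθ/μ` of the concave parabola; for `μ = 0` the value
  -- `u + pθ` forces `pθ = 0`.
  have hae : pθ =ᵐ[volume.restrict (Icc 0 1)] fun t => -μ * u t := by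
    filter_upwards [hmax] with t ht
    rcases hμ.lt_or_eq with hμ | hμ
    · have hμ' := hμ.ne
      have := ht (u t - (pθ t + μ * u t) / μ)
      simp only [hamiltonian] at this
      have e : pθ t * (u t - (pθ t + μ * u t) / μ) + μ * (1 / 2 * (u t - (pθ t + μ * u t) / μ) ^ 2)
          = pθ t * u t + μ * (1 / 2 * u t ^ 2) - (pθ t + μ * u t) ^ 2 / (2 * μ) := by
        field_simp; ring
      have h2 : 0 ≤ (pθ t + μ * u t) ^ 2 / (2 * μ) := by linarith
      have h3 : (pθ t + μ * u t) ^ 2 ≤ 0 := by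
        by_contra hcon
        have := div_neg_of_pos_of_neg (not_le.1 hcon) (show 2 * μ < 0 by linarith)
        linarith
      have := pow_eq_zero_iff two_ne_zero |>.1 (le_antisymm h3 (sq_nonneg _))
      linarith
    · subst hμ
      have := ht (u t + pθ t)
      simp only [hamiltonian] at this
      have h3 : pθ t ^ 2 ≤ 0 := by linarith
      simpa using h3
  have heq : EqOn pθ (fun t => -μ * u t) (Icc 0 1) :=
    Measure.eqOn_Icc_of_ae_eq volume zero_ne_one hae (fun t ht => (hpθ t ht).continuousWithinAt)
      (hc.const_mul (-μ))
  -- In the abnormal case all three costates vanish: `pz` and `px` would be constant, hence zero by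
  -- transversality.
  have hμ0 : μ ≠ 0 := by
    rintro rfl
    rcases hne with h | ⟨t, ht, h⟩
    · exact h rfl
    · have e1 := heq ht
      have e2 := ez t ht
      have e3 := ex t ht
      simp only [zero_mul, add_zero, neg_zero] at e1 e2 e3
      simp [e1, e2, e3] at h
  have hd : ∀ t ∈ Icc (0 : ℝ) 1, HasDerivWithinAt u (2 * γ * Sx u 1 * cos (2 * angle u t)
      - 2 * γ * Sz u 1 * sin (2 * angle u t)) (Icc 0 1) t := by
    intro t ht
    have := ((hpθ t ht).const_mul (-μ⁻¹)).congr_of_mem (f₁ := u) (fun s hs => by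
      rw [heq hs]; field_simp) ht
    convert! this using 1
    rw [ez t ht, ex t ht]
    field_simp
    ring
  have hen := eq_of_hasDerivWithinAt_zero
    (f := fun t => u t ^ 2 - 2 * γ * Sx u 1 * sin (2 * angle u t)
      - 2 * γ * Sz u 1 * cos (2 * angle u t)) (fun t ht => by
      have := (((hd t ht).pow 2).sub ((((da t ht).const_mul 2).sin).const_mul
        (2 * γ * Sx u 1))).sub ((((da t ht).const_mul 2).cos).const_mul (2 * γ * Sz u 1))
      convert! this using 1
      simp; ring) zero_mem one_mem
  have hs := (hu.intervalIntegrable_comp (g := fun x => sin (2 * x)) (by fun_prop)).const_mul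
    (2 * γ * Sz u 1)
  have hcs := (hu.intervalIntegrable_comp (g := fun x => cos (2 * x)) (by fun_prop)).const_mul
    (2 * γ * Sx u 1)
  have hsub : u 1 - u 0 = 0 := by
    rw [← intervalIntegral.integral_eq_sub_of_hasDerivAt_of_le zero_le_one hc
      (fun t ht => (hd t ⟨ht.1.le, ht.2.le⟩).hasDerivAt (Icc_mem_nhds ht.1 ht.2)) (hcs.sub hs),
      intervalIntegral.integral_sub hcs hs, intervalIntegral.integral_const_mul,
      intervalIntegral.integral_const_mul]
    change 2 * γ * Sx u 1 * Sz u 1 - 2 * γ * Sz u 1 * Sx u 1 = 0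
    ring
  -- The energy contains `-2γ S_z cos 2θ`, whose cosine goes from `1` to `-1`, while `u²` and `sin
  -- 2θ` have equal end values.
  have hzero : γ * Sz u 1 = 0 := by
    simp only [angle_zero, h1, mul_zero, sin_zero, cos_zero, show 2 * (π / 2) = π by ring, sin_pi,
      cos_pi] at hen
    rw [sub_eq_zero] at hsub
    rw [hsub] at hen
    linarith
  refine ⟨fun t ht => ?_, hzero⟩
  convert! hd t ht using 1
  linear_combination (2 * sin (2 * angle u t)) * hzero

/-! ### Counting switches through the phase -/

theorem IsSwitch.eq_zero {u : ℝ → ℝ} (hc : ContinuousOn u (Icc 0 1)) {t : ℝ} (h : IsSwitch u t) :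
    u t = 0 := by
  obtain ⟨ht, e, he, h⟩ := h
  have hct : ContinuousAt u t := hc.continuousAt (Icc_mem_nhds ht.1 ht.2)
  have hl := hct.tendsto.mono_left (nhdsWithin_le_nhds (s := Iio t))
  have hr := hct.tendsto.mono_left (nhdsWithin_le_nhds (s := Ioi t))
  have ml : Ioo (t - e) t ∈ nhdsWithin t (Iio t) := Ioo_mem_nhdsLT (by linarith)
  have mr : Ioo t (t + e) ∈ nhdsWithin t (Ioi t) := Ioo_mem_nhdsGT (by linarith)
  rcases h with ⟨h1, h2⟩ | ⟨h1, h2⟩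
  · exact le_antisymm
      (le_of_tendsto hl (Filter.mem_of_superset ml fun s hs => (h1 s hs).le))
      (ge_of_tendsto hr (Filter.mem_of_superset mr fun s hs => (h2 s hs).le))
  · exact le_antisymm
      (le_of_tendsto hr (Filter.mem_of_superset mr fun s hs => (h2 s hs).le))
      (ge_of_tendsto hl (Filter.mem_of_superset ml fun s hs => (h1 s hs).le))

theorem IsSwitch.congr {u v : ℝ → ℝ} (h : EqOn u v (Icc 0 1)) {t : ℝ} (hu : IsSwitch u t) :
    IsSwitch v t := by
  obtain ⟨ht, e, he, hs⟩ := hu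
  have hl : ∀ s ∈ Ioo (t - min e (min t (1 - t))) t, s ∈ Ioo (t - e) t ∧ u s = v s := by
    intro s hs
    have h1 := min_le_left e (min t (1 - t))
    have h2 := (min_le_right e (min t (1 - t))).trans (min_le_left _ _)
    exact ⟨⟨by linarith [hs.1], hs.2⟩, h ⟨by linarith [hs.1], by linarith [hs.2, ht.2]⟩⟩
  have hr : ∀ s ∈ Ioo t (t + min e (min t (1 - t))), s ∈ Ioo t (t + e) ∧ u s = v s := by
    intro s hs
    have h1 := min_le_left e (min t (1 - t))
    have h2 := (min_le_right e (min t (1 - t))).trans (min_le_right _ _)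
    exact ⟨⟨hs.1, by linarith [hs.2]⟩, h ⟨by linarith [hs.1, ht.1], by linarith [hs.2]⟩⟩
  refine ⟨ht, min e (min t (1 - t)), lt_min he (lt_min ht.1 (by linarith [ht.2])), ?_⟩
  exact hs.imp
    (fun h => ⟨fun s hs => (hl s hs).2 ▸ h.1 s (hl s hs).1, fun s hs => (hr s hs).2 ▸ h.2 s (hr s hs).1⟩)
    (fun h => ⟨fun s hs => (hl s hs).2 ▸ h.1 s (hl s hs).1, fun s hs => (hr s hs).2 ▸ h.2 s (hr s hs).1⟩)

section Switches

variable {ε k : ℝ} {φ u : ℝ → ℝ}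

theorem IsOscillation.isSwitch_iff (h : IsOscillation ε k φ u) (hε : 0 < ε)
    (hk : k ∈ Ico (0 : ℝ) 1) {t : ℝ} :
    IsSwitch u t ↔ t ∈ Ioo (0 : ℝ) 1 ∧ cos (φ t) = 0 := by
  have hA : 0 < √(2 * ε) * √((1 + k) / 2) :=
    mul_pos (by positivity) (sqrt_pos.2 (by linarith [hk.1]))
  have hu : ∀ s, u s = √(2 * ε) * √((1 + k) / 2) * cos (φ s) := fun s => by
    rw [h.control_eq]; ring
  have hφc : Continuous φ := continuous_iff_continuousAt.2 fun x => (h.hasDerivAt_phase x).continuousAt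
  have hmono := h.phase_strictMono hε hk
  constructor
  · intro hs
    refine ⟨hs.1, ?_⟩
    have := hs.eq_zero (h.isPendulum hε hk).continuousOn
    rw [hu] at this
    exact (mul_eq_zero.1 this).resolve_left hA.ne'
  · rintro ⟨ht, hc⟩
    -- Within phase distance `π`, `cos φ(s) = -sin φ(t) sin(φ(s) - φ(t))` has a definite sign on
    -- each side of `t`, because `φ` increases strictly.
    obtain ⟨e, he, hball⟩ := Metric.continuousAt_iff.1 (hφc.continuousAt (x := t)) π pi_pos
    have hcos : ∀ s, cos (φ s) = -(sin (φ t) * sin (φ s - φ t)) := fun s => by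
      have := cos_add (φ t) (φ s - φ t)
      rw [add_sub_cancel, hc] at this
      rw [this]; ring
    have hl : ∀ s ∈ Ioo (t - e) t, sin (φ s - φ t) < 0 := by
      intro s hs
      have h1 := hball (x := s) (by rw [Real.dist_eq, abs_lt]; constructor <;> linarith [hs.1, hs.2])
      rw [Real.dist_eq, abs_lt] at h1
      exact sin_neg_of_neg_of_neg_pi_lt (sub_neg.2 (hmono hs.2)) h1.1
    have hr : ∀ s ∈ Ioo t (t + e), 0 < sin (φ s - φ t) := by
      intro s hs
      have h1 := hball (x := s) (by rw [Real.dist_eq, abs_lt]; constructor <;> linarith [hs.1, hs.2])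
      rw [Real.dist_eq, abs_lt] at h1
      exact sin_pos_of_pos_of_lt_pi (sub_pos.2 (hmono hs.1)) h1.2
    have hsq : sin (φ t) = 1 ∨ sin (φ t) = -1 := by
      have := sin_sq_add_cos_sq (φ t)
      rw [hc] at this
      have h2 : (sin (φ t) - 1) * (sin (φ t) + 1) = 0 := by linarith
      exact (mul_eq_zero.1 h2).imp sub_eq_zero.1 eq_neg_of_add_eq_zero_left
    refine ⟨ht, e, he, ?_⟩
    rcases hsq with h1 | h1
    · right
      refine ⟨fun s hs => ?_, fun s hs => ?_⟩
      · rw [hu, hcos, h1]; exact mul_pos hA (by linarith [hl s hs])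
      · rw [hu, hcos, h1]; exact mul_neg_of_pos_of_neg hA (by linarith [hr s hs])
    · left
      refine ⟨fun s hs => ?_, fun s hs => ?_⟩
      · rw [hu, hcos, h1]; exact mul_neg_of_pos_of_neg hA (by linarith [hl s hs])
      · rw [hu, hcos, h1]; exact mul_pos hA (by linarith [hr s hs])

/-- The value `α = π/2`, which occurs for `k = 0`, is allowed: the open interval excludes the zeros
`-π/2` and `π/2 + 2πn`. -/
theorem zeros_cos_Ioo {α : ℝ} (hα : α ∈ Ioc 0 (π / 2)) (n : ℕ) :
    {x | x ∈ Ioo (-α) (α + n * (2 * π)) ∧ cos x = 0}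
      = (fun j : ℕ => π / 2 + j * π) '' (Finset.range (2 * n)) := by
  ext x
  simp only [mem_ofPred_eq, mem_image, Finset.coe_range, mem_Iio]
  have hp := pi_pos
  constructor
  · rintro ⟨hx, hc⟩
    obtain ⟨j, hj⟩ := cos_eq_zero_iff.1 hc
    have h1 : (-1 : ℝ) < j := by
      have := hx.1
      rw [hj] at this
      by_contra hcon
      nlinarith [hα.2]
    have h2 : (j : ℝ) < 2 * n := by
      have := hx.2
      rw [hj] at this
      by_contra hcon
      nlinarith [hα.2]
    have h1' : 0 ≤ j := by
      have : (-1 : ℤ) < j := by exact_mod_cast h1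
      omega
    have h2' : j < 2 * n := by exact_mod_cast h2
    refine ⟨j.toNat, by omega, ?_⟩
    have : ((j.toNat : ℕ) : ℝ) = j := by exact_mod_cast Int.toNat_of_nonneg h1'
    rw [this, hj]; ring
  · rintro ⟨j, hj, rfl⟩
    have h1 : (j : ℝ) + 1 ≤ 2 * n := by exact_mod_cast hj
    have h0 : (0 : ℝ) ≤ j := Nat.cast_nonneg j
    refine ⟨⟨by nlinarith [hα.1], ?_⟩, ?_⟩
    · nlinarith [hα.1]
    · rw [cos_eq_zero_iff]; exact ⟨j, by push_cast; ring⟩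

theorem IsOscillation.encard_switch (h : IsOscillation ε k φ u) (hε : 0 < ε)
    (hk : k ∈ Ico (0 : ℝ) 1) {α : ℝ} (hα : α ∈ Ioc 0 (π / 2)) {n : ℕ} (h0 : φ 0 = -α)
    (h1 : φ 1 = α + n * (2 * π)) : {t | IsSwitch u t}.encard = (2 * n : ℕ) := by
  have hmono := h.phase_strictMono hε hk
  have hφc : Continuous φ := continuous_iff_continuousAt.2 fun x => (h.hasDerivAt_phase x).continuousAt
  have himg : φ '' {t | IsSwitch u t} = {x | x ∈ Ioo (-α) (α + n * (2 * π)) ∧ cos x = 0} := by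
    ext x
    simp only [mem_image, mem_ofPred_eq, h.isSwitch_iff hε hk]
    constructor
    · rintro ⟨t, ⟨ht, hc⟩, rfl⟩
      exact ⟨⟨h0 ▸ hmono ht.1, h1 ▸ hmono ht.2⟩, hc⟩
    · rintro ⟨hx, hc⟩
      rw [← h0, ← h1] at hx
      obtain ⟨t, ht, rfl⟩ := intermediate_value_Ioo zero_le_one hφc.continuousOn hx
      exact ⟨t, ⟨ht, hc⟩, rfl⟩
  rw [← hmono.injective.encard_image, himg, zeros_cos_Ioo hα, Function.Injective.encard_image,
    Set.encard_coe_eq_coe_finsetCard, Finset.card_range]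
  intro i j hij
  have : (i : ℝ) * π = j * π := by simpa using hij
  exact_mod_cast mul_right_cancel₀ pi_pos.ne' this

end Switches

/-- The parameters of a pendulum trajectory with a switch. -/
theorem IsPendulum.param_of_zero {ε : ℝ} {u : ℝ → ℝ} (hu : IsPendulum ε u)
    (h1 : angle u 1 = π / 2) {t₀ : ℝ} (ht₀ : t₀ ∈ Ioo (0 : ℝ) 1) (h0 : u t₀ = 0) :
    0 ≤ ε ∧ u 0 ^ 2 ≤ ε ∧ u 0 ^ 2 ≠ ε := by
  have hne := hu.cos_ne_zero (by rw [h1]; positivity) ht₀ h0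
  have hen := hu.energy (Ioo_subset_Icc_self ht₀)
  rw [h0] at hen
  have hsc := sin_sq_add_cos_sq (2 * angle u t₀)
  have hcpos : 0 < cos (2 * angle u t₀) ^ 2 := by positivity
  have hs1 : sin (2 * angle u t₀) < 1 := by
    by_contra hcon
    nlinarith [sin_le_one (2 * angle u t₀)]
  have hs2 : -1 < sin (2 * angle u t₀) := by
    by_contra hcon
    nlinarith [neg_one_le_sin (2 * angle u t₀)]
  -- At a time with `θ = π/4` the energy gives `u² = ε(1 - sin 2θ(t₀))`, which would be negative.
  have hε : 0 ≤ ε := by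
    by_contra hcon
    obtain ⟨t, ht, htq⟩ := intermediate_value_Icc zero_le_one hu.isControl.continuousOn_angle
      (show π / 4 ∈ Icc (angle u 0) (angle u 1) by
        rw [h1, angle_zero]; constructor <;> linarith [pi_pos])
    have h2 := hu.energy ht
    rw [htq, show 2 * (π / 4) = π / 2 by ring, sin_pi_div_two] at h2
    nlinarith [sq_nonneg (u t)]
  refine ⟨hε, by nlinarith, fun heq => ?_⟩
  rw [heq] at hen
  have h3 : ε * (1 + sin (2 * angle u t₀)) = 0 := by linarith
  have h4 : ε = 0 := (mul_eq_zero.1 h3).resolve_right (by linarith)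
  have hu0 : u 0 = 0 := by rw [h4] at heq; simpa using heq
  have hz : EqOn u (fun _ => 0) (Icc 0 1) := fun t ht => by
    have := hu.energy ht
    rw [hu0, h4] at this
    simpa using this
  have := angle_eqOn hz one_mem
  rw [h1] at this
  simp [angle] at this

/-- Trajectories with `u(0) ≥ 0` and a switch are oscillations with an even number of switches. -/
theorem IsPendulum.structure {ε : ℝ} {u : ℝ → ℝ} (hu : IsPendulum ε u) (h1 : angle u 1 = π / 2)
    (h01 : u 1 = u 0) (hu0 : 0 ≤ u 0) {t₀ : ℝ} (ht₀ : t₀ ∈ Ioo (0 : ℝ) 1) (h0 : u t₀ = 0) :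
    0 < ε ∧ u 0 ^ 2 / ε ∈ Ico (0 : ℝ) 1 ∧ ∃ n : ℕ, {t | IsSwitch u t}.encard = (2 * n : ℕ) ∧
      Iplus n (u 0 ^ 2 / ε) = √ε ∧ Jplus n (u 0 ^ 2 / ε) = √ε * Sx u 1 := by
  obtain ⟨hε, hle, hne⟩ := hu.param_of_zero h1 ht₀ h0
  have hε : 0 < ε := (sq_nonneg (u 0)).trans_lt (lt_of_le_of_ne hle hne)
  set k := u 0 ^ 2 / ε with hk
  have hkm : k ∈ Ico (0 : ℝ) 1 := ⟨by positivity, by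
    rw [hk, div_lt_one hε]; exact lt_of_le_of_ne hle hne⟩
  have hm : (1 + k) / 2 < 1 := by linarith [hkm.2]
  have hα := ampZero_mem hkm.1
  have hA : 0 < √ε * √(1 + k) := mul_pos (by positivity) (sqrt_pos.2 (by linarith [hkm.1]))
  -- Comparison oscillation with the same initial data: this phase is the branch with `u(0) ≥ 0`.
  -- Uniqueness for the pendulum equation identifies it with `u`.
  obtain ⟨φ, v, h, hφ0⟩ := exists_isOscillation (φ₀ := -ampZero k) hε hkm
    (by rw [sin_neg, mul_neg, sqrt_mul_sin_ampZero hkm.1])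
  have hv : ∀ t, v t = √ε * √(1 + k) * cos (φ t) := fun t => by
    rw [h.control_eq, sqrt_two_mul_mul hε.le, mul_assoc]
  have hv0 : u 0 = √ε * √(1 + k) * cos (ampZero k) := by
    rw [mul_assoc, cos_ampZero hkm.1, ← sqrt_mul hε.le, hk, mul_div_cancel₀ _ hε.ne', sqrt_sq hu0]
  have heq : EqOn u v (Icc 0 1) := hu.eqOn (h.isPendulum hε hkm) (by
    rw [hv0, hv, hφ0, cos_neg])
  have hcos : cos (φ 1) = cos (ampZero k) := by
    have := heq one_mem
    rw [h01, hv0, hv] at this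
    exact (mul_left_cancel₀ hA.ne' this).symm
  have hsin : sin (φ 1) = sin (ampZero k) := by
    have ha := angle_eqOn heq one_mem
    rw [h1, h.angle_eq] at ha
    have hmem := sqrt_mul_sin_mem (φ := φ 1) hm.le
    have hb : arcsin (√((1 + k) / 2) * sin (φ 1)) = π / 4 := by linarith
    have hc := congrArg sin hb
    rw [sin_arcsin hmem.1 hmem.2, sin_pi_div_four, ← sqrt_mul_sin_ampZero hkm.1] at hc
    exact mul_left_cancel₀ (sqrt_pos.2 (by linarith [hkm.1])).ne' hc
  -- `u(1) = u(0)` fixes the cosine of the final phase and `θ(1) = π/2` its sine, so it is `ampZero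
  -- k + 2πn`; the increase of the phase gives `n ≥ 0`.
  obtain ⟨n, hn⟩ := Real.Angle.angle_eq_iff_two_pi_dvd_sub.1 (Real.Angle.cos_sin_inj hcos hsin)
  have hmono := h.phase_strictMono hε hkm
  have hn0 : 0 ≤ n := by
    have h2 := hmono zero_lt_one
    rw [hφ0] at h2
    have h3 : (-1 : ℝ) < n := by
      by_contra hcon
      nlinarith [hα.2, pi_pos]
    have : (-1 : ℤ) < n := by exact_mod_cast h3
    omega
  lift n to ℕ using hn0
  have hφ1 : φ 1 = ampZero k + n * (2 * π) := by
    push_cast at hn; linarith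
  have hosc := fun {F : ℝ → ℝ} (hF : Continuous F) =>
    h.integral_eq hε hkm hF 1
  simp only [hφ0, hφ1] at hosc
  have hI := hosc (F := fun _ => 1) continuous_const
  have hJ := hosc (F := fun s => s) continuous_id'
  rw [integral_legendre_oscillations continuous_const hm, ← ellI_eq hkm.1 hkm.2.le] at hI
  rw [integral_legendre_oscillations continuous_id' hm, ← ellJ_eq hkm.1 hkm.2.le] at hJ
  change _ = 2 * ellI k + 4 * n * quarterI k at hI
  change 2 * √ε * Sx v 1 = 2 * ellJ k + 4 * n * quarterJ k at hJ
  rw [← ellA_add_ellI hkm.1 hkm.2] at hI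
  rw [← ellB_add_ellJ hkm.1 hkm.2, ← Sx_eqOn heq one_mem] at hJ
  simp only [intervalIntegral.integral_const, sub_zero, one_smul, mul_one] at hI
  refine ⟨hε, hkm, n, ?_, ?_, ?_⟩
  · rw [← h.encard_switch hε hkm hα hφ0 hφ1]
    congr 1
    ext t
    exact ⟨fun ht => ht.congr heq, fun ht => ht.congr heq.symm⟩
  · rw [Iplus]; linarith
  · rw [Jplus]; linarith

/-! ### The cost of extremals with switches -/

/-- Cauchy–Schwarz for `(k + sin x)^(-1/4)` and `(k + sin x)^(1/4)`, obtained from the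
arithmetic-geometric inequality with the optimal weight `l = (π/2) / zeroAction k`. -/
theorem pi_div_two_sq_le {k : ℝ} (h0 : 0 ≤ k) : (π / 2) ^ 2 ≤ ellI k * zeroAction k := by
  have hZ : 0 < zeroAction k := by
    rw [zeroAction_eq h0]; linarith [mul_nonneg h0 (ellI_pos h0).le, ellJ_pos h0]
  have key : ∀ l : ℝ, 2 * l * (π / 2) ≤ ellI k + l ^ 2 * zeroAction k := by
    intro l
    have e : ∫ _x in 0..π / 2, 2 * l = 2 * l * (π / 2) := by simp; ring
    have hi := intervalIntegrable_ellI h0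
    have hc := ((continuous_sqrt_add_sin k).intervalIntegrable (μ := volume) 0 (π / 2)).const_mul
      (l ^ 2)
    rw [← e, ellI, zeroAction, ← intervalIntegral.integral_const_mul,
      ← intervalIntegral.integral_add hi hc]
    refine intervalIntegral.integral_mono_on_of_le_Ioo pi_div_two_mem.1 (by simp) (hi.add hc)
      fun x hx => ?_
    have hs : 0 < sin x := sin_pos_of_pos_of_lt_pi hx.1 (by linarith [hx.2, pi_pos])
    have hp : 0 < √(k + sin x) := sqrt_pos.2 (by positivity)
    have e2 : 1 / √(k + sin x) + l ^ 2 * √(k + sin x) - 2 * l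
        = (1 - l * √(k + sin x)) ^ 2 / √(k + sin x) := by field_simp; ring
    have : 0 ≤ (1 - l * √(k + sin x)) ^ 2 / √(k + sin x) := by positivity
    linarith
  have h2 := key (π / 2 / zeroAction k)
  have h3 := mul_le_mul_of_nonneg_right h2 hZ.le
  have e1 : 2 * (π / 2 / zeroAction k) * (π / 2) * zeroAction k = 2 * (π / 2) ^ 2 := by field_simp
  have e2 : (ellI k + (π / 2 / zeroAction k) ^ 2 * zeroAction k) * zeroAction k
      = ellI k * zeroAction k + (π / 2) ^ 2 := by field_simp
  rw [e1, e2] at h3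
  linarith

/-- Here `k I₊ₘ + J₊ₘ = 2m quarterAction + zeroAction ≥ (2m + 1) zeroAction` and `I₊ₘ ≥ (2m + 1) I`.
Dropping `I₊ₘ J₊ₘ / 4`, the cost is at least `(2m + 1)² π²/8`, and `π ≥ 8/3`. -/
theorem Cplus_ge {k : ℝ} (hk : k ∈ Ico (0 : ℝ) 1) (m : ℕ) (hJ : 0 ≤ Jplus m k) :
    (2 * (m : ℝ) + 1) ^ 2 * π / 3 ≤ Cplus m k := by
  have hm : (0 : ℝ) ≤ m := Nat.cast_nonneg m
  have hA := ellA_nonneg hk.1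
  have hI := ellI_pos hk.1
  have hq := quarterAction_eq hk.1 hk.2
  have hz := zeroAction_eq hk.1
  rw [← ellA_add_ellI hk.1 hk.2, ← ellB_add_ellJ hk.1 hk.2] at hq
  have hzq : zeroAction k ≤ quarterAction k :=
    intervalIntegral.integral_mono_interval (by linarith [arcsin_nonneg.2 hk.1]) (by positivity)
      le_rfl (ae_of_all _ fun x => sqrt_nonneg _)
      ((continuous_sqrt_add_sin k).intervalIntegrable _ _)
  have hG : (2 * (m : ℝ) + 1) * zeroAction k ≤ k * Iplus m k + Jplus m k := by
    have := mul_nonneg hm (sub_nonneg.2 hzq)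
    rw [Iplus, Jplus]
    rw [hq, hz] at this
    rw [hz]
    linarith
  have hI' : (2 * (m : ℝ) + 1) * ellI k ≤ Iplus m k := by
    rw [Iplus]; linarith [mul_nonneg hm hA]
  have hZ : 0 ≤ zeroAction k := by
    rw [hz]; linarith [mul_nonneg hk.1 hI.le, ellJ_pos hk.1]
  have hIp : 0 ≤ Iplus m k := (by positivity : 0 ≤ (2 * (m : ℝ) + 1) * ellI k).trans hI'
  have h1 := mul_le_mul hI' hG (by positivity) hIp
  have h2 := mul_le_mul_of_nonneg_left (pi_div_two_sq_le hk.1) (sq_nonneg (2 * (m : ℝ) + 1))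
  have h3 := mul_nonneg hIp hJ
  have h4 : π / 3 ≤ (π / 2) ^ 2 / 2 := by nlinarith [pi_gt_three]
  have h5 := mul_le_mul_of_nonneg_left h4 (sq_nonneg (2 * (m : ℝ) + 1))
  rw [Cplus]
  linarith

/-- Extremals with `u(0) ≥ 0` and `2 m` switches. -/
theorem IsExtremal.of_switches {γ : ℝ} (hγ : 0 ≤ γ) {u : ℝ → ℝ} (hu : IsExtremal γ u)
    (hc : ContinuousOn u (Icc 0 1)) (hu0 : 0 ≤ u 0) {m : ℕ} (hm : 1 ≤ m)
    (hs : {t : ℝ | IsSwitch u t}.encard = 2 * m) :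
    ∃ k : ℝ, 0 < γ ∧ 0 < Sx u 1 ∧ k = u 0 ^ 2 / (2 * γ * Sx u 1) ∧ 0 ≤ k ∧ k < 1 ∧
      Iplus m k = √(2 * γ * Sx u 1) ∧ 2 * γ = Iplus m k ^ 3 / Jplus m k ∧
      cost γ u = Cplus m k ∧ Cplus m k ≥ (2 * (m : ℝ) + 1) ^ 2 * π / 3 ∧
      (2 * (m : ℝ) + 1) ^ 2 * π / 3 ≥ 3 * π := by
  obtain ⟨hp, hz⟩ := hu.pendulum hc
  have hne : {t : ℝ | IsSwitch u t}.Nonempty := by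
    rw [← encard_ne_zero, hs]
    exact_mod_cast (by omega : 2 * m ≠ 0)
  obtain ⟨t₀, ht₀⟩ := hne
  have h01 : u 1 = u 0 := by
    have := hp.sub_eq
    rw [show 2 * γ * Sx u 1 * Sz u 1 = 2 * Sx u 1 * (γ * Sz u 1) by ring, hz, mul_zero] at this
    linarith
  obtain ⟨hε, hk, n, hn, hI, hJ⟩ := hp.structure hu.2.1 h01 hu0 ht₀.1 (ht₀.eq_zero hc)
  have hnm : n = m := by
    rw [hs] at hn
    have : 2 * m = 2 * n := by exact_mod_cast hn
    omega
  subst hnm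
  have hγ0 : 0 < γ := lt_of_le_of_ne hγ fun h => by rw [← h] at hε; simp at hε
  have hS : 0 < Sx u 1 := by
    by_contra hcon
    nlinarith [mul_nonneg hγ0.le (neg_nonneg.2 (not_lt.1 hcon))]
  have hz' : Sz u 1 = 0 := (mul_eq_zero.1 hz).resolve_left hγ0.ne'
  set ε := 2 * γ * Sx u 1 with hεd
  set k := u 0 ^ 2 / ε with hkd
  have hs0 : 0 < √ε := sqrt_pos.2 hε
  have hs2 := sq_sqrt hε.le
  have hm1 : (1 : ℝ) ≤ n := by exact_mod_cast hm
  refine ⟨k, hγ0, hS, rfl, hk.1, hk.2, hI, ?_, ?_, ?_, ?_⟩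
  · rw [hI, hJ, eq_div_iff (by positivity)]
    linear_combination (-√ε) * hs2 + √ε * hεd
  · have hk2 : u 0 ^ 2 = ε * k := by rw [hkd]; field_simp
    rw [hp.cost_eq hz' hεd, Cplus, hI, hJ, hk2]
    linear_combination (-k / 2 - 3 / 4 * Sx u 1) * hs2
  · exact Cplus_ge hk n (by rw [hJ]; positivity)
  · have h9 : (9 : ℝ) ≤ (2 * (n : ℝ) + 1) ^ 2 := by nlinarith
    linarith [mul_le_mul_of_nonneg_right h9 pi_pos.le]

/-! ### The simplest extremal and its optimality -/

/-- The variance of `u` on the unit interval is nonnegative, and so is the sensitivity term. -/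
theorem IsControl.half_sq_le_cost {u : ℝ → ℝ} (hu : IsControl u) {γ : ℝ} (hγ : 0 ≤ γ) :
    angle u 1 ^ 2 / 2 ≤ cost γ u := by
  have h0 : 0 ≤ ∫ t in 0..1, (u t - angle u 1) ^ 2 :=
    intervalIntegral.integral_nonneg zero_le_one fun t _ => sq_nonneg _
  have e : ∫ t in 0..1, (u t - angle u 1) ^ 2 = (∫ t in 0..1, u t ^ 2) - angle u 1 ^ 2 := by
    have i1 := hu.intervalIntegrable_sq
    have i2 := hu.intervalIntegrable.const_mul (2 * angle u 1)
    have : ∫ t in 0..1, (u t - angle u 1) ^ 2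
        = ∫ t in 0..1, (u t ^ 2 - 2 * angle u 1 * u t + angle u 1 ^ 2) :=
      intervalIntegral.integral_congr fun t _ => by ring
    rw [this, intervalIntegral.integral_add (i1.sub i2) (by simp),
      intervalIntegral.integral_sub i1 i2, intervalIntegral.integral_const_mul]
    change _ - 2 * angle u 1 * angle u 1 + _ = _
    simp; ring
  have h2 : 0 ≤ γ * ((1 / 2) * (Sz u 1 ^ 2 + Sx u 1 ^ 2)) := by positivity
  rw [cost]
  linarith

theorem angle_neg (u : ℝ → ℝ) (t : ℝ) : angle (-u) t = -angle u t := by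
  simp [angle]

theorem cost_neg (γ : ℝ) (u : ℝ → ℝ) : cost γ (-u) = cost γ u := by
  have h1 : Sz (-u) 1 = Sz u 1 := by simp [Sz, angle_neg]
  have h2 : Sx (-u) 1 = -Sx u 1 := by simp [Sx, angle_neg]
  simp [cost, h1, h2]

theorem IsControl.neg {u : ℝ → ℝ} (hu : IsControl u) : IsControl (-u) :=
  ⟨hu.measurable.neg, by simpa using hu.bounded⟩

/-- A path with a cost below `3 π` that is optimal for the target `π / 2` is optimal for all
NOT gates. -/
theorem optimal_of_optimal {γ C : ℝ} (hγ : 0 ≤ γ) (hC : C < 3 * π)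
    (h : ∀ u, IsControl u → angle u 1 = π / 2 → C ≤ cost γ u) {u : ℝ → ℝ} (hu : IsControl u)
    (hn : ∃ n : ℤ, angle u 1 = π / 2 + n * π) : C ≤ cost γ u := by
  obtain ⟨n, hn⟩ := hn
  have hhalf := hu.half_sq_le_cost hγ
  -- Every target other than `±π/2` has `|θ(1)| ≥ 3π/2`, so the energy alone is at least `9π²/8 >
  -- 3π`.
  have hfar : (3 / 2 * π) ^ 2 ≤ angle u 1 ^ 2 → C ≤ cost γ u := fun h => by
    nlinarith [pi_gt_three]
  rcases lt_trichotomy n 0 with h0 | h0 | h0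
  · rcases eq_or_ne n (-1) with h1 | h1
    · rw [← cost_neg]
      refine h _ hu.neg ?_
      rw [angle_neg, hn, h1]; push_cast; ring
    · have h2 : (n : ℝ) ≤ -2 := by exact_mod_cast (by omega : n ≤ -2)
      rw [← neg_sq (angle u 1)] at hfar
      refine hfar (pow_le_pow_left₀ (by positivity) ?_ 2)
      rw [hn]
      nlinarith [pi_pos]
  · refine h u hu ?_
    rw [hn, h0]; simp
  · have h2 : (1 : ℝ) ≤ n := by exact_mod_cast h0
    refine hfar (pow_le_pow_left₀ (by positivity) ?_ 2)
    rw [hn]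
    nlinarith [pi_pos]

/-- The trajectory of the simplest extremal, and its optimality for the target `π / 2`. -/
theorem exists_simplest {γ : ℝ} (hγ : 0 ≤ γ) :
    ∃ u, SimplestParams γ (u 0) (Sx u 1) ∧ IsPendulum (2 * γ * Sx u 1) u ∧ angle u 1 = π / 2 ∧
      γ * Sz u 1 = 0 ∧ ∀ v, IsControl v → angle v 1 = π / 2 → cost γ u ≤ cost γ v := by
  rcases hγ.eq_or_lt with h0 | h0
  · subst h0
    have hang : ∀ t, angle (fun _ => π / 2) t = t * (π / 2) := fun t => by simp [angle]; ring
    have hS : Sx (fun _ => π / 2) 1 = 2 / π := by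
      simp only [Sx, hang]
      rw [show (fun s : ℝ => sin (2 * (s * (π / 2)))) = fun s => sin (π * s) by
        ext s; congr 1; ring, intervalIntegral.integral_comp_mul_left _ pi_ne_zero]
      simp [integral_sin]; ring
    refine ⟨fun _ => π / 2, Or.inl ⟨rfl, rfl, hS⟩, fun t _ => ?_, by simp [angle], by simp,
      fun v hv h1 => ?_⟩
    · simpa using hasDerivWithinAt_const t (Icc (0 : ℝ) 1) (π / 2)
    · have := hv.half_sq_le_cost le_rfl
      rw [h1] at this
      refine le_trans (le_of_eq ?_) this
      simp [cost]; ring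
  · rcases le_or_gt γ γc with hc | hc
    · obtain ⟨k, hk, hkγ⟩ := exists_ellI_param h0 hc
      obtain ⟨u, hp, hu0, hz, h1, hS⟩ := exists_monotone_path hk
      have hI := ellI_pos hk
      have hJ := ellJ_pos hk
      have hε : ellI k ^ 2 = 2 * γ * Sx u 1 := by rw [hS, hkγ]; field_simp
      refine ⟨u, Or.inr (Or.inl ⟨h0, hc, k, hk, hkγ, hu0, hS⟩), hε ▸ hp, h1, by rw [hz, mul_zero],
        fun v hv hv1 => le_trans (le_of_eq ?_) (hv.cost_ge_of_ellI hv1 h0 hk)⟩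
      -- With `ε = 2γS` the term lost in completing the square is `εS/4`, and the lower bound
      -- becomes `kI²/2 + (3/4)IJ`, the cost of this path.
      have e : (ellI k ^ 2) ^ 2 / (8 * γ) = ellI k ^ 2 * Sx u 1 / 4 := by
        rw [sq (ellI k ^ 2)]
        nth_rewrite 2 [hε]
        field_simp; ring
      rw [hp.cost_eq hz hε, e, hu0, hS, zeroAction_eq hk, mul_pow, sq_sqrt hk]
      field_simp
      ring
    · obtain ⟨k, hk, hJ, hkγ⟩ := exists_Ione_param hc
      obtain ⟨u, hp, hu0, hz, h1, hS⟩ := exists_turning_path (Ioo_subset_Ico_self hk)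
      have hI := Ione_pos hk.1.le
      have hε : Ione k ^ 2 = 2 * γ * Sx u 1 := by rw [hS, hkγ]; field_simp
      refine ⟨u, Or.inr (Or.inr ⟨hc, k, hk.1, hk.2, hkγ, hu0, ?_⟩), hε ▸ hp, h1,
        by rw [hz, mul_zero],
        fun v hv hv1 => le_trans (le_of_eq ?_) (hv.cost_ge_of_Ione hv1 h0 (Ioo_subset_Ico_self hk))⟩
      · rw [hε]; field_simp
      have e : (Ione k ^ 2) ^ 2 / (8 * γ) = Ione k ^ 2 * Sx u 1 / 4 := by
        rw [sq (Ione k ^ 2)]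
        nth_rewrite 2 [hε]
        field_simp; ring
      rw [hp.cost_eq hz hε, e, hu0, hS, turnAction_eq hk.1.le hk.2, neg_sq, mul_pow,
        sq_sqrt hk.1.le]
      field_simp
      ring

theorem SimplestParams.unique {γ c S c' S' : ℝ} (h : SimplestParams γ c S)
    (h' : SimplestParams γ c' S') : c = c' ∧ S = S' := by
  have hγc := γc_pos
  rcases h with ⟨h0, hc, hS⟩ | ⟨h0, h1, k, hk, hkγ, hc, hS⟩ | ⟨h1, k, hk, hk1, hkγ, hc, hS⟩ <;>
    rcases h' with ⟨h0', hc', hS'⟩ | ⟨h0', h1', k', hk', hkγ', hc', hS'⟩ |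
      ⟨h1', k', hk', hk1', hkγ', hc', hS'⟩ <;> try (exfalso; linarith)
  · exact ⟨hc.trans hc'.symm, hS.trans hS'.symm⟩
  · obtain rfl := ellI_param_unique h0 hk hk' hkγ hkγ'
    exact ⟨hc.trans hc'.symm, hS.trans hS'.symm⟩
  · obtain rfl := Ione_param_unique (hγc.trans h1) ⟨hk, hk1⟩ ⟨hk', hk1'⟩ hkγ hkγ'
    exact ⟨hc.trans hc'.symm, hS.trans hS'.symm⟩

/-- The limiting path has vanishing sensitivity. -/
theorem exists_limit_path {k : ℝ} (hk : k ∈ Ioo (0 : ℝ) 1) (hJ : Jone k = 0) :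
    ∃ u, IsControl u ∧ angle u 1 = π / 2 ∧ ∀ γ, cost γ u = 1 / 2 * k * Ione k ^ 2 := by
  obtain ⟨u, hp, hu0, hz, h1, hS⟩ := exists_turning_path (Ioo_subset_Ico_self hk)
  rw [hJ, zero_div] at hS
  refine ⟨u, hp.isControl, h1, fun γ => ?_⟩
  rw [cost, hp.integral_sq, hz, hS, hu0, neg_sq, mul_pow, sq_sqrt hk.1.le]
  ring

end NotGate

theorem proposition3p5 :
    ∃ kLim U : ℝ,
      -- the limiting cost `U` of the simplest extremals
      (∀ k ∈ Set.Ioo (0 : ℝ) 1, NotGate.Jone k = 0 ↔ k = kLim) ∧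
      kLim ∈ Set.Ioo (0 : ℝ) 1 ∧
      U = 1 / 2 * kLim * NotGate.Ione kLim ^ 2 ∧
      3 * Real.pi > U ∧
      ∀ γ : ℝ, 0 ≤ γ → ∃ us : ℝ → ℝ,
        -- `us` is the control of the simplest extremal, which exists and is unique
        NotGate.IsSimplest γ us ∧
        (∀ v : ℝ → ℝ, NotGate.IsSimplest γ v → Set.EqOn v us (Set.Icc 0 1)) ∧
        NotGate.IsExtremal γ us ∧
        NotGate.SimplestParams γ (us 0) (NotGate.Sx us 1) ∧
        NotGate.cost γ us ≤ U ∧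
        -- extremals with `c = u(0) ≥ 0`
        (∀ u : ℝ → ℝ, NotGate.IsExtremal γ u → ContinuousOn u (Set.Icc 0 1) → 0 ≤ u 0 →
          (∀ m : ℕ, 1 ≤ m → {t : ℝ | NotGate.IsSwitch u t}.encard = 2 * m →
            ∃ k : ℝ, 0 < γ ∧ 0 < NotGate.Sx u 1 ∧
              k = u 0 ^ 2 / (2 * γ * NotGate.Sx u 1) ∧ 0 ≤ k ∧ k < 1 ∧
              NotGate.Iplus m k = Real.sqrt (2 * γ * NotGate.Sx u 1) ∧
              2 * γ = NotGate.Iplus m k ^ 3 / NotGate.Jplus m k ∧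
              NotGate.cost γ u = NotGate.Cplus m k ∧
              NotGate.Cplus m k ≥ (2 * (m : ℝ) + 1) ^ 2 * Real.pi / 3 ∧
              (2 * (m : ℝ) + 1) ^ 2 * Real.pi / 3 ≥ 3 * Real.pi) ∧
          NotGate.cost γ us ≤ NotGate.cost γ u) ∧
        -- optimality of the simplest extremal among all controls that realize a NOT gate
        (∀ u : ℝ → ℝ, NotGate.IsControl u →
          (∃ n : ℤ, NotGate.angle u 1 = Real.pi / 2 + n * Real.pi) →
          NotGate.cost γ us ≤ NotGate.cost γ u) := by
  obtain ⟨l, hl, hl0⟩ := NotGate.exists_Jone_eq_zero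
  have hU := NotGate.half_mul_sq_lt_three_pi hl hl0
  refine ⟨l, _, fun k hk => ⟨fun h => ?_, fun h => h ▸ hl0⟩, hl, rfl, hU, fun γ hγ => ?_⟩
  · exact NotGate.strictAntiOn_Jone.injOn (Ioo_subset_Ico_self hk) (Ioo_subset_Ico_self hl)
      (h.trans hl0.symm)
  · obtain ⟨us, hs, hp, h1, hz, hopt⟩ := NotGate.exists_simplest hγ
    -- A competitor whose cost is `U` for every `γ`; optimality for the target `π/2` turns it into
    -- the uniform bound on the simplest extremal.
    obtain ⟨w, hw, hw1, hwU⟩ := NotGate.exists_limit_path hl hl0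
    have hle := hwU γ ▸ hopt w hw hw1
    refine ⟨us, ⟨_, _, hs, rfl, hp⟩, ?_, hp.isExtremal hz h1, hs, hle, fun u hu hc hu0 =>
      ⟨fun m hm hsw => hu.of_switches hγ hc hu0 hm hsw, hopt u hu.1 hu.2.1⟩,
      fun u hu hn => NotGate.optimal_of_optimal hγ (hle.trans_lt hU) hopt hu hn⟩
    rintro v ⟨c, S, hv, hv0, hvp⟩
    obtain ⟨hc, hS⟩ := hv.unique hs
    rw [hS] at hvp
    exact NotGate.IsPendulum.eqOn hvp hp (hv0.trans hc)
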